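/- **Setting.** Let $n,\mu\ge 1$ be integers and let $\{\xi(m):m\in\mathbb Z\}$ be a sequence of complex random variables with wide-sense stationary $n$th increments $$\xi^{(n)}(m,\nu)=\sum_{l=0}^{n}(-1)^l\binom nl\,\xi(m-l\nu),\qquad m,\nu\in\mathbb Z,$$ that is, the increments are square integrable and $\mathsf E\,\xi^{(n)}(m_0,\nu)$ and $\mathsf E\,\xi^{(n)}(m_0+m,\nu_1)\overline{\xi^{(n)}(m_0,\nu_2)}$ do not depend on $m_0$. Let the increments have mean zero and spectral density $f$ with respect to $d\lambda/2\pi$: $$\mathsf E\,\xi^{(n)}(m_0+m,\nu_1)\overline{\xi^{(n)}(m_0,\nu_2)}=\frac1{2\pi}\int_{-\pi}^{\pi}e^{i\lambda m}(1-e^{-i\nu_1\lambda})^n(1-e^{i\nu_2\lambda})^n\frac{f(\lambda)}{\lambda^{2n}}\,d\lambda .$$ Suppose that $f(\lambda)=|\Phi(e^{-i\lambda})|^2$ for almost every $\lambda\in[-\pi,\pi)$, where $\Phi(z)=\sum_{k\ge0}\varphi(k)z^k$ has radius of convergence greater than $1$ and no zeros in $\{|z|\le1\}$. Let $a(k)\in\mathbb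 C$, $k\ge0$. Define $d_\mu$ by $\sum_{k\ge0}d_\mu(k)x^k=\bigl(\sum_{j\ge0}x^{\mu j}\bigr)^n$, and infinite matrices by $D^\mu_{k,j}=d_\mu(j-k)$ for $k\le j$, $D^\mu_{k,j}=0$ for $j<k$, and $A_{k,j}=a(k+j)$. Infinite series of numbers are understood as limits of partial sums. Suppose that the series defining $b_\mu=D^\mu a$, $b_\mu(k)=\sum_{m\ge k}a(m)d_\mu(m-k)$, converge, that $\sum_k|b_\mu(k)|<\infty$ and $\sum_k(k+1)|b_\mu(k)|^2<\infty$, and that the series $A\xi=\sum_{k\ge0}a(k)\xi(k)$ converges in mean square, meaning that $\mathsf E\bigl|\sum_{k<N}a(k)\xi(k)-A\xi\bigr|^2\to0$. Put $$v_\mu(k)=\sum_{l=\lceil -k/\mu\rceil}^{n}(-1)^l\binom nl\,b_\mu(l\mu+k),\qquad -\mu n\le k\le-1.$$ Let $H^t(\xi^{(n)})$ be the closed subspace of $L^2(\Omega)$ generated by $\xi^{(n)}(m,\nu)$, $m\le t$, $\nu>0$. * A *random spectral measure* is a family $Z$ of elements of $L^2(\Omega)$, indexed by Borel sets, with $\mathsf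 E\,Z(B_1)\overline{Z(B_2)}=\frac1{2\pi}\int_{B_1\cap B_2\cap[-\pi,\pi)}f\,d\lambda$ and $\xi^{(n)}(m,\nu)=\int_{-\pi}^{\pi}e^{i\lambda m}(1-e^{-i\nu\lambda})^n(i\lambda)^{-n}dZ(\lambda)$ for all $m,\nu\in\mathbb Z$. * A *canonical moving average representation* consists of $\varepsilon(m)\in L^2(\Omega)$, $m\in\mathbb Z$, and $\varphi_\mu\in\ell_2$ such that the $\varepsilon(m)$ are uncorrelated with mean $0$ and variance $1$, for every $t$ the closed subspace generated by $\varepsilon(m)$, $m\le t$, is $H^t(\xi^{(n)})$, and $\xi^{(n)}(m,\mu)=\sum_{k\ge0}\varphi_\mu(k)\varepsilon(m-k)$ in $L^2(\Omega)$ for every $m$. Then $\Phi_\mu(z)=\sum_{k\ge0}\varphi_\mu(k)z^k$. A *linear estimate whose error is formed from increments* is a mean square limit $Y$ of finite linear combinations $Y_j$ of the observations $\xi(m)$, $m\le-1$, such that for some integers $N_j\to\infty$ the linear form $\sum_{k<N_j}a(k)\xi(k)-Y_j$ is, as a formal linear combination of the symbols $\xi(m)$, a finite linear combination of $n$th increments.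 An estimate is *optimal* in a class if it belongs to the class and has the least mean square error for $A\xi$ there. **Theorem.** A random spectral measure $Z$ and a canonical moving average representation exist. For every choice of them, $\sum_k|\varphi_\mu(k)|<\infty$, the series defining the matrix product $D^\mu A$ and the vector $r_\mu=D^\mu A\varphi_\mu$ converge, $\sum_k|r_\mu(k)|<\infty$, and the following holds with $$h_\mu^{(a)}(\lambda)=A(e^{i\lambda})-r_\mu^{(a)}(e^{i\lambda})\,\Phi_\mu^{-1}(e^{-i\lambda}),\qquad A(e^{i\lambda})=\sum_{k\ge0}(D^\mu a)_k e^{i\lambda k},\qquad r_\mu^{(a)}(e^{i\lambda})=\sum_{j\ge0}(D^\mu A\varphi_\mu)_j e^{i\lambda j},$$ $$\hat A\xi=-\sum_{k=-\mu n}^{-1}v_\mu(k)\xi(k)+\int_{-\pi}^{\pi}h_\mu^{(a)}(\lambda)\frac{(1-e^{-i\lambda\mu})^n}{(i\lambda)^n}\,dZ(\lambda),$$ where the integrand belongs to $L^2(f)$. 1. $\hat A\xi$ is, up to almost sure equality, the unique optimal estimate of $A\xi$ among the linear estimates from $\xi(m)$, $m\le-1$, whose error is formed from increments. 2. If in addition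 $\xi(-n),\dots,\xi(-1)$ are square integrable and orthogonal to all increments $\xi^{(n)}(m,\nu)$, then $\hat A\xi$ is, up to almost sure equality, the unique optimal estimate among all mean square limits of finite linear combinations of $\xi(m)$, $m\le-1$. 3. The mean square error is finite and $$\mathsf E|A\xi-\hat A\xi|^2=\frac1{2\pi}\int_{-\pi}^{\pi}|r_\mu^{(a)}(e^{i\lambda})|^2d\lambda=\|D^\mu A\varphi_\mu\|^2=\sum_{j\ge0}|(D^\mu A\varphi_\mu)_j|^2 .$$ -/

import Mathlib

open MeasureTheory Filter Topology

noncomputable section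

namespace StatIncr

/-! Increments of a sequence and linear forms in its values. -/

/-- The `n`th increment with step `ν`:
`ξ⁽ⁿ⁾(m, ν) = ∑_{l=0}^n (-1)^l C(n,l) ξ(m - l ν)`. -/
def increment {Ω : Type*} (n : ℕ) (ξ : ℤ → Ω → ℂ) (m ν : ℤ) : Ω → ℂ :=
  fun ω => ∑ l ∈ Finset.range (n + 1), (-1 : ℂ) ^ l * (n.choose l : ℂ) * ξ (m - l * ν) ω

/-- The random variable `∑ c(m) ξ(m)` given by a finitely supported family of coefficients. -/
def linComb {Ω : Type*} (ξ : ℤ → Ω → ℂ) (c : ℤ →₀ ℂ) : Ω → ℂ :=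
  fun ω => c.sum fun m z => z * ξ m ω

/-- The coefficients of the `n`th increment at `m` with step `ν`. -/
def incrementForm (n : ℕ) (m ν : ℤ) : ℤ →₀ ℂ :=
  ∑ l ∈ Finset.range (n + 1),
    Finsupp.single (m - l * ν) ((-1 : ℂ) ^ l * (n.choose l : ℂ))

/-- The coefficients of all finite linear combinations of `n`th increments. -/
def incrementForms (n : ℕ) : Submodule ℂ (ℤ →₀ ℂ) :=
  Submodule.span ℂ {c | ∃ m ν : ℤ, c = incrementForm n m ν}

/-- The coefficients of the partial sum `∑_{k<N} a(k) ξ(k)`. -/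
def truncForm (a : ℕ → ℂ) (N : ℕ) : ℤ →₀ ℂ :=
  ∑ k ∈ Finset.range N, Finsupp.single (k : ℤ) (a k)

theorem linComb_sum_single {Ω ι : Type*} (ξ : ℤ → Ω → ℂ) (s : Finset ι) (p : ι → ℤ)
    (z : ι → ℂ) :
    linComb ξ (∑ i ∈ s, Finsupp.single (p i) (z i)) = fun ω => ∑ i ∈ s, z i * ξ (p i) ω := by
  classical
  funext ω
  unfold linComb
  rw [← Finsupp.sum_finsetSum_index (fun _ => by simp) (fun _ _ _ => by ring)]
  refine Finset.sum_congr rfl fun i _ => ?_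
  rw [Finsupp.sum_single_index (by simp)]

theorem linComb_incrementForm {Ω : Type*} (n : ℕ) (ξ : ℤ → Ω → ℂ) (m ν : ℤ) :
    linComb ξ (incrementForm n m ν) = increment n ξ m ν :=
  linComb_sum_single ξ _ _ _

theorem linComb_truncForm {Ω : Type*} (ξ : ℤ → Ω → ℂ) (a : ℕ → ℂ) (N : ℕ) :
    linComb ξ (truncForm a N) = fun ω => ∑ k ∈ Finset.range N, a k * ξ k ω :=
  linComb_sum_single ξ _ _ _

/-! Second order structure. -/

section Probability

variable {Ω : Type*} [MeasurableSpace Ω]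

/-- `ξ` has wide sense stationary `n`th increments: the first and second moments of the
increments exist, and `E ξ⁽ⁿ⁾(m₀, ν)` and `E ξ⁽ⁿ⁾(m₀ + m, ν₁) conj ξ⁽ⁿ⁾(m₀, ν₂)`
do not depend on `m₀`. -/
structure HasStationaryIncrements (P : Measure Ω) (n : ℕ) (ξ : ℤ → Ω → ℂ) : Prop where
  memLp : ∀ m ν : ℤ, MemLp (increment n ξ m ν) 2 P
  mean : ∀ m₀ m₁ ν : ℤ, ∫ ω, increment n ξ m₀ ν ω ∂P = ∫ ω, increment n ξ m₁ ν ω ∂P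
  covariance : ∀ m₀ m₁ m ν₁ ν₂ : ℤ,
    ∫ ω, increment n ξ (m₀ + m) ν₁ ω * starRingEnd ℂ (increment n ξ m₀ ν₂ ω) ∂P =
      ∫ ω, increment n ξ (m₁ + m) ν₁ ω * starRingEnd ℂ (increment n ξ m₁ ν₂ ω) ∂P

/-- The increment `ξ⁽ⁿ⁾(m, ν)` as an element of the Hilbert space `L²(Ω)`. -/
def HasStationaryIncrements.incr {P : Measure Ω} {n : ℕ} {ξ : ℤ → Ω → ℂ}
    (h : HasStationaryIncrements P n ξ) (m ν : ℤ) : Lp ℂ 2 P :=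
  (h.memLp m ν).toLp (increment n ξ m ν)

/-- `Hᵗ(ξ⁽ⁿ⁾)`: the closed subspace generated by `ξ⁽ⁿ⁾(m, ν)`, `m ≤ t`, `ν > 0`. -/
def HasStationaryIncrements.past {P : Measure Ω} {n : ℕ} {ξ : ℤ → Ω → ℂ}
    (h : HasStationaryIncrements P n ξ) (t : ℤ) : Submodule ℂ (Lp ℂ 2 P) :=
  (Submodule.span ℂ {x | ∃ m ν : ℤ, m ≤ t ∧ 0 < ν ∧ x = h.incr m ν}).topologicalClosure

/-- `Hᵗ(ε)`: the closed subspace generated by `ε(m)`, `m ≤ t`. -/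
def pastOf {P : Measure Ω} (ε : ℤ → Lp ℂ 2 P) (t : ℤ) : Submodule ℂ (Lp ℂ 2 P) :=
  (Submodule.span ℂ {x | ∃ m : ℤ, m ≤ t ∧ x = ε m}).topologicalClosure

/-- `f` is the spectral density (with respect to `dθ / 2π` on `[-π, π)`) of the `n`th increments:
the structural function is
`∫ e^{iθm} (1 - e^{-iν₁θ})ⁿ (1 - e^{iν₂θ})ⁿ θ^{-2n} f(θ) dθ / 2π`. -/
def IsSpectralDensity (P : Measure Ω) (n : ℕ) (ξ : ℤ → Ω → ℂ) (f : ℝ → ℝ) : Prop :=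
  ∀ m₀ m ν₁ ν₂ : ℤ,
    ∫ ω, increment n ξ (m₀ + m) ν₁ ω * starRingEnd ℂ (increment n ξ m₀ ν₂ ω) ∂P =
      (1 / (2 * Real.pi) : ℂ) * ∫ θ in Set.Ico (-Real.pi) Real.pi,
        Complex.exp (Complex.I * θ * m) * (1 - Complex.exp (-Complex.I * ν₁ * θ)) ^ n *
          (1 - Complex.exp (Complex.I * ν₂ * θ)) ^ n * (1 / (θ : ℂ) ^ (2 * n)) * (f θ : ℂ)

/-- The spectral measure `dF = f(θ) dθ / 2π` on `[-π, π)`. -/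
def spectralMeasure (f : ℝ → ℝ) : Measure ℝ :=
  (volume.restrict (Set.Ico (-Real.pi) Real.pi)).withDensity
    fun θ => ENNReal.ofReal (f θ / (2 * Real.pi))

/-- The canonical factorization `f(θ) = |Φ(e^{-iθ})|²`, `Φ(z) = ∑ φ(k) z^k`, where the power
series has radius of convergence greater than 1 and no zeros in the closed unit disk. -/
structure IsCanonicalFactorization (f : ℝ → ℝ) (φ : ℕ → ℂ) : Prop where
  radius : 1 < (FormalMultilinearSeries.ofScalars ℂ φ).radius
  ne_zero : ∀ z : ℂ, ‖z‖ ≤ 1 → ∑' k, φ k * z ^ k ≠ 0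
  eq : ∀ᵐ θ : ℝ ∂(volume.restrict (Set.Ico (-Real.pi) Real.pi)),
    f θ = ‖∑' k, φ k * Complex.exp (-Complex.I * θ) ^ k‖ ^ 2

/-! Orthogonal stochastic measures and stochastic integrals. -/

/-- `Z` is an orthogonal stochastic measure with structure measure `F`:
`E Z(A) conj Z(B) = F(A ∩ B)`. -/
def IsOrthogonalMeasure {P : Measure Ω} (F : Measure ℝ) (Z : Set ℝ → Lp ℂ 2 P) : Prop :=
  ∀ A B : Set ℝ, MeasurableSet A → MeasurableSet B →
    ∫ ω, Z A ω * starRingEnd ℂ (Z B ω) ∂P = ((F (A ∩ B)).toReal : ℂ)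

/-- The stochastic integral of a simple function. -/
def simpleIntegral {P : Measure Ω} (Z : Set ℝ → Lp ℂ 2 P) (s : SimpleFunc ℝ ℂ) : Lp ℂ 2 P :=
  ∑ z ∈ s.range, z • Z (s ⁻¹' {z})

/-- `J = ∫ g dZ`: `J` is the mean square limit of the integrals of simple functions which
converge to `g` in `L²(F)`. -/
def IsStochasticIntegral {P : Measure Ω} (F : Measure ℝ) (Z : Set ℝ → Lp ℂ 2 P)
    (g : ℝ → ℂ) (J : Lp ℂ 2 P) : Prop :=
  MemLp g 2 F ∧ ∃ s : ℕ → SimpleFunc ℝ ℂ,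
    Tendsto (fun j => eLpNorm (fun θ => s j θ - g θ) 2 F) atTop (𝓝 0) ∧
    Tendsto (fun j => simpleIntegral Z (s j)) atTop (𝓝 J)

/-- The function `(1 - e^{-iθν})ⁿ / (iθ)ⁿ`. -/
def kernel (n : ℕ) (ν : ℤ) (θ : ℝ) : ℂ :=
  (1 - Complex.exp (-Complex.I * θ * ν)) ^ n * (1 / (Complex.I * θ) ^ n)

/-- `Z` is the random spectral measure of the `n`th increments:
`ξ⁽ⁿ⁾(m, ν) = ∫ e^{iθm} (1 - e^{-iνθ})ⁿ (iθ)^{-n} dZ(θ)`. -/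
structure IsSpectralRepresentation {P : Measure Ω} {n : ℕ} {ξ : ℤ → Ω → ℂ}
    (h : HasStationaryIncrements P n ξ) (f : ℝ → ℝ) (Z : Set ℝ → Lp ℂ 2 P) : Prop where
  orthogonal : IsOrthogonalMeasure (spectralMeasure f) Z
  integral : ∀ m ν : ℤ, IsStochasticIntegral (spectralMeasure f) Z
    (fun θ => Complex.exp (Complex.I * θ * m) * kernel n ν θ) (h.incr m ν)

/-- The canonical one-sided moving average representation
`ξ⁽ⁿ⁾(m, μ) = ∑_{k ≥ 0} φ_μ(k) ε(m - k)`, where `ε` is an innovation sequence: its members have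
mean zero and unit variance, are uncorrelated, and `Hᵗ(ξ⁽ⁿ⁾) = Hᵗ(ε)` for all `t`. -/
structure IsCanonicalMovingAverage {P : Measure Ω} {n : ℕ} {ξ : ℤ → Ω → ℂ}
    (h : HasStationaryIncrements P n ξ) (μ : ℕ) (ε : ℤ → Lp ℂ 2 P) (φμ : ℕ → ℂ) : Prop where
  mean : ∀ m, ∫ ω, ε m ω ∂P = 0
  orthonormal : Orthonormal ℂ ε
  innovation : ∀ t, h.past t = pastOf ε t
  square_summable : Summable fun k => ‖φμ k‖ ^ 2
  hasSum : ∀ m : ℤ, HasSum (fun k : ℕ => φμ k • ε (m - k)) (h.incr m μ)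

/-! Linear estimates. -/

/-- `Aξ = ∑_{k ≥ 0} a(k) ξ(k)` as a mean square limit of the partial sums. -/
def IsFunctional (P : Measure Ω) (ξ : ℤ → Ω → ℂ) (a : ℕ → ℂ) (Aξ : Ω → ℂ) : Prop :=
  AEStronglyMeasurable Aξ P ∧
    Tendsto (fun N => eLpNorm (fun ω => (∑ k ∈ Finset.range N, a k * ξ k ω) - Aξ ω) 2 P)
      atTop (𝓝 0)

/-- `Y` is a mean square limit of finite linear combinations of `ξ(m)`, `m ≤ -1`. -/
def IsLinearEstimate (P : Measure Ω) (ξ : ℤ → Ω → ℂ) (Y : Ω → ℂ) : Prop :=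
  AEStronglyMeasurable Y P ∧ ∃ c : ℕ → ℤ →₀ ℂ,
    (∀ j, ∀ m ∈ (c j).support, m ≤ -1) ∧
    Tendsto (fun j => eLpNorm (fun ω => linComb ξ (c j) ω - Y ω) 2 P) atTop (𝓝 0)

/-- `Y` is a linear estimate of `∑ a(k) ξ(k)` from `ξ(m)`, `m ≤ -1`, whose error is formed
from `n`th increments: `Y` is a mean square limit of finite linear combinations `Y_j` of the
observations such that, for some `N_j → ∞`, the linear form `∑_{k < N_j} a(k) ξ(k) - Y_j` is a
finite linear combination of `n`th increments. -/
def IsIncrementEstimate (P : Measure Ω) (n : ℕ) (ξ : ℤ → Ω → ℂ) (a : ℕ → ℂ) (Y : Ω → ℂ) :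
    Prop :=
  AEStronglyMeasurable Y P ∧ ∃ (N : ℕ → ℕ) (c : ℕ → ℤ →₀ ℂ),
    Tendsto N atTop atTop ∧
    (∀ j, ∀ m ∈ (c j).support, m ≤ -1) ∧
    (∀ j, truncForm a (N j) - c j ∈ incrementForms n) ∧
    Tendsto (fun j => eLpNorm (fun ω => linComb ξ (c j) ω - Y ω) 2 P) atTop (𝓝 0)

/-- `Y` has the least mean square error for `X` among all members of the class `C`. -/
def IsOptimalIn (P : Measure Ω) (C : (Ω → ℂ) → Prop) (X Y : Ω → ℂ) : Prop :=
  C Y ∧ ∀ Y', C Y' → eLpNorm (fun ω => X ω - Y ω) 2 P ≤ eLpNorm (fun ω => X ω - Y' ω) 2 P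

/-- The starting values `ξ(-n), …, ξ(-1)` have second moments and are orthogonal to all `n`th
increments. -/
def OrthogonalStart (P : Measure Ω) (n : ℕ) (ξ : ℤ → Ω → ℂ) : Prop :=
  ∀ i : ℤ, -(n : ℤ) ≤ i → i ≤ -1 → MemLp (ξ i) 2 P ∧
    ∀ m ν : ℤ, ∫ ω, ξ i ω * starRingEnd ℂ (increment n ξ m ν ω) ∂P = 0

end Probability

/-! Infinite matrices and coefficients. -/

/-- Convergence of the partial sums of a series. -/
def SeriesTo (u : ℕ → ℂ) (s : ℂ) : Prop :=
  Tendsto (fun N => ∑ i ∈ Finset.range N, u i) atTop (𝓝 s)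

/-- `y = M x` for an infinite matrix `M`. -/
def IsMulVec (M : ℕ → ℕ → ℂ) (x y : ℕ → ℂ) : Prop :=
  ∀ k, SeriesTo (fun j => M k j * x j) (y k)

/-- `K = M L` for infinite matrices. -/
def IsMatMul (M L K : ℕ → ℕ → ℂ) : Prop :=
  ∀ k j, SeriesTo (fun l => M k l * L l j) (K k j)

/-- The coefficients of `(∑_j x^{μj})ⁿ = ∑_k d_μ(k) x^k`. -/
def dCoeff (n μ : ℕ) (k : ℕ) : ℂ :=
  PowerSeries.coeff k ((PowerSeries.mk fun j => if μ ∣ j then (1 : ℂ) else 0) ^ n)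

/-- The matrix `D^μ`, with entries `d_μ(j - k)` for `k ≤ j` and `0` for `j < k`. -/
def dMatrix (n μ : ℕ) (k j : ℕ) : ℂ := if k ≤ j then dCoeff n μ (j - k) else 0

/-- The matrix `A`, with entries `a(k + j)`. -/
def hankel (a : ℕ → ℂ) (k j : ℕ) : ℂ := a (k + j)

/-- `v_μ(-i) = ∑_{l=⌈i/μ⌉}^n (-1)^l C(n,l) b_μ(lμ - i)`. -/
def vCoeff (n μ : ℕ) (b : ℕ → ℂ) (i : ℕ) : ℂ :=
  ∑ l ∈ Finset.Icc ⌈(i : ℚ) / (μ : ℚ)⌉₊ n, (-1 : ℂ) ^ l * (n.choose l : ℂ) * b (l * μ - i)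

/-- `∑_{k ≥ 0} x(k) z^k`. -/
def genFun (x : ℕ → ℂ) (z : ℂ) : ℂ := ∑' k, x k * z ^ k

/-- The spectral characteristic `A(e^{iθ}) - r(e^{iθ}) Φ_μ(e^{-iθ})^{-1}`, where
`A(z) = ∑ b(k) z^k`, `r(z) = ∑ r(k) z^k`, `Φ_μ(z) = ∑ φ_μ(k) z^k`. -/
def spectralCharacteristic (b r φμ : ℕ → ℂ) (θ : ℝ) : ℂ :=
  genFun b (Complex.exp (Complex.I * θ)) -
    genFun r (Complex.exp (Complex.I * θ)) * (genFun φμ (Complex.exp (-Complex.I * θ)))⁻¹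

/-- The estimate `-∑_{k=-μn}^{-1} v_μ(k) ξ(k) + J`. -/
def estimate {Ω : Type*} (n μ : ℕ) (ξ : ℤ → Ω → ℂ) (b : ℕ → ℂ) (J : Ω → ℂ) : Ω → ℂ :=
  fun ω => -(∑ i ∈ Finset.Icc 1 (μ * n), vCoeff n μ b i * ξ (-(i : ℤ)) ω) + J ω

end StatIncr

end

noncomputable section
namespace StatIncr

/-! Backward shifts and differences of two-sided sequences. -/

section Sequences

variable {V : Type*} [AddCommGroup V] [Module ℂ V]

/-- The backward shift `(S u)(m) = u(m - 1)`. -/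
def bshift (V : Type*) [AddCommGroup V] [Module ℂ V] : Module.End ℂ (ℤ → V) where
  toFun u m := u (m - 1)
  map_add' _ _ := rfl
  map_smul' _ _ := rfl

/-- The backward difference `(D u)(m) = u(m) - u(m - 1)`. -/
def bdiff (V : Type*) [AddCommGroup V] [Module ℂ V] : Module.End ℂ (ℤ → V) := 1 - bshift V

theorem bdiff_apply (u : ℤ → V) (m : ℤ) : bdiff V u m = u m - u (m - 1) := rfl

theorem bshift_pow_apply (k : ℕ) (u : ℤ → V) (m : ℤ) : (bshift V ^ k) u m = u (m - k) := by
  induction k generalizing m with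
  | zero => simp
  | succ k ih =>
    rw [pow_succ', Module.End.mul_apply]
    change (bshift V ^ k) u (m - 1) = _
    rw [ih]
    congr 1
    push_cast
    ring

theorem aeval_bshift_apply (q : Polynomial ℂ) (u : ℤ → V) (m : ℤ) :
    Polynomial.aeval (bshift V) q u m = q.sum fun j z => z • u (m - j) := by
  rw [Polynomial.aeval_eq_sum_range, Polynomial.sum_over_range _ (by simp), LinearMap.sum_apply,
    Finset.sum_apply]
  refine Finset.sum_congr rfl fun j _ => ?_
  rw [LinearMap.smul_apply, Pi.smul_apply, bshift_pow_apply]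

/-- The `n`th difference with step `ν` of a sequence in a vector space. -/
def diffOp (n : ℕ) (ν : ℤ) (u : ℤ → V) (m : ℤ) : V :=
  ∑ l ∈ Finset.range (n + 1), ((-1 : ℂ) ^ l * (n.choose l : ℂ)) • u (m - l * ν)

theorem aeval_one_sub_X_pow (n ν : ℕ) (u : ℤ → V) :
    Polynomial.aeval (bshift V) ((1 - Polynomial.X ^ ν) ^ n : Polynomial ℂ) u = diffOp n ν u := by
  funext m
  have h : ((1 - Polynomial.X ^ ν) ^ n : Polynomial ℂ) =
      ∑ l ∈ Finset.range (n + 1),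
        ((-1 : ℂ) ^ l * (n.choose l : ℂ)) • (Polynomial.X ^ (ν * l) : Polynomial ℂ) := by
    rw [sub_eq_neg_add, add_pow]
    refine Finset.sum_congr rfl fun l _ => ?_
    rw [neg_pow, ← pow_mul, Polynomial.smul_eq_C_mul]
    simp only [one_pow, mul_one, map_mul, map_pow, map_neg, map_one, map_natCast]
    ring
  rw [h, map_sum, LinearMap.sum_apply, Finset.sum_apply, diffOp]
  refine Finset.sum_congr rfl fun l _ => ?_
  rw [map_smul, map_pow, Polynomial.aeval_X, LinearMap.smul_apply, Pi.smul_apply,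
    bshift_pow_apply]
  congr 2
  push_cast
  ring

theorem bdiff_pow_eq (n : ℕ) (u : ℤ → V) : (bdiff V ^ n) u = diffOp n 1 u := by
  have := aeval_one_sub_X_pow n 1 u
  simpa [bdiff] using this

/-- The polynomial `(1 + X + ⋯ + X^{ν-1})ⁿ`. -/
def geomPoly (n ν : ℕ) : Polynomial ℂ := (∑ j ∈ Finset.range ν, Polynomial.X ^ j) ^ n

theorem diffOp_natCast (n ν : ℕ) (u : ℤ → V) (m : ℤ) :
    diffOp n ν u m = (geomPoly n ν).sum fun j z => z • diffOp n 1 u (m - j) := by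
  rw [← aeval_bshift_apply, ← bdiff_pow_eq, ← aeval_one_sub_X_pow]
  have h : ((1 - Polynomial.X ^ ν) ^ n : Polynomial ℂ) = geomPoly n ν * (1 - Polynomial.X) ^ n := by
    rw [geomPoly, ← mul_pow, geom_sum_mul_neg]
  rw [h, map_mul, Module.End.mul_apply]
  simp [bdiff]

theorem diffOp_neg (n : ℕ) (ν : ℤ) (u : ℤ → V) (m : ℤ) :
    diffOp n (-ν) u m = (-1 : ℂ) ^ n • diffOp n ν u (m + n * ν) := by
  unfold diffOp
  rw [← Finset.sum_range_reflect, Finset.smul_sum]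
  refine Finset.sum_congr rfl fun l hl => ?_
  have hl' : l ≤ n := Nat.lt_succ_iff.mp (Finset.mem_range.mp hl)
  rw [show n + 1 - 1 - l = n - l by omega, smul_smul, Nat.choose_symm hl', ← mul_assoc]
  congr 1
  · congr 1
    have : (-1 : ℂ) ^ l * (-1) ^ l = 1 := by rw [← mul_pow]; simp
    have h2 : (-1 : ℂ) ^ n = (-1) ^ (n - l) * (-1) ^ l := by rw [← pow_add]; congr 1; omega
    rw [h2, mul_assoc, this, mul_one]
  · congr 1
    push_cast [hl']
    ring

theorem diffOp_zero_step {n : ℕ} (hn : 1 ≤ n) (u : ℤ → V) (m : ℤ) : diffOp n 0 u m = 0 := by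
  have h : ∑ l ∈ Finset.range (n + 1), ((-1 : ℂ) ^ l * (n.choose l : ℂ)) = 0 := by
    have := add_pow (-1 : ℂ) 1 n
    simp only [one_pow, mul_one, neg_add_cancel] at this
    rw [← this, zero_pow (by omega)]
  simp only [diffOp, mul_zero, sub_zero]
  rw [← Finset.sum_smul, h, zero_smul]

theorem map_diffOp {W : Type*} [AddCommGroup W] [Module ℂ W] (T : V →ₗ[ℂ] W) (n : ℕ) (ν : ℤ)
    (u : ℤ → V) (m : ℤ) : diffOp n ν (fun k => T (u k)) m = T (diffOp n ν u m) := by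
  simp [diffOp]

theorem bdiff_pow_shift (n : ℕ) (u : ℤ → V) (k m : ℤ) :
    (bdiff V ^ n) (fun j => u (j + k)) m = (bdiff V ^ n) u (m + k) := by
  simp only [bdiff_pow_eq, diffOp]
  refine Finset.sum_congr rfl fun l _ => ?_
  congr 2
  ring

theorem eq_of_bdiff_eq_zero {u : ℤ → V} (h : bdiff V u = 0) (m k : ℤ) : u m = u k := by
  have h1 : ∀ m, u m = u (m - 1) := fun m => sub_eq_zero.mp (congrFun h m)
  have h2 : ∀ m, u m = u 0 := by
    intro m
    induction m using Int.induction_on with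
    | zero => rfl
    | succ i hi => rw [h1, add_sub_cancel_right, hi]
    | pred i hi => rw [← h1, hi]
  rw [h2 m, h2 k]

/-- A sequence killed by `Dⁿ` is determined by its values at `-n, …, -1`. -/
theorem eq_zero_of_bdiff_pow_of_start (n : ℕ) {u : ℤ → V} (h : (bdiff V ^ n) u = 0)
    (h0 : ∀ m : ℤ, -(n : ℤ) ≤ m → m ≤ -1 → u m = 0) : u = 0 := by
  induction n generalizing u with
  | zero => simpa using h
  | succ n ih =>
    have h1 : bdiff V u = 0 := by
      refine ih (by rw [pow_succ] at h; exact h) fun m hm hm' => ?_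
      rw [bdiff_apply, h0 m (by push_cast; omega) hm', h0 (m - 1) (by push_cast; omega) (by omega),
        sub_zero]
    funext m
    rw [eq_of_bdiff_eq_zero h1 m (-1), h0 (-1) (by push_cast; omega) le_rfl]
    rfl

theorem eq_zero_of_bdiff_pow_of_tendsto (n : ℕ) {u : ℤ → ℂ} (h : (bdiff ℂ ^ n) u = 0)
    (h0 : Tendsto u atBot (𝓝 0)) : u = 0 := by
  induction n generalizing u with
  | zero => simpa using h
  | succ n ih =>
    have h1 : bdiff ℂ u = 0 := by
      refine ih (by rw [pow_succ] at h; exact h) ?_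
      have h2 : Tendsto (fun m : ℤ => u (m - 1)) atBot (𝓝 0) :=
        h0.comp (tendsto_atBot_add_const_right _ _ tendsto_id)
      have h3 := h0.sub h2
      rw [sub_zero] at h3
      exact h3
    funext m
    refine tendsto_nhds_unique (tendsto_const_nhds.congr fun k => ?_) h0
    exact eq_of_bdiff_eq_zero h1 m k

theorem bdiff_pow_eq_fwdDiff (n : ℕ) (u : ℤ → V) (m : ℤ) :
    (fwdDiff 1)^[n] u m = (bdiff V ^ n) u (m + n) := by
  induction n generalizing u with
  | zero => simp
  | succ n ih =>
    rw [Function.iterate_succ_apply, ih, pow_succ, Module.End.mul_apply,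
      show ((n + 1 : ℕ) : ℤ) = 1 + n by push_cast; ring, ← add_assoc, add_right_comm,
      ← bdiff_pow_shift n (bdiff V u) 1]
    have : fwdDiff 1 u = fun j => bdiff V u (j + 1) := by
      funext j
      simp [fwdDiff, bdiff_apply]
    rw [this]

theorem eq_zero_of_bdiff_pow_of_frequently_complex (n : ℕ) {u : ℤ → ℂ} (h : (bdiff ℂ ^ n) u = 0)
    (h0 : ∃ᶠ m in atTop, u m = 0) : u = 0 := by
  funext y
  let p : Polynomial ℂ := ∑ k ∈ Finset.range n,
    Polynomial.C ((fwdDiff 1)^[k] u y / (k.factorial : ℂ)) * descPochhammer ℂ k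
  have hp : ∀ N : ℕ, p.eval (N : ℂ) = u (y + N) := by
    intro N
    have h1 := shift_eq_sum_fwdDiff_iter (1 : ℤ) u N y
    rw [nsmul_one] at h1
    have h2 : ∀ k, n ≤ k → (fwdDiff 1)^[k] u y = 0 := by
      intro k hk
      rw [bdiff_pow_eq_fwdDiff, ← Nat.sub_add_cancel hk, pow_add, Module.End.mul_apply, h]
      simp
    have h3 : ∀ k, N < k → (N.choose k) • (fwdDiff 1)^[k] u y = 0 := by
      intro k hk
      rw [Nat.choose_eq_zero_of_lt hk, zero_smul]
    have h4 : ∑ k ∈ Finset.range (N + 1), N.choose k • (fwdDiff 1)^[k] u y =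
        ∑ k ∈ Finset.range (max n (N + 1)), N.choose k • (fwdDiff 1)^[k] u y := by
      refine Finset.sum_subset (Finset.range_subset_range.mpr (le_max_right _ _)) ?_
      intro k _ hk
      exact h3 k (by simpa using hk)
    have h5 : ∑ k ∈ Finset.range n, N.choose k • (fwdDiff 1)^[k] u y =
        ∑ k ∈ Finset.range (max n (N + 1)), N.choose k • (fwdDiff 1)^[k] u y := by
      refine Finset.sum_subset (Finset.range_subset_range.mpr (le_max_left _ _)) ?_
      intro k _ hk
      rw [h2 k (by simpa using hk), smul_zero]
    rw [h1, h4, ← h5, Polynomial.eval_finsetSum]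
    refine Finset.sum_congr rfl fun k _ => ?_
    rw [Polynomial.eval_mul, Polynomial.eval_C, descPochhammer_eval_eq_descFactorial,
      Nat.descFactorial_eq_factorial_mul_choose, nsmul_eq_mul]
    have : (k.factorial : ℂ) ≠ 0 := by exact_mod_cast k.factorial_ne_zero
    push_cast
    field_simp
  have hp0 : p = 0 := by
    refine Polynomial.eq_zero_of_infinite_isRoot p ?_
    have h6 : {N : ℕ | u (y + N) = 0}.Infinite := by
      refine Set.infinite_of_not_bddAbove ?_
      rintro ⟨K, hK⟩
      obtain ⟨m, hm, hm0⟩ := (h0.and_eventually (eventually_ge_atTop (y + K + 1))).exists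
      have := hK (show (m - y).toNat ∈ {N : ℕ | u (y + N) = 0} by
        have : y + ((m - y).toNat : ℤ) = m := by omega
        simp only [Set.mem_ofPred_eq, this, hm])
      omega
    refine (h6.image (f := fun N : ℕ => (N : ℂ)) Nat.cast_injective.injOn).mono ?_
    rintro _ ⟨N, hN, rfl⟩
    exact (hp N).trans hN
  have := hp 0
  rw [hp0] at this
  simpa using this.symm

theorem eq_zero_of_bdiff_pow_of_frequently (n : ℕ) {u : ℤ → V} (h : (bdiff V ^ n) u = 0)
    (h0 : ∃ᶠ m in atTop, u m = 0) : u = 0 := by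
  funext m
  rw [Pi.zero_apply, ← Module.forall_dual_apply_eq_zero_iff ℂ]
  intro T
  have := eq_zero_of_bdiff_pow_of_frequently_complex n (u := fun k => T (u k)) (by
    funext k
    rw [bdiff_pow_eq, map_diffOp, ← bdiff_pow_eq, h]
    simp) (h0.mono fun m hm => by rw [hm, map_zero])
  exact congrFun this m

/-- The polynomial sequence `m ↦ C(m + n - 1, n - 1)`. -/
def binomSeq (n : ℕ) (m : ℤ) : ℂ := ((Ring.choose (m + n - 1) (n - 1) : ℤ) : ℂ)

/-- The one-sided fundamental solution of `Dⁿ β = δ₀`. -/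
def impulse (n : ℕ) (m : ℤ) : ℂ := if 0 ≤ m then binomSeq n m else 0

theorem bdiff_binomSeq {n : ℕ} (hn : 1 ≤ n) : bdiff ℂ (binomSeq (n + 1)) = binomSeq n := by
  funext m
  obtain ⟨k, rfl⟩ := Nat.exists_eq_add_of_le' hn
  simp only [bdiff_apply, binomSeq, Nat.add_sub_cancel]
  rw [← Int.cast_sub]
  congr 1
  have := Ring.choose_succ_succ (m + k) k
  push_cast
  rw [show m + (k + 1 + 1) - 1 = (m + k) + 1 by ring, show m - 1 + (k + 1 + 1) - 1 = m + k by ring,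
    show m + (k + 1) - 1 = m + k by ring]
  linarith

theorem binomSeq_zero {n : ℕ} (hn : 1 ≤ n) : binomSeq n 0 = 1 := by
  obtain ⟨k, rfl⟩ := Nat.exists_eq_add_of_le' hn
  simp only [binomSeq, Nat.add_sub_cancel, zero_add]
  push_cast
  rw [show (k : ℤ) + 1 - 1 = (k : ℕ) by ring, Ring.choose_natCast]
  simp

theorem binomSeq_eq_zero {n : ℕ} {m : ℤ} (h1 : -(n : ℤ) < m) (h2 : m < 0) : binomSeq n m = 0 := by
  have : m + n - 1 = ((m + n - 1).toNat : ℕ) := by omega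
  rw [binomSeq, this, Ring.choose_natCast, Nat.choose_eq_zero_of_lt (by omega)]
  simp

theorem bdiff_pow_binomSeq {n : ℕ} (hn : 1 ≤ n) : (bdiff ℂ ^ n) (binomSeq n) = 0 := by
  induction n, hn using Nat.le_induction with
  | base =>
    funext m
    simp [bdiff_apply, binomSeq]
  | succ n hn ih => rw [pow_succ, Module.End.mul_apply, bdiff_binomSeq hn, ih]

theorem bdiff_pow_impulse {n : ℕ} (hn : 1 ≤ n) : (bdiff ℂ ^ n) (impulse n) = Pi.single 0 1 := by
  induction n, hn using Nat.le_induction with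
  | base =>
    funext m
    rcases lt_trichotomy m 0 with h | rfl | h
    · simp [bdiff_apply, impulse, h.not_ge, h.ne, show ¬ 1 ≤ m by omega]
    · simp [bdiff_apply, impulse, binomSeq]
    · simp [bdiff_apply, impulse, binomSeq, h.le, h.ne', show 1 ≤ m by omega]
  | succ n hn ih =>
    rw [pow_succ, Module.End.mul_apply, ← ih]
    congr 1
    funext m
    have hB := congrFun (bdiff_binomSeq hn) m
    rw [bdiff_apply] at hB
    rcases lt_trichotomy m 0 with h | rfl | h
    · simp [bdiff_apply, impulse, h.not_ge, show ¬ 1 ≤ m by omega]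
    · simp [bdiff_apply, impulse, binomSeq_zero hn, binomSeq_zero (n := n + 1) (by omega)]
    · simp only [bdiff_apply, impulse, h.le, show 0 ≤ m - 1 by omega, if_true]
      exact hB

end Sequences

/-! Linear forms modulo increments. -/

theorem incrementForm_eq (n : ℕ) (m ν : ℤ) :
    incrementForm n m ν = diffOp n ν (fun k => Finsupp.single k (1 : ℂ)) m := by
  simp [incrementForm, diffOp]

theorem linearCombination_incrementForm {V : Type*} [AddCommGroup V] [Module ℂ V] (u : ℤ → V)
    (n : ℕ) (m ν : ℤ) :
    Finsupp.linearCombination ℂ u (incrementForm n m ν) = diffOp n ν u m := by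
  rw [incrementForm_eq, ← map_diffOp]
  simp

theorem incrementForm_mem_span_of_pos {n : ℕ} {m ν t : ℤ} (hν : 0 < ν) (hm : m ≤ t) :
    incrementForm n m ν ∈ Submodule.span ℂ {c | ∃ j ≤ t, c = incrementForm n j 1} := by
  lift ν to ℕ using hν.le
  rw [incrementForm_eq, diffOp_natCast, Polynomial.sum_def]
  refine Submodule.sum_mem _ fun j _ => Submodule.smul_mem _ _ (Submodule.subset_span ?_)
  exact ⟨m - j, by omega, (incrementForm_eq _ _ _).symm⟩

theorem incrementForms_eq_span {n : ℕ} (hn : 1 ≤ n) :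
    incrementForms n = Submodule.span ℂ (Set.range fun j : ℤ => incrementForm n j 1) := by
  refine le_antisymm (Submodule.span_le.mpr ?_) (Submodule.span_mono ?_)
  · rintro _ ⟨m, ν, rfl⟩
    have key : ∀ ν : ℤ, 0 < ν → ∀ m, incrementForm n m ν ∈
        Submodule.span ℂ (Set.range fun j : ℤ => incrementForm n j 1) := fun ν hν m =>
      Submodule.span_mono (by rintro _ ⟨j, _, rfl⟩; exact ⟨j, rfl⟩)
        (incrementForm_mem_span_of_pos hν (le_refl m))
    rcases lt_trichotomy ν 0 with h | rfl | h
    · rw [incrementForm_eq, ← neg_neg ν, diffOp_neg, ← incrementForm_eq]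
      exact Submodule.smul_mem _ _ (key _ (by omega) _)
    · rw [incrementForm_eq, diffOp_zero_step hn]
      exact Submodule.zero_mem _
    · exact key _ h _
  · rintro _ ⟨j, rfl⟩
    exact ⟨j, 1, rfl⟩

theorem incrementForm_one_apply_self (n : ℕ) (m : ℤ) : incrementForm n m 1 m = 1 := by
  rw [incrementForm, Finsupp.finsetSum_apply, Finset.sum_eq_single 0]
  · simp
  · intro l _ hl
    rw [Finsupp.single_apply, if_neg (by omega)]
  · simp

theorem incrementForm_one_apply_of_lt (n : ℕ) {m k : ℤ} (h : m < k) :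
    incrementForm n m 1 k = 0 := by
  rw [incrementForm, Finsupp.finsetSum_apply]
  refine Finset.sum_eq_zero fun l _ => ?_
  rw [Finsupp.single_apply, if_neg (by omega)]

theorem mem_span_of_support_le {n : ℕ} (hn : 1 ≤ n) {c : ℤ →₀ ℂ} (hc : c ∈ incrementForms n)
    {t : ℤ} (ht : ∀ m ∈ c.support, m ≤ t) :
    c ∈ Submodule.span ℂ {c | ∃ j ≤ t, c = incrementForm n j 1} := by
  rw [incrementForms_eq_span hn, Finsupp.mem_span_range_iff_exists_finsupp] at hc
  obtain ⟨q, rfl⟩ := hc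
  rw [Finsupp.sum]
  refine Submodule.sum_mem _ fun j hj => Submodule.smul_mem _ _ (Submodule.subset_span ?_)
  refine ⟨j, ?_, rfl⟩
  have hne : q.support.Nonempty := ⟨j, hj⟩
  have hM := q.support.max'_mem hne
  set M := q.support.max' hne with hMdef
  refine (q.support.le_max' j hj).trans (ht M ?_)
  rw [Finsupp.mem_support_iff, Finsupp.sum, Finsupp.finsetSum_apply, Finset.sum_eq_single M]
  · rw [Finsupp.smul_apply, incrementForm_one_apply_self, smul_eq_mul, mul_one]
    exact Finsupp.mem_support_iff.mp hM
  · intro k hk hkM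
    rw [Finsupp.smul_apply, incrementForm_one_apply_of_lt, smul_zero]
    exact lt_of_le_of_ne (q.support.le_max' k hk) hkM
  · exact fun h => absurd hM h

/-- The form `∑ ρ_i ξ(-i-1)`, `0 ≤ i < n`. -/
def startForm (n : ℕ) (ρ : Fin n → ℂ) : ℤ →₀ ℂ :=
  ∑ i : Fin n, Finsupp.single (-(i : ℤ) - 1) (ρ i)

theorem startForm_support {n : ℕ} {ρ : Fin n → ℂ} {m : ℤ} (hm : m ∈ (startForm n ρ).support) :
    -(n : ℤ) ≤ m ∧ m ≤ -1 := by
  obtain ⟨i, -, hi⟩ := Finset.mem_biUnion.mp (Finsupp.support_finsetSum hm)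
  have := Finset.mem_singleton.mp (Finsupp.support_single_subset hi)
  omega

theorem exists_startForm_sub_mem (n : ℕ) (c : ℤ →₀ ℂ) :
    ∃ ρ : Fin n → ℂ, c - startForm n ρ ∈ incrementForms n := by
  let W : Submodule ℂ (ℤ →₀ ℂ) :=
    Submodule.span ℂ (Set.range fun i : Fin n => Finsupp.single (-(i : ℤ) - 1) (1 : ℂ)) ⊔
      incrementForms n
  have h1 : (fun m : ℤ => W.mkQ (Finsupp.single m (1 : ℂ))) = 0 := by
    refine eq_zero_of_bdiff_pow_of_start n ?_ ?_
    · funext m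
      rw [bdiff_pow_eq, map_diffOp, ← incrementForm_eq, Submodule.mkQ_apply, Pi.zero_apply,
        Submodule.Quotient.mk_eq_zero]
      exact Submodule.mem_sup_right (Submodule.subset_span ⟨m, 1, rfl⟩)
    · intro m hm hm'
      rw [Submodule.mkQ_apply, Submodule.Quotient.mk_eq_zero]
      refine Submodule.mem_sup_left (Submodule.subset_span ⟨⟨(-m - 1).toNat, by omega⟩, ?_⟩)
      simp only
      congr 1
      omega
  have h2 : c ∈ W := by
    rw [← Finsupp.sum_single c, Finsupp.sum]
    refine Submodule.sum_mem _ fun m _ => ?_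
    have := congrFun h1 m
    rw [Submodule.mkQ_apply, Pi.zero_apply, Submodule.Quotient.mk_eq_zero] at this
    simpa using W.smul_mem (c m) this
  obtain ⟨x, hx, y, hy, hxy⟩ := Submodule.mem_sup.mp h2
  rw [Submodule.mem_span_range_iff_exists_fun] at hx
  obtain ⟨ρ, hρ⟩ := hx
  refine ⟨ρ, ?_⟩
  have : startForm n ρ = x := by rw [← hρ]; simp [startForm]
  rw [this, ← hxy, add_sub_cancel_left]
  exact hy

theorem linearCombination_eq_zero {V : Type*} [AddCommGroup V] [Module ℂ V] {n : ℕ} (hn : 1 ≤ n)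
    {u : ℤ → V} (hu : (bdiff V ^ n) u = 0) {c : ℤ →₀ ℂ} (hc : c ∈ incrementForms n) :
    Finsupp.linearCombination ℂ u c = 0 := by
  rw [incrementForms_eq_span hn] at hc
  have : Submodule.span ℂ (Set.range fun j : ℤ => incrementForm n j 1) ≤
      LinearMap.ker (Finsupp.linearCombination ℂ u) := by
    refine Submodule.span_le.mpr ?_
    rintro _ ⟨j, rfl⟩
    simp only [SetLike.mem_coe, LinearMap.mem_ker]
    rw [linearCombination_incrementForm, ← bdiff_pow_eq, hu, Pi.zero_apply]
  exact this hc

end StatIncr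
end

noncomputable section
namespace StatIncr

/-! Power series with absolutely summable coefficients. -/

section Wiener

/-- The coefficients of the power series are absolutely summable. -/
def AbsSummable (c : PowerSeries ℂ) : Prop := Summable fun k => ‖PowerSeries.coeff k c‖

/-- The value `∑ c_k z^k` of a power series with absolutely summable coefficients. -/
def ev (c : PowerSeries ℂ) (z : ℂ) : ℂ := genFun (fun k => PowerSeries.coeff k c) z

/-- The one-sided moving average `(c ⋆ u)(m) = ∑_{k ≥ 0} c_k u(m - k)`. -/
def act {V : Type*} [NormedAddCommGroup V] [NormedSpace ℂ V] (c : PowerSeries ℂ) (u : ℤ → V)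
    (m : ℤ) : V := ∑' k : ℕ, PowerSeries.coeff k c • u (m - k)

theorem hasSum_sum_antidiagonal {V : Type*} [NormedAddCommGroup V] [CompleteSpace V]
    {F : ℕ × ℕ → V} (hF : Summable fun p => ‖F p‖) :
    HasSum (fun k => ∑ p ∈ Finset.HasAntidiagonal.antidiagonal k, F p) (∑' i, ∑' j, F (i, j)) := by
  have h1 : Summable F := hF.of_norm
  rw [← h1.tsum_prod, ← Finset.HasAntidiagonal.sigmaAntidiagonalEquivProd.tsum_eq F]
  have h2 : Summable fun x : (Σ n : ℕ, Finset.HasAntidiagonal.antidiagonal n) =>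
      F (Finset.HasAntidiagonal.sigmaAntidiagonalEquivProd x) :=
    Finset.HasAntidiagonal.sigmaAntidiagonalEquivProd.summable_iff.mpr h1
  have h3 := h2.hasSum.sigma (fun k => (hasSum_fintype _))
  convert h3 using 2 with k
  rw [← Finset.sum_coe_sort]
  rfl

theorem AbsSummable.mul {c d : PowerSeries ℂ} (hc : AbsSummable c) (hd : AbsSummable d) :
    AbsSummable (c * d) := by
  have := summable_norm_sum_mul_antidiagonal_of_summable_norm hc hd
  simpa [AbsSummable, PowerSeries.coeff_mul] using this

theorem absSummable_coe (q : Polynomial ℂ) : AbsSummable (q : PowerSeries ℂ) := by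
  refine summable_of_ne_finset_zero (s := q.support) fun k hk => ?_
  rw [Polynomial.coeff_coe, Polynomial.notMem_support_iff.mp hk, norm_zero]

theorem absSummable_one : AbsSummable 1 := by
  simpa using absSummable_coe 1

theorem AbsSummable.pow {c : PowerSeries ℂ} (hc : AbsSummable c) (n : ℕ) :
    AbsSummable (c ^ n) := by
  induction n with
  | zero => simpa using absSummable_one
  | succ n ih => rw [pow_succ]; exact ih.mul hc

/-- The sum of the absolute values of the coefficients. -/
def absSum (c : PowerSeries ℂ) : ℝ := ∑' k, ‖PowerSeries.coeff k c‖

theorem absSum_mul_le {c d : PowerSeries ℂ} (hc : AbsSummable c) (hd : AbsSummable d) :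
    absSum (c * d) ≤ absSum c * absSum d := by
  have h1 := tsum_mul_tsum_eq_tsum_sum_antidiagonal_of_summable_norm
    (f := fun k => ‖PowerSeries.coeff k c‖) (g := fun k => ‖PowerSeries.coeff k d‖)
    (by simpa [AbsSummable] using hc) (by simpa [AbsSummable] using hd)
  have h2 := summable_norm_sum_mul_antidiagonal_of_summable_norm
    (f := fun k => ‖PowerSeries.coeff k c‖) (g := fun k => ‖PowerSeries.coeff k d‖)
    (by simpa [AbsSummable] using hc) (by simpa [AbsSummable] using hd)
  unfold absSum
  rw [h1]
  refine Summable.tsum_le_tsum (fun k => ?_) (hc.mul hd) h2.of_norm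
  rw [PowerSeries.coeff_mul]
  refine (norm_sum_le _ _).trans_eq ?_
  simp

theorem absSum_nonneg (c : PowerSeries ℂ) : 0 ≤ absSum c := tsum_nonneg fun _ => norm_nonneg _

theorem absSum_pow_le {c : PowerSeries ℂ} (hc : AbsSummable c) (n : ℕ) :
    absSum (c ^ n) ≤ absSum c ^ n := by
  induction n with
  | zero =>
    refine le_of_eq ?_
    rw [pow_zero, pow_zero, absSum, tsum_eq_single 0]
    · simp
    · intro k hk
      simp [PowerSeries.coeff_one, hk]
  | succ n ih =>
    rw [pow_succ, pow_succ]
    exact (absSum_mul_le (hc.pow n) hc).trans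
      (mul_le_mul_of_nonneg_right ih (absSum_nonneg c))

theorem summable_mul_pow {x : ℕ → ℂ} (hx : Summable fun k => ‖x k‖) {z : ℂ} (hz : ‖z‖ ≤ 1) :
    Summable fun k => ‖x k * z ^ k‖ := by
  refine hx.of_nonneg_of_le (fun _ => norm_nonneg _) fun k => ?_
  rw [norm_mul, norm_pow]
  exact mul_le_of_le_one_right (norm_nonneg _) (pow_le_one₀ (norm_nonneg _) hz)

theorem norm_ev_le {c : PowerSeries ℂ} (hc : AbsSummable c) {z : ℂ} (hz : ‖z‖ ≤ 1) :
    ‖ev c z‖ ≤ absSum c := by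
  refine tsum_of_norm_bounded hc.hasSum fun k => ?_
  rw [norm_mul, norm_pow]
  exact mul_le_of_le_one_right (norm_nonneg _) (pow_le_one₀ (norm_nonneg _) hz)

theorem ev_one (z : ℂ) : ev 1 z = 1 := by
  rw [ev, genFun, tsum_eq_single 0]
  · simp
  · intro k hk
    simp [PowerSeries.coeff_one, hk]

theorem ev_mul {c d : PowerSeries ℂ} (hc : AbsSummable c) (hd : AbsSummable d) {z : ℂ}
    (hz : ‖z‖ ≤ 1) : ev (c * d) z = ev c z * ev d z := by
  simp only [ev, genFun]
  rw [tsum_mul_tsum_eq_tsum_sum_antidiagonal_of_summable_norm (summable_mul_pow hc hz)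
    (summable_mul_pow hd hz)]
  refine tsum_congr fun k => ?_
  rw [PowerSeries.coeff_mul, Finset.sum_mul]
  refine Finset.sum_congr rfl fun p hp => ?_
  rw [← Finset.HasAntidiagonal.mem_antidiagonal.mp hp, pow_add]
  ring

theorem ev_pow {c : PowerSeries ℂ} (hc : AbsSummable c) {z : ℂ} (hz : ‖z‖ ≤ 1) (n : ℕ) :
    ev (c ^ n) z = ev c z ^ n := by
  induction n with
  | zero => simp [ev_one]
  | succ n ih => rw [pow_succ, ev_mul (hc.pow n) hc hz, ih, pow_succ]

theorem ev_coe (q : Polynomial ℂ) (z : ℂ) : ev (q : PowerSeries ℂ) z = q.eval z := by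
  rw [ev, genFun, tsum_eq_sum (s := q.support), Polynomial.eval_eq_sum, Polynomial.sum]
  · simp
  · intro k hk
    rw [Polynomial.coeff_coe, Polynomial.notMem_support_iff.mp hk, zero_mul]

theorem ev_neg (c : PowerSeries ℂ) (z : ℂ) : ev (-c) z = -ev c z := by
  simp [ev, genFun, tsum_neg]

theorem AbsSummable.neg {c : PowerSeries ℂ} (hc : AbsSummable c) : AbsSummable (-c) := by
  simpa [AbsSummable] using hc

section Action

variable {V : Type*} [NormedAddCommGroup V] [NormedSpace ℂ V]

theorem norm_smul_shift_le (c : PowerSeries ℂ) {u : ℤ → V} {B : ℝ} (hu : ∀ m, ‖u m‖ ≤ B)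
    (m : ℤ) (k : ℕ) : ‖PowerSeries.coeff k c • u (m - k)‖ ≤ ‖PowerSeries.coeff k c‖ * B := by
  rw [norm_smul]
  exact mul_le_mul_of_nonneg_left (hu _) (norm_nonneg _)

theorem norm_act_le {c : PowerSeries ℂ} (hc : AbsSummable c) {u : ℤ → V} {B : ℝ}
    (hu : ∀ m, ‖u m‖ ≤ B) (m : ℤ) : ‖act c u m‖ ≤ absSum c * B :=
  tsum_of_norm_bounded (hc.hasSum.mul_right B) fun k => norm_smul_shift_le c hu m k

theorem act_one (u : ℤ → V) : act 1 u = u := by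
  funext m
  rw [act, tsum_eq_single 0]
  · simp
  · intro k hk
    simp [PowerSeries.coeff_one, hk]

theorem act_coe (q : Polynomial ℂ) (u : ℤ → V) (m : ℤ) :
    act (q : PowerSeries ℂ) u m = q.sum fun j z => z • u (m - j) := by
  rw [act, tsum_eq_sum (s := q.support), Polynomial.sum]
  · simp
  · intro k hk
    rw [Polynomial.coeff_coe, Polynomial.notMem_support_iff.mp hk, zero_smul]

theorem act_smul (c : PowerSeries ℂ) (u : ℤ → V) (z : ℂ) (m : ℤ) :
    act c (fun k => z • u k) m = z • act c u m := by
  simp only [act]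
  rw [← tsum_const_smul'' z]
  exact tsum_congr fun k => smul_comm _ _ _

variable [CompleteSpace V]

theorem hasSum_act {c : PowerSeries ℂ} (hc : AbsSummable c) {u : ℤ → V} {B : ℝ}
    (hu : ∀ m, ‖u m‖ ≤ B) (m : ℤ) :
    HasSum (fun k : ℕ => PowerSeries.coeff k c • u (m - k)) (act c u m) :=
  (Summable.of_norm_bounded (hc.mul_right B) fun k => norm_smul_shift_le c hu m k).hasSum

theorem act_mul {c d : PowerSeries ℂ} (hc : AbsSummable c) (hd : AbsSummable d) {u : ℤ → V}
    {B : ℝ} (hu : ∀ m, ‖u m‖ ≤ B) : act (c * d) u = act c (act d u) := by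
  funext m
  have h1 : Summable fun p : ℕ × ℕ =>
      ‖(PowerSeries.coeff p.1 c * PowerSeries.coeff p.2 d) • u (m - p.1 - p.2)‖ := by
    refine Summable.of_nonneg_of_le (fun _ => norm_nonneg _) (fun p => ?_)
      ((hc.mul_norm hd).mul_right B)
    rw [norm_smul]
    exact mul_le_mul_of_nonneg_left (hu _) (norm_nonneg _)
  have h2 := (hasSum_sum_antidiagonal h1).tsum_eq
  simp only [act]
  have h3 : ∀ i : ℕ, PowerSeries.coeff i c • ∑' j : ℕ, PowerSeries.coeff j d • u (m - i - j) =
      ∑' j : ℕ, (PowerSeries.coeff i c * PowerSeries.coeff j d) • u (m - i - j) := by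
    intro i
    rw [← tsum_const_smul'' (PowerSeries.coeff i c)]
    exact tsum_congr fun j => by rw [smul_smul]
  rw [tsum_congr h3, ← h2]
  refine tsum_congr fun k => ?_
  · rw [PowerSeries.coeff_mul, Finset.sum_smul]
    refine Finset.sum_congr rfl fun p hp => ?_
    rw [← Finset.HasAntidiagonal.mem_antidiagonal.mp hp]
    congr 2
    push_cast
    ring

theorem map_act {W : Type*} [NormedAddCommGroup W] [NormedSpace ℂ W] (T : V →L[ℂ] W)
    {c : PowerSeries ℂ} (hc : AbsSummable c) {u : ℤ → V} {B : ℝ} (hu : ∀ m, ‖u m‖ ≤ B) (m : ℤ) :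
    T (act c u m) = act c (fun k => T (u k)) m := by
  rw [act, T.map_tsum (hasSum_act hc hu m).summable]
  simp [act]

end Action

theorem tsum_tsum_mul_pow {F : ℕ × ℕ → ℂ} (hF : Summable fun p => ‖F p‖) {z : ℂ}
    (hz : ‖z‖ ≤ 1) :
    ∑' k, (∑' j, F (j, k)) * z ^ k = ∑' j, ∑' k, F (j, k) * z ^ k := by
  have hG : Summable fun p : ℕ × ℕ => F (p.1, p.2) * z ^ p.2 := by
    refine Summable.of_norm_bounded hF fun p => ?_
    rw [norm_mul, norm_pow]
    exact mul_le_of_le_one_right (norm_nonneg _) (pow_le_one₀ (norm_nonneg _) hz)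
  have h1 : ∀ k, (∑' j, F (j, k)) * z ^ k = ∑' j, F (j, k) * z ^ k :=
    fun k => tsum_mul_right.symm
  rw [tsum_congr h1]
  have hG' : Summable (Function.uncurry fun j k => F (j, k) * z ^ k) := hG
  exact hG'.tsum_comm

theorem exists_exp {c : PowerSeries ℂ} (hc : AbsSummable c) :
    ∃ E : PowerSeries ℂ, AbsSummable E ∧ ∀ z : ℂ, ‖z‖ ≤ 1 → ev E z = Complex.exp (ev c z) := by
  let F : ℕ × ℕ → ℂ := fun p => PowerSeries.coeff p.2 (c ^ p.1) / (p.1.factorial : ℂ)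
  have hrow : ∀ j, Summable fun k => ‖F (j, k)‖ := by
    intro j
    simpa [F] using (hc.pow j).div_const (j.factorial : ℝ)
  have hF : Summable fun p => ‖F p‖ := by
    rw [summable_prod_of_nonneg (fun _ => norm_nonneg _)]
    refine ⟨hrow, ?_⟩
    refine Summable.of_nonneg_of_le (fun j => tsum_nonneg fun _ => norm_nonneg _) (fun j => ?_)
      (Real.summable_pow_div_factorial (absSum c))
    have : ∑' k, ‖F (j, k)‖ = absSum (c ^ j) / j.factorial := by
      rw [absSum, ← tsum_div_const]
      simp [F]
    rw [this]
    exact div_le_div_of_nonneg_right (absSum_pow_le hc j) (by positivity)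
  have hF' : Summable fun p : ℕ × ℕ => ‖F (p.2, p.1)‖ :=
    (Equiv.prodComm ℕ ℕ).summable_iff.mpr hF
  refine ⟨PowerSeries.mk fun k => ∑' j, F (j, k), ?_, fun z hz => ?_⟩
  · unfold AbsSummable
    simp only [PowerSeries.coeff_mk]
    refine Summable.of_nonneg_of_le (fun _ => norm_nonneg _) (fun k => ?_) hF'.prod
    exact norm_tsum_le_tsum_norm (hF'.prod_factor k)
  · have h1 := tsum_tsum_mul_pow hF hz
    simp only [ev, genFun, PowerSeries.coeff_mk]
    have h3 : ∀ j, ∑' k, F (j, k) * z ^ k = ev c z ^ j / (j.factorial : ℂ) := by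
      intro j
      rw [← ev_pow hc hz, ev, genFun, ← tsum_div_const]
      refine tsum_congr fun k => ?_
      simp only [F]
      ring
    rw [h1, tsum_congr h3, Complex.exp_eq_exp_ℂ, NormedSpace.exp_eq_tsum_div]
    rfl

theorem hasFPowerSeriesOnBall_genFun {x : ℕ → ℂ}
    (h : 0 < (FormalMultilinearSeries.ofScalars ℂ x).radius) :
    HasFPowerSeriesOnBall (genFun x) (FormalMultilinearSeries.ofScalars ℂ x) 0
      (FormalMultilinearSeries.ofScalars ℂ x).radius := by
  have := (FormalMultilinearSeries.ofScalars ℂ x).hasFPowerSeriesOnBall h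
  convert this using 1
  funext z
  rw [FormalMultilinearSeries.sum, genFun]
  simp [FormalMultilinearSeries.ofScalars]

theorem absSummable_mk_of_radius {p : FormalMultilinearSeries ℂ ℂ ℂ} (h : 1 < p.radius) :
    AbsSummable (PowerSeries.mk p.coeff) := by
  have := p.summable_norm_mul_pow (r := 1) (by simpa using h)
  refine this.congr fun k => ?_
  simp

theorem ext_of_ev {c d : PowerSeries ℂ} (hc : AbsSummable c) (hd : AbsSummable d)
    (h : ∀ z, ‖z‖ ≤ 1 → ev c z = ev d z) : c = d := by
  have key : ∀ c : PowerSeries ℂ, AbsSummable c → HasFPowerSeriesAt (ev c)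
      (FormalMultilinearSeries.ofScalars ℂ fun k => PowerSeries.coeff k c) 0 := by
    intro c hc
    have hr : 0 < (FormalMultilinearSeries.ofScalars ℂ fun k => PowerSeries.coeff k c).radius := by
      refine lt_of_lt_of_le one_pos ?_
      have := (FormalMultilinearSeries.ofScalars ℂ fun k =>
        PowerSeries.coeff k c).le_radius_of_summable_norm (r := 1) (by
          refine hc.congr fun k => ?_
          simp)
      simpa using this
    exact (hasFPowerSeriesOnBall_genFun hr).hasFPowerSeriesAt
  have h1 := (key d hd).congr (g := ev c) (by
    filter_upwards [Metric.ball_mem_nhds (0 : ℂ) one_pos] with z hz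
    exact (h z (by simpa using (le_of_lt (mem_ball_zero_iff.mp hz)))).symm)
  have h2 := (key c hc).eq_formalMultilinearSeries h1
  ext k
  have h3 := congrArg (fun p => FormalMultilinearSeries.coeff p k) h2
  simpa [FormalMultilinearSeries.coeff_ofScalars] using h3

theorem exists_inverse {x : ℕ → ℂ} (hr : 1 < (FormalMultilinearSeries.ofScalars ℂ x).radius)
    (h0 : ∀ z : ℂ, ‖z‖ ≤ 1 → genFun x z ≠ 0) :
    ∃ d : PowerSeries ℂ, AbsSummable d ∧ ∀ z : ℂ, ‖z‖ ≤ 1 → ev d z = (genFun x z)⁻¹ := by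
  have hps := hasFPowerSeriesOnBall_genFun (zero_lt_one.trans hr)
  have hball : Metric.closedBall (0 : ℂ) 1 ⊆
      Metric.eball 0 (FormalMultilinearSeries.ofScalars ℂ x).radius := by
    intro z hz
    rw [Metric.mem_eball, edist_zero_right]
    refine lt_of_le_of_lt ?_ hr
    rw [mem_closedBall_zero_iff] at hz
    rw [← ofReal_norm]
    exact ENNReal.ofReal_le_one.mpr hz
  have hU : IsOpen (Metric.eball 0 (FormalMultilinearSeries.ofScalars ℂ x).radius ∩
      genFun x ⁻¹' {0}ᶜ) :=
    hps.analyticOnNhd.continuousOn.isOpen_inter_preimage Metric.isOpen_eball isOpen_compl_singleton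
  obtain ⟨δ, hδ, hδU⟩ := (isCompact_closedBall (0 : ℂ) 1).exists_thickening_subset_open hU
    (fun z hz => ⟨hball hz, h0 z (by simpa using hz)⟩)
  rw [thickening_closedBall hδ zero_le_one] at hδU
  have hRδ : (((δ / 2).toNNReal : NNReal) : ℝ) = δ / 2 := Real.coe_toNNReal _ (by positivity)
  let R : NNReal := 1 + (δ / 2).toNNReal
  have hR : (1 : NNReal) < R := by
    simp [R, hδ]
  have hsub : Metric.closedBall (0 : ℂ) R ⊆ Metric.ball 0 (δ + 1) :=
    Metric.closedBall_subset_ball (by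
      simp only [R, NNReal.coe_add, NNReal.coe_one, hRδ]; linarith)
  have hd : DifferentiableOn ℂ (fun z => (genFun x z)⁻¹) (Metric.closedBall 0 R) := by
    refine DifferentiableOn.inv ?_ fun z hz => (hδU (hsub hz)).2
    exact hps.analyticOnNhd.differentiableOn.mono fun z hz => (hδU (hsub hz)).1
  have hq := hd.hasFPowerSeriesOnBall (zero_lt_one.trans hR)
  refine ⟨PowerSeries.mk (cauchyPowerSeries (fun z => (genFun x z)⁻¹) 0 R).coeff,
    absSummable_mk_of_radius (lt_of_lt_of_le (by exact_mod_cast hR) hq.r_le), fun z hz => ?_⟩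
  have := (hq.hasSum (y := z) (by
    rw [Metric.mem_eball, edist_zero_right]
    refine lt_of_le_of_lt (b := 1) ?_ (by exact_mod_cast hR)
    rw [← ofReal_norm]
    exact ENNReal.ofReal_le_one.mpr hz)).tsum_eq
  rw [zero_add] at this
  rw [← this, ev, genFun]
  refine tsum_congr fun k => ?_
  rw [PowerSeries.coeff_mk, FormalMultilinearSeries.apply_eq_pow_smul_coeff, smul_eq_mul, mul_comm]

end Wiener

end StatIncr
end

noncomputable section
namespace StatIncr

/-! The outer factor of `|1 - e^{-iθ}| / |θ|`. -/

theorem analyticAt_sinc (x : ℝ) : AnalyticAt ℝ Real.sinc x := by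
  by_cases hx : x = 0
  · subst hx
    obtain ⟨p, hp⟩ := Real.analyticAt_sin (x := 0)
    rw [Real.sinc_eq_dslope]
    exact ⟨_, hp.has_fpower_series_dslope_fslope⟩
  · have h : AnalyticAt ℝ (fun y => Real.sin y / y) x :=
      Real.analyticAt_sin.div analyticAt_id hx
    refine h.congr ?_
    filter_upwards [isOpen_ne.mem_nhds hx] with y hy
    rw [Real.sinc_of_ne_zero hy]

theorem sinc_half_pos {θ : ℝ} (h : θ ∈ Set.Icc (-Real.pi) Real.pi) : 0 < Real.sinc (θ / 2) := by
  by_cases h0 : θ = 0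
  · simp [h0]
  rw [Real.sinc_of_ne_zero (by simpa using h0)]
  have hπ := Real.pi_pos
  rcases lt_or_gt_of_ne h0 with hn | hp
  · refine div_pos_of_neg_of_neg ?_ (by linarith)
    exact Real.sin_neg_of_neg_of_neg_pi_lt (by linarith) (by linarith [h.1])
  · exact div_pos (Real.sin_pos_of_pos_of_lt_pi (by linarith) (by linarith [h.2])) (by linarith)

theorem norm_one_sub_exp_div {θ : ℝ} (h0 : θ ≠ 0) :
    ‖(1 - Complex.exp (-Complex.I * θ)) * (1 / (Complex.I * θ))‖ = |Real.sinc (θ / 2)| := by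
  have h1 : (1 - Complex.exp (-Complex.I * θ)) =
      Complex.exp (-Complex.I * (θ / 2 : ℝ)) * (2 * Complex.I * (Real.sin (θ / 2) : ℝ)) := by
    rw [Complex.ofReal_sin, Complex.sin]
    have h2 : Complex.exp (-Complex.I * θ) = Complex.exp (-Complex.I * (θ / 2 : ℝ)) ^ 2 := by
      rw [← Complex.exp_nat_mul]
      congr 1
      push_cast
      ring
    have h3 : Complex.exp (-Complex.I * (θ / 2 : ℝ)) * Complex.exp (((θ / 2 : ℝ) : ℂ) * Complex.I)
        = 1 := by
      rw [← Complex.exp_add]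
      simp [mul_comm]
    rw [h2, show -((θ / 2 : ℝ) : ℂ) * Complex.I = -Complex.I * (θ / 2 : ℝ) by ring]
    linear_combination Complex.I ^ 2 * h3 +
      (1 - Complex.exp (-Complex.I * (θ / 2 : ℝ)) ^ 2) * Complex.I_sq
  rw [h1, Real.sinc_of_ne_zero (by simpa using h0), norm_mul, norm_mul]
  have h4 : ‖Complex.exp (-Complex.I * (θ / 2 : ℝ))‖ = 1 := by
    rw [show -Complex.I * ((θ / 2 : ℝ) : ℂ) = ((-(θ / 2) : ℝ) : ℂ) * Complex.I by push_cast; ring]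
    exact Complex.norm_exp_ofReal_mul_I _
  rw [h4]
  simp only [norm_mul, norm_div, Complex.norm_I, Complex.norm_real, norm_one, Real.norm_eq_abs,
    abs_div]
  rw [Complex.norm_ofNat, abs_two]
  have : |θ| ≠ 0 := abs_ne_zero.mpr h0
  field_simp

/-- The logarithm of `sinc (θ / 2)`. -/
def logSinc (θ : ℝ) : ℝ := Real.log (Real.sinc (θ / 2))

theorem analyticAt_logSinc {θ : ℝ} (h : θ ∈ Set.Icc (-Real.pi) Real.pi) :
    AnalyticAt ℝ logSinc θ := by
  have h1 : AnalyticAt ℝ (fun θ : ℝ => Real.sinc (θ / 2)) θ :=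
    AnalyticAt.fun_comp (analyticAt_sinc (θ / 2)) (analyticAt_id.div_const)
  exact h1.log (sinc_half_pos h)

theorem neg_pi_lt_pi : -Real.pi < Real.pi := by linarith [Real.pi_pos]

theorem summable_fourierCoeffOn_logSinc :
    Summable (fourierCoeffOn neg_pi_lt_pi fun θ => (logSinc θ : ℂ)) := by
  have huIcc : Set.uIcc (-Real.pi) Real.pi = Set.Icc (-Real.pi) Real.pi :=
    Set.uIcc_of_le neg_pi_lt_pi.le
  have hcont : ContinuousOn (fun θ => ((deriv logSinc θ : ℝ) : ℂ))
      (Set.Icc (-Real.pi) Real.pi) := fun θ hθ =>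
    (Complex.continuous_ofReal.continuousAt.comp
      (analyticAt_logSinc hθ).deriv.continuousAt).continuousWithinAt
  have hint : IntervalIntegrable (fun θ => ((deriv logSinc θ : ℝ) : ℂ)) volume
      (-Real.pi) Real.pi := (huIcc ▸ hcont).intervalIntegrable
  have hper : logSinc (-Real.pi) = logSinc Real.pi := by
    rw [logSinc, neg_div, Real.sinc_neg, logSinc]
  have hL2 : MemLp (fun θ => ((deriv logSinc θ : ℝ) : ℂ)) 2
      (volume.restrict (Set.Ioc (-Real.pi) Real.pi)) := by
    obtain ⟨C, hC⟩ := isCompact_Icc.exists_bound_of_continuousOn hcont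
    refine MemLp.of_bound
      ((hcont.mono Set.Ioc_subset_Icc_self).aestronglyMeasurable measurableSet_Ioc) C ?_
    filter_upwards [ae_restrict_mem measurableSet_Ioc] with θ hθ
    exact hC θ (Set.Ioc_subset_Icc_self hθ)
  have hsq := (hasSum_sq_fourierCoeffOn neg_pi_lt_pi hL2).summable
  have hinv := Real.summable_one_div_int_pow.mpr (show 1 < 2 by norm_num)
  refine Summable.of_norm_bounded_eventually (hsq.add hinv) ?_
  filter_upwards [(Set.finite_singleton (0 : ℤ)).compl_mem_cofinite] with k hk
  have hk0 : k ≠ 0 := hk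
  rw [fourierCoeffOn_of_hasDerivAt neg_pi_lt_pi hk0 (f' := fun θ => ((deriv logSinc θ : ℝ) : ℂ))
    (fun θ hθ => (analyticAt_logSinc (huIcc ▸ hθ)).differentiableAt.hasDerivAt.ofReal_comp) hint]
  rw [hper, sub_self, mul_zero, zero_sub, norm_mul, norm_neg, norm_mul]
  set x := ‖fourierCoeffOn neg_pi_lt_pi (fun θ => ((deriv logSinc θ : ℝ) : ℂ)) k‖
  have h1 : ‖(1 : ℂ) / (-2 * Real.pi * Complex.I * k)‖ = 1 / (2 * Real.pi * |(k : ℝ)|) := by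
    have : ‖(k : ℂ)‖ = |(k : ℝ)| := Complex.norm_intCast k
    simp [abs_of_pos Real.pi_pos]
  have h2 : ‖(Real.pi : ℂ) - ((-Real.pi : ℝ) : ℂ)‖ = 2 * Real.pi := by
    rw [← Complex.ofReal_sub, Complex.norm_real, Real.norm_eq_abs, abs_of_pos] <;>
      linarith [Real.pi_pos]
  rw [h1, h2, ← sq_abs (k : ℝ)]
  have hkpos : 0 < |(k : ℝ)| := abs_pos.mpr (by exact_mod_cast hk0)
  have h3 : 1 / (2 * Real.pi * |(k : ℝ)|) * (2 * Real.pi * x) = (1 / |(k : ℝ)|) * x := by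
    have := Real.pi_pos
    field_simp
  rw [h3, show 1 / |(k : ℝ)| ^ 2 = (1 / |(k : ℝ)|) ^ 2 by rw [div_pow, one_pow]]
  nlinarith [sq_nonneg (1 / |(k : ℝ)| - x), sq_nonneg x, sq_nonneg (1 / |(k : ℝ)|)]

theorem conj_fourierCoeffOn_logSinc (k : ℤ) :
    starRingEnd ℂ (fourierCoeffOn neg_pi_lt_pi (fun θ => (logSinc θ : ℂ)) k) =
      fourierCoeffOn neg_pi_lt_pi (fun θ => (logSinc θ : ℂ)) (-k) := by
  rw [fourierCoeffOn_eq_integral, fourierCoeffOn_eq_integral, Complex.real_smul,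
    Complex.real_smul, map_mul, Complex.conj_ofReal,
    intervalIntegral.integral_of_le neg_pi_lt_pi.le,
    intervalIntegral.integral_of_le neg_pi_lt_pi.le, ← integral_conj]
  congr 2
  funext θ
  rw [smul_eq_mul, smul_eq_mul, map_mul, Complex.conj_ofReal, fourier_neg, fourier_neg,
    Complex.conj_conj, fourier_neg, Complex.conj_conj]

theorem hasSum_logSinc {θ : ℝ} (hθ : θ ∈ Set.Ico (-Real.pi) Real.pi) :
    HasSum (fun k : ℤ => fourierCoeffOn neg_pi_lt_pi (fun θ => (logSinc θ : ℂ)) k *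
      Complex.exp (Complex.I * θ * k)) (logSinc θ) := by
  have : Fact (0 < 2 * Real.pi) := ⟨by linarith [Real.pi_pos]⟩
  have hend : -Real.pi + 2 * Real.pi = Real.pi := by ring
  have hc : Continuous (AddCircle.liftIco (2 * Real.pi) (-Real.pi) fun θ => (logSinc θ : ℂ)) := by
    refine AddCircle.liftIco_continuous ?_ ?_
    · rw [hend, logSinc, neg_div, Real.sinc_neg, logSinc]
    · rw [hend]
      exact fun θ hθ => (Complex.continuous_ofReal.continuousAt.comp
        (analyticAt_logSinc hθ).continuousAt).continuousWithinAt
  have hcoef : ∀ k, fourierCoeff (AddCircle.liftIco (2 * Real.pi) (-Real.pi)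
      fun θ => (logSinc θ : ℂ)) k =
      fourierCoeffOn neg_pi_lt_pi (fun θ => (logSinc θ : ℂ)) k := by
    intro k
    rw [fourierCoeff_liftIco_eq]
    simp only [hend]
  have h := has_pointwise_sum_fourier_series_of_summable
    (f := ⟨_, hc⟩) (summable_fourierCoeffOn_logSinc.congr fun k => (hcoef k).symm) (θ : AddCircle _)
  simp only [ContinuousMap.coe_mk] at h
  rw [AddCircle.liftIco_coe_apply (by rwa [hend])] at h
  convert h using 2 with k
  rw [hcoef, fourier_coe_apply]
  congr 2
  have : (Real.pi : ℂ) ≠ 0 := by exact_mod_cast Real.pi_ne_zero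
  push_cast
  field_simp

theorem norm_exp_I_mul (θ : ℝ) : ‖Complex.exp (Complex.I * θ)‖ = 1 := by
  rw [mul_comm]; exact Complex.norm_exp_ofReal_mul_I θ

theorem norm_exp_neg_I_mul (θ : ℝ) : ‖Complex.exp (-Complex.I * θ)‖ = 1 := by
  have := norm_exp_I_mul (-θ)
  rwa [Complex.ofReal_neg, mul_neg, ← neg_mul] at this

/-- `sinc (θ / 2)` is the modulus of an outer function with absolutely summable coefficients. -/
theorem exists_outer_sinc : ∃ G G' : PowerSeries ℂ, AbsSummable G ∧ AbsSummable G' ∧ G * G' = 1 ∧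
    ∀ θ ∈ Set.Ico (-Real.pi) Real.pi,
      ‖ev G (Complex.exp (-Complex.I * θ))‖ = Real.sinc (θ / 2) := by
  set x := fourierCoeffOn neg_pi_lt_pi fun θ => (logSinc θ : ℂ) with hx
  have hsum : Summable fun k : ℕ => ‖x (-(k : ℤ))‖ :=
    summable_fourierCoeffOn_logSinc.norm.comp_injective
      (i := fun k : ℕ => -(k : ℤ)) (neg_injective.comp Nat.cast_injective)
  let y : ℕ → ℂ := fun k => 2 * x (-(k : ℤ)) - if k = 0 then x 0 else 0
  have hy : AbsSummable (PowerSeries.mk y) := by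
    have h1 : Summable fun k : ℕ => ‖(if k = 0 then x 0 else 0)‖ :=
      summable_of_ne_finset_zero (s := {0}) fun k hk => by simp_all
    unfold AbsSummable
    simp only [PowerSeries.coeff_mk, y]
    refine ((hsum.mul_left 2).add h1).of_nonneg_of_le (fun _ => norm_nonneg _) fun k => ?_
    refine (norm_sub_le _ _).trans_eq ?_
    rw [norm_mul, Complex.norm_ofNat]
  obtain ⟨G, hG, hGev⟩ := exists_exp hy
  obtain ⟨G', hG', hG'ev⟩ := exists_exp hy.neg
  refine ⟨G, G', hG, hG', ?_, fun θ hθ => ?_⟩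
  · refine ext_of_ev (hG.mul hG') absSummable_one fun z hz => ?_
    rw [ev_mul hG hG' hz, hGev z hz, hG'ev z hz, ev_neg, ← Complex.exp_add, add_neg_cancel,
      Complex.exp_zero, ev_one]
  · set z := Complex.exp (-Complex.I * θ) with hz
    have hz1 : ‖z‖ ≤ 1 := (norm_exp_neg_I_mul θ).le
    have hS := (summable_mul_pow hsum hz1).of_norm.hasSum
    set S := ∑' k : ℕ, x (-(k : ℤ)) * z ^ k
    have hSc := hS.map (starRingEnd ℂ) Complex.continuous_conj
    have h1 := (hasSum_logSinc hθ).nat_add_neg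
    have hterm : ∀ k : ℕ, z ^ k = Complex.exp (Complex.I * θ * ((-(k : ℤ) : ℤ) : ℂ)) := by
      intro k
      rw [hz, ← Complex.exp_nat_mul]
      congr 1
      push_cast
      ring
    have hterm' : ∀ k : ℕ, starRingEnd ℂ (z ^ k) = Complex.exp (Complex.I * θ * ((k : ℤ) : ℂ)) := by
      intro k
      rw [hterm, ← Complex.exp_conj]
      congr 1
      simp
    have h2 : (logSinc θ : ℂ) + x 0 = starRingEnd ℂ S + S := by
      have h3 := (hSc.add hS).unique (by
        convert h1 using 2 with k
        simp only [Function.comp_apply]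
        rw [map_mul, hterm', hterm, hx, conj_fourierCoeffOn_logSinc, neg_neg])
      rw [h3]
      simp [hx]
    have h4 : ev (PowerSeries.mk y) z = 2 * S - x 0 := by
      have h5 : HasSum (fun k : ℕ => (if k = 0 then x 0 else 0) * z ^ k) (x 0) := by
        convert hasSum_ite_eq (0 : ℕ) (x 0) using 2 with k
        split_ifs with h <;> simp [h]
      rw [ev, genFun, ← ((hS.mul_left 2).sub h5).tsum_eq]
      refine tsum_congr fun k => ?_
      rw [PowerSeries.coeff_mk]
      simp only [y]
      ring
    have hx0 : (x 0).im = 0 := by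
      have := conj_fourierCoeffOn_logSinc 0
      rw [neg_zero] at this
      exact Complex.conj_eq_iff_im.mp this
    rw [hGev z hz1, Complex.norm_exp, h4]
    have h6 := congrArg Complex.re h2
    simp only [Complex.add_re, Complex.ofReal_re, Complex.conj_re] at h6
    have h7 : (2 * S - x 0).re = logSinc θ := by
      simp only [Complex.sub_re, Complex.mul_re, Complex.re_ofNat, Complex.im_ofNat, zero_mul,
        sub_zero]
      linarith
    rw [h7, logSinc, Real.exp_log (sinc_half_pos (Set.Ico_subset_Icc_self hθ))]

end StatIncr
end

noncomputable section
namespace StatIncr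

/-! Stochastic integrals as isometries. -/

theorem exists_isometry_of_gram {ι E₁ E₂ : Type*} [NormedAddCommGroup E₁] [InnerProductSpace ℂ E₁]
    [NormedAddCommGroup E₂] [InnerProductSpace ℂ E₂] [CompleteSpace E₂] {x : ι → E₁} {y : ι → E₂}
    (h : ∀ i j, inner ℂ (x i) (x j) = inner ℂ (y i) (y j))
    (hd : (Submodule.span ℂ (Set.range x)).topologicalClosure = ⊤) :
    ∃ T : E₁ →ₗᵢ[ℂ] E₂, ∀ i, T (x i) = y i := by
  set e := Finsupp.linearCombination ℂ x
  set f := Finsupp.linearCombination ℂ y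
  have hnorm : ∀ c, ‖f c‖ = ‖e c‖ := by
    intro c
    have hin : inner ℂ (f c) (f c) = inner ℂ (e c) (e c) := by
      simp only [e, f, Finsupp.linearCombination_apply, Finsupp.inner_sum, Finsupp.sum_inner,
        inner_smul_left, inner_smul_right, h]
    rw [inner_self_eq_norm_sq_to_K, inner_self_eq_norm_sq_to_K] at hin
    have h2 : ‖f c‖ ^ 2 = ‖e c‖ ^ 2 := by exact_mod_cast hin
    exact (pow_left_inj₀ (norm_nonneg _) (norm_nonneg _) two_ne_zero).mp h2
  have hdense : DenseRange e := by
    have : (LinearMap.range e : Set E₁) = Set.range e := rfl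
    rw [DenseRange, ← this, Finsupp.range_linearCombination]
    exact Submodule.dense_iff_topologicalClosure_eq_top.mpr hd
  have hT : ∀ c, f.extendOfNorm e (e c) = f c :=
    LinearMap.extendOfNorm_eq hdense ⟨1, fun c => by rw [one_mul, hnorm]⟩
  refine ⟨⟨(f.extendOfNorm e : E₁ →ₗ[ℂ] E₂), fun z => ?_⟩, fun i => ?_⟩
  · refine hdense.induction_on (p := fun z => ‖f.extendOfNorm e z‖ = ‖z‖) z ?_ fun c => ?_
    · exact isClosed_eq (f.extendOfNorm e).continuous.norm continuous_norm
    · rw [hT, hnorm]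
  · have := hT (Finsupp.single i 1)
    simpa [e, f] using this

section

variable {Ω : Type*} [MeasurableSpace Ω] {P : Measure Ω} {F : Measure ℝ} [IsFiniteMeasure F]

/-- A simple function as an element of `L²(F)`. -/
def simpleLp (F : Measure ℝ) [IsFiniteMeasure F] (s : SimpleFunc ℝ ℂ) : Lp ℂ 2 F :=
  (s.memLp_of_isFiniteMeasure 2 F).toLp s

theorem simpleLp_eq_sum (s : SimpleFunc ℝ ℂ) :
    simpleLp F s = ∑ z ∈ s.range, z • indicatorConstLp 2 (s.measurableSet_preimage {z})
      (measure_ne_top F _) (1 : ℂ) := by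
  have h1 : ∀ z : ℂ, z • indicatorConstLp 2 (s.measurableSet_preimage {z})
      (measure_ne_top F _) (1 : ℂ) =ᵐ[F] (s ⁻¹' {z}).indicator fun _ => z := by
    intro z
    filter_upwards [Lp.coeFn_smul z (indicatorConstLp 2 (s.measurableSet_preimage {z})
      (measure_ne_top F _) (1 : ℂ)), indicatorConstLp_coeFn (p := 2)
      (hs := s.measurableSet_preimage {z}) (hμs := measure_ne_top F _) (c := (1 : ℂ))] with θ h2 h3
    rw [h2, Pi.smul_apply, h3]
    simp only [Set.indicator]
    split_ifs <;> simp
  refine Lp.ext ?_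
  have h4 : ∀ᵐ θ ∂F, ∀ z ∈ s.range, (z • indicatorConstLp 2 (s.measurableSet_preimage {z})
      (measure_ne_top F _) (1 : ℂ) : Lp ℂ 2 F) θ = (s ⁻¹' {z}).indicator (fun _ => z) θ :=
    (ae_ball_iff s.range.countable_toSet).mpr fun z _ => h1 z
  filter_upwards [MemLp.coeFn_toLp (s.memLp_of_isFiniteMeasure 2 F), h4,
    Lp.coeFn_fun_finsetSum s.range fun z => z • indicatorConstLp 2 (s.measurableSet_preimage {z})
      (measure_ne_top F _) (1 : ℂ)] with θ h5 h6 h7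
  rw [simpleLp, h5, h7, Finset.sum_congr rfl h6, Finset.sum_eq_single (s θ)]
  · simp
  · intro z _ hz
    simp [Set.indicator, hz.symm]
  · simp

theorem tendsto_simpleLp {s : ℕ → SimpleFunc ℝ ℂ} {g : ℝ → ℂ} (hg : MemLp g 2 F) :
    Tendsto (fun j => simpleLp F (s j)) atTop (𝓝 (hg.toLp g)) ↔
      Tendsto (fun j => eLpNorm (fun θ => s j θ - g θ) 2 F) atTop (𝓝 0) :=
  Lp.tendsto_Lp_iff_tendsto_eLpNorm'' (fun j => s j) _ _ hg

theorem exists_simpleLp_tendsto {g : ℝ → ℂ} (hg : MemLp g 2 F) :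
    ∃ s : ℕ → SimpleFunc ℝ ℂ, Tendsto (fun j => simpleLp F (s j)) atTop (𝓝 (hg.toLp g)) := by
  have h : ∀ j : ℕ, ∃ s : SimpleFunc ℝ ℂ, eLpNorm (fun θ => s θ - g θ) 2 F < 1 / ((j : ENNReal) + 1) := by
    intro j
    obtain ⟨s, hs, -⟩ := hg.exists_simpleFunc_eLpNorm_sub_lt (by simp)
      (ε := 1 / ((j : ENNReal) + 1)) (by simp)
    refine ⟨s, ?_⟩
    rwa [eLpNorm_sub_comm] at hs
  choose s hs using h
  refine ⟨s, (tendsto_simpleLp hg).mpr ?_⟩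
  refine tendsto_of_tendsto_of_tendsto_of_le_of_le tendsto_const_nhds ?_ (fun _ => zero_le)
    (fun j => (hs j).le)
  have := (ENNReal.tendsto_inv_nat_nhds_zero).comp (tendsto_add_atTop_nat 1)
  refine this.congr fun j => ?_
  simp

theorem span_simpleLp :
    (Submodule.span ℂ (Set.range (simpleLp F))).topologicalClosure = ⊤ := by
  rw [eq_top_iff]
  intro g _
  obtain ⟨s, hs⟩ := exists_simpleLp_tendsto (Lp.memLp g)
  rw [Lp.toLp_coeFn] at hs
  exact mem_closure_of_tendsto hs
    (Eventually.of_forall fun j => Submodule.subset_span ⟨s j, rfl⟩)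

theorem inner_indicatorConstLp_one {A B : Set ℝ} (hA : MeasurableSet A) (hB : MeasurableSet B) :
    inner ℂ (indicatorConstLp 2 hA (measure_ne_top F A) (1 : ℂ))
      (indicatorConstLp 2 hB (measure_ne_top F B) (1 : ℂ)) = ((F (A ∩ B)).toReal : ℂ) := by
  rw [L2.inner_indicatorConstLp_one, setIntegral_congr_ae (g := B.indicator 1) hA,
    setIntegral_indicator hB]
  · simp [Measure.real]
  · filter_upwards [indicatorConstLp_coeFn (p := 2) (hs := hB) (hμs := measure_ne_top F B)
      (c := (1 : ℂ))] with θ h _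
    rw [h]
    rfl

theorem inner_eq_integral_mul_conj (x y : Lp ℂ 2 P) :
    inner ℂ x y = ∫ ω, y ω * starRingEnd ℂ (x ω) ∂P := by
  rw [L2.inner_def]
  rfl

theorem IsOrthogonalMeasure.inner_eq {F : Measure ℝ} {Z : Set ℝ → Lp ℂ 2 P} (hZ : IsOrthogonalMeasure F Z)
    {A B : Set ℝ} (hA : MeasurableSet A) (hB : MeasurableSet B) :
    inner ℂ (Z A) (Z B) = ((F (A ∩ B)).toReal : ℂ) := by
  rw [inner_eq_integral_mul_conj, hZ B A hB hA, Set.inter_comm]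

theorem isStochasticIntegral_iff {Z : Set ℝ → Lp ℂ 2 P} {T : Lp ℂ 2 F →ₗᵢ[ℂ] Lp ℂ 2 P}
    (hT : ∀ s, T (simpleLp F s) = simpleIntegral Z s) {g : ℝ → ℂ} {J : Lp ℂ 2 P} :
    IsStochasticIntegral F Z g J ↔ ∃ hg : MemLp g 2 F, T (hg.toLp g) = J := by
  constructor
  · rintro ⟨hg, s, h1, h2⟩
    refine ⟨hg, tendsto_nhds_unique ?_ h2⟩
    simp only [← hT]
    exact (T.continuous.tendsto _).comp ((tendsto_simpleLp hg).mpr h1)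
  · rintro ⟨hg, rfl⟩
    obtain ⟨s, hs⟩ := exists_simpleLp_tendsto hg
    refine ⟨hg, s, (tendsto_simpleLp hg).mp hs, ?_⟩
    simp only [← hT]
    exact (T.continuous.tendsto _).comp hs

/-- The stochastic integral with respect to an orthogonal stochastic measure is an isometry. -/
theorem IsOrthogonalMeasure.exists_isometry {Z : Set ℝ → Lp ℂ 2 P}
    (hZ : IsOrthogonalMeasure F Z) : ∃ T : Lp ℂ 2 F →ₗᵢ[ℂ] Lp ℂ 2 P, ∀ g J,
      IsStochasticIntegral F Z g J ↔ ∃ hg : MemLp g 2 F, T (hg.toLp g) = J := by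
  obtain ⟨T, hT⟩ := exists_isometry_of_gram (x := simpleLp F) (y := simpleIntegral Z) (by
    intro s t
    simp only [simpleLp_eq_sum, simpleIntegral, sum_inner, inner_sum, inner_smul_left,
      inner_smul_right, inner_indicatorConstLp_one,
      hZ.inner_eq (s.measurableSet_preimage _) (t.measurableSet_preimage _)]) span_simpleLp
  exact ⟨T, fun g J => isStochasticIntegral_iff hT⟩

/-- Every isometry of `L²(F)` into `L²(Ω)` is a stochastic integral. -/
theorem exists_isOrthogonalMeasure (T : Lp ℂ 2 F →ₗᵢ[ℂ] Lp ℂ 2 P) :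
    ∃ Z : Set ℝ → Lp ℂ 2 P, IsOrthogonalMeasure F Z ∧ ∀ g J,
      IsStochasticIntegral F Z g J ↔ ∃ hg : MemLp g 2 F, T (hg.toLp g) = J := by
  classical
  let Z : Set ℝ → Lp ℂ 2 P := fun A =>
    if h : MeasurableSet A then T (indicatorConstLp 2 h (measure_ne_top F A) (1 : ℂ)) else 0
  have hZ : ∀ {A} (h : MeasurableSet A),
      Z A = T (indicatorConstLp 2 h (measure_ne_top F A) (1 : ℂ)) := fun h => dif_pos h
  refine ⟨Z, fun A B hA hB => ?_, fun g J => isStochasticIntegral_iff fun s => ?_⟩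
  · rw [← inner_eq_integral_mul_conj, hZ hA, hZ hB, T.inner_map_map,
      inner_indicatorConstLp_one, Set.inter_comm]
  · rw [simpleLp_eq_sum, simpleIntegral, map_sum]
    refine Finset.sum_congr rfl fun z _ => ?_
    rw [map_smul, hZ (s.measurableSet_preimage {z})]

end

end StatIncr
end

noncomputable section
namespace StatIncr

/-! The space `L²(F)` of the spectral measure. -/

theorem hasSum_mem_of_isClosed {V : Type*} [NormedAddCommGroup V] [NormedSpace ℂ V]
    {K : Submodule ℂ V} (hK : IsClosed (K : Set V)) {ι : Type*} {u : ι → V} {x : V}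
    (hu : HasSum u x) (h : ∀ i, u i ∈ K) : x ∈ K :=
  hK.mem_of_tendsto hu (Eventually.of_forall fun _ => K.sum_mem fun i _ => h i)

theorem act_mem {V : Type*} [NormedAddCommGroup V] [NormedSpace ℂ V] [CompleteSpace V]
    {K : Submodule ℂ V} (hK : IsClosed (K : Set V)) {c : PowerSeries ℂ} (hc : AbsSummable c)
    {u : ℤ → V} {B : ℝ} (hu : ∀ m, ‖u m‖ ≤ B) {m : ℤ} (h : ∀ j ≤ m, u j ∈ K) : act c u m ∈ K :=
  hasSum_mem_of_isClosed hK (hasSum_act hc hu m) fun k => K.smul_mem _ (h _ (by omega))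

theorem hasSum_toLp_mul {F : Measure ℝ} {x : ℕ → ℂ} (hx : Summable fun k => ‖x k‖)
    {w : ℕ → ℝ → ℂ} (hw : ∀ k θ, ‖w k θ‖ ≤ 1) {u : ℝ → ℂ}
    (hwu : ∀ k, MemLp (fun θ => w k θ * u θ) 2 F) (hu : MemLp u 2 F) {g : ℝ → ℂ}
    (hg : MemLp g 2 F) (hgw : ∀ᵐ θ ∂F, g θ = (∑' k, x k * w k θ) * u θ) :
    HasSum (fun k => x k • (hwu k).toLp) (hg.toLp g) := by
  rw [HasSum, tendsto_iff_norm_sub_tendsto_zero]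
  have h1 : Tendsto (fun s : Finset ℕ => (∑' k : {k // k ∉ s}, ‖x k‖) * ‖hu.toLp u‖) atTop (𝓝 0) := by
    have := (tendsto_tsum_compl_atTop_zero fun k => ‖x k‖).mul_const ‖hu.toLp u‖
    rwa [zero_mul] at this
  refine squeeze_zero (fun _ => norm_nonneg _) (fun s => ?_) h1
  refine Lp.norm_le_mul_norm_of_ae_le_mul ?_
  have h2 : ∀ᵐ θ ∂F, ∀ k ∈ s, (x k • (hwu k).toLp : Lp ℂ 2 F) θ = x k * (w k θ * u θ) := by
    refine (ae_ball_iff s.countable_toSet).mpr fun k _ => ?_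
    filter_upwards [Lp.coeFn_smul (x k) (hwu k).toLp, (hwu k).coeFn_toLp] with θ h3 h4
    rw [h3, Pi.smul_apply, h4, smul_eq_mul]
  filter_upwards [h2, hgw, hg.coeFn_toLp, hu.coeFn_toLp, Lp.coeFn_sub
    (∑ k ∈ s, x k • (hwu k).toLp) (hg.toLp g), Lp.coeFn_fun_finsetSum s fun k =>
      x k • (hwu k).toLp] with θ h3 h4 h5 h6 h7 h8
  rw [h7, Pi.sub_apply, h8, Finset.sum_congr rfl h3, h5, h6, h4]
  have hs : Summable fun k => ‖x k * w k θ‖ := by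
    refine hx.of_nonneg_of_le (fun _ => norm_nonneg _) fun k => ?_
    rw [norm_mul]
    exact mul_le_of_le_one_right (norm_nonneg _) (hw k θ)
  have h9 : ∑ k ∈ s, x k * (w k θ * u θ) - (∑' k, x k * w k θ) * u θ =
      -((∑' k : {k // k ∉ s}, x k * w k θ) * u θ) := by
    rw [← hs.of_norm.sum_add_tsum_compl (s := s), add_mul, Finset.sum_mul]
    simp only [mul_assoc]
    rw [sub_add_cancel_left]
    rfl
  rw [h9, norm_neg, norm_mul]
  refine mul_le_mul_of_nonneg_right ?_ (norm_nonneg _)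
  have h10 : Summable fun k : {k // k ∉ s} => ‖x k * w k θ‖ := hs.subtype _
  refine (norm_tsum_le_tsum_norm h10).trans (h10.tsum_le_tsum (fun k => ?_) (hx.subtype _))
  rw [norm_mul]
  exact mul_le_of_le_one_right (norm_nonneg _) (hw k θ)

theorem inner_toLp {α : Type*} [MeasurableSpace α] {F : Measure α} {g h : α → ℂ}
    (hg : MemLp g 2 F) (hh : MemLp h 2 F) :
    inner ℂ (hg.toLp g) (hh.toLp h) = ∫ θ, h θ * starRingEnd ℂ (g θ) ∂F := by
  rw [L2.inner_def]
  refine integral_congr_ae ?_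
  filter_upwards [hg.coeFn_toLp, hh.coeFn_toLp] with θ h1 h2
  rw [h1, h2]
  rfl

section Density

/-- Lebesgue measure on `[-π, π)`. -/
def circleMeasure : Measure ℝ := volume.restrict (Set.Ico (-Real.pi) Real.pi)

instance : IsFiniteMeasure circleMeasure :=
  inferInstanceAs (IsFiniteMeasure (volume.restrict (Set.Ico (-Real.pi) Real.pi)))

/-- `κ` is a measurable function with `|κ|² f = 1` almost everywhere. -/
structure IsWhitening (f : ℝ → ℝ) (κ : ℝ → ℂ) : Prop where
  aemeasurable : AEMeasurable f circleMeasure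
  nonneg : ∀ᵐ θ ∂circleMeasure, 0 ≤ f θ
  measurable : Measurable κ
  norm_sq : ∀ᵐ θ ∂circleMeasure, ‖κ θ‖ ^ 2 * f θ = 1

variable {f : ℝ → ℝ} {κ : ℝ → ℂ}

theorem integral_spectralMeasure (hf : AEMeasurable f circleMeasure)
    (h0 : ∀ᵐ θ ∂circleMeasure, 0 ≤ f θ) {E : Type*} [NormedAddCommGroup E] [NormedSpace ℝ E]
    (g : ℝ → E) :
    ∫ θ, g θ ∂(spectralMeasure f) = ∫ θ, (f θ / (2 * Real.pi)) • g θ ∂circleMeasure := by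
  rw [spectralMeasure, ← circleMeasure, integral_withDensity_eq_integral_toReal_smul₀
    (hf.div_const _).ennreal_ofReal (by simp)]
  refine integral_congr_ae ?_
  filter_upwards [h0] with θ h
  rw [ENNReal.toReal_ofReal (div_nonneg h (by positivity))]

theorem spectralMeasure_absolutelyContinuous (f : ℝ → ℝ) : spectralMeasure f ≪ circleMeasure :=
  withDensity_absolutelyContinuous _ _

theorem integrable_spectralMeasure_iff (hf : AEMeasurable f circleMeasure)
    (h0 : ∀ᵐ θ ∂circleMeasure, 0 ≤ f θ) {g : ℝ → ℝ} :
    Integrable g (spectralMeasure f) ↔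
      Integrable (fun θ => (f θ / (2 * Real.pi)) • g θ) circleMeasure := by
  rw [spectralMeasure, ← circleMeasure, integrable_withDensity_iff_integrable_smul₀'
    (hf.div_const _).ennreal_ofReal (by simp)]
  refine integrable_congr ?_
  filter_upwards [h0] with θ h
  rw [ENNReal.toReal_ofReal (div_nonneg h (by positivity))]

theorem integral_exp_circle (k : ℤ) :
    ∫ θ, Complex.exp (Complex.I * θ * k) ∂circleMeasure = if k = 0 then 2 * Real.pi else 0 := by
  rw [circleMeasure, integral_Ico_eq_integral_Ioo, ← integral_Ioc_eq_integral_Ioo,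
    ← intervalIntegral.integral_of_le neg_pi_lt_pi.le]
  split_ifs with h
  · subst h
    simp
    ring
  · have hk : (Complex.I * k : ℂ) ≠ 0 := by simp [h]
    have h1 : ∀ θ : ℝ, Complex.exp (Complex.I * θ * k) = Complex.exp (Complex.I * k * θ) :=
      fun θ => by congr 1; ring
    simp only [h1]
    rw [integral_exp_mul_complex hk]
    have h2 : Complex.exp (Complex.I * k * Real.pi) =
        Complex.exp (Complex.I * k * (-Real.pi : ℝ)) := by
      rw [Complex.exp_eq_exp_iff_exists_int]
      exact ⟨k, by push_cast; ring⟩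
    rw [h2, sub_self, zero_div, Complex.ofReal_zero]

theorem norm_exp_I_mul_int (θ : ℝ) (m : ℤ) : ‖Complex.exp (Complex.I * θ * m)‖ = 1 := by
  have := norm_exp_I_mul (θ * m)
  rwa [Complex.ofReal_mul, Complex.ofReal_intCast, ← mul_assoc] at this

theorem memLp_exp_mul {F : Measure ℝ} {u : ℝ → ℂ} (hu : MemLp u 2 F) (m : ℤ) :
    MemLp (fun θ : ℝ => Complex.exp (Complex.I * θ * m) * u θ) 2 F := by
  refine hu.of_le ?_ (Eventually.of_forall fun θ => ?_)
  · exact AEStronglyMeasurable.mul (by fun_prop) hu.1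
  · rw [norm_mul, norm_exp_I_mul_int, one_mul]

/-- The function `e^{iθm} u(θ)` as an element of `L²(F)`. -/
def waveLp {F : Measure ℝ} {u : ℝ → ℂ} (hu : MemLp u 2 F) (m : ℤ) : Lp ℂ 2 F :=
  (memLp_exp_mul hu m).toLp

theorem norm_waveLp_le {F : Measure ℝ} {u : ℝ → ℂ} (hu : MemLp u 2 F) (m : ℤ) :
    ‖waveLp hu m‖ ≤ ‖hu.toLp u‖ := by
  have h := Lp.norm_le_mul_norm_of_ae_le_mul (c := 1) (f := waveLp hu m) (g := hu.toLp u) (by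
    filter_upwards [(memLp_exp_mul hu m).coeFn_toLp, hu.coeFn_toLp] with θ h1 h2
    rw [waveLp, h1, h2, norm_mul, norm_exp_I_mul_int])
  rwa [one_mul] at h

theorem conj_exp_I_mul_int (θ : ℝ) (m : ℤ) : starRingEnd ℂ (Complex.exp (Complex.I * θ * m)) =
    Complex.exp (Complex.I * θ * ((-m : ℤ) : ℂ)) := by
  rw [← Complex.exp_conj]
  congr 1
  simp

theorem IsWhitening.memLp (h : IsWhitening f κ) : MemLp κ 2 (spectralMeasure f) := by
  rw [memLp_two_iff_integrable_sq_norm h.measurable.aestronglyMeasurable,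
    integrable_spectralMeasure_iff h.aemeasurable h.nonneg]
  refine (integrable_const (1 / (2 * Real.pi))).congr ?_
  filter_upwards [h.norm_sq] with θ h1
  rw [smul_eq_mul, div_mul_eq_mul_div, mul_comm (f θ), h1]

theorem IsWhitening.inner_eq (h : IsWhitening f κ) (i j : ℤ) :
    inner ℂ (waveLp h.memLp i) (waveLp h.memLp j) = if j - i = 0 then 1 else 0 := by
  have hπ : (Real.pi : ℂ) ≠ 0 := by exact_mod_cast Real.pi_ne_zero
  rw [waveLp, waveLp, inner_toLp, integral_spectralMeasure h.aemeasurable h.nonneg,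
    integral_congr_ae (g := fun θ : ℝ => (1 / (2 * Real.pi) : ℂ) *
      Complex.exp (Complex.I * θ * (j - i : ℤ))), integral_const_mul, integral_exp_circle]
  · split_ifs
    · push_cast
      field_simp
    · simp
  · filter_upwards [h.norm_sq] with θ h1
    have h2 : κ θ * starRingEnd ℂ (κ θ) * f θ = 1 := by
      rw [Complex.mul_conj, Complex.normSq_eq_norm_sq]
      exact_mod_cast h1
    have h3 : Complex.exp (Complex.I * θ * (j - i : ℤ)) =
        Complex.exp (Complex.I * θ * j) * Complex.exp (Complex.I * θ * ((-i : ℤ) : ℂ)) := by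
      rw [← Complex.exp_add]
      congr 1
      push_cast
      ring
    rw [map_mul, conj_exp_I_mul_int, h3, Complex.real_smul]
    push_cast
    linear_combination (1 / (2 * Real.pi) * Complex.exp (Complex.I * θ * j) *
      Complex.exp (Complex.I * θ * -i) : ℂ) * h2

theorem IsWhitening.orthonormal (h : IsWhitening f κ) : Orthonormal ℂ (waveLp h.memLp) := by
  rw [orthonormal_iff_ite]
  intro i j
  rw [h.inner_eq]
  simp only [sub_eq_zero, eq_comm]

theorem circleMeasure_eq_Ioc : circleMeasure = volume.restrict (Set.Ioc (-Real.pi) Real.pi) := by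
  rw [circleMeasure, Measure.restrict_congr_set Ico_ae_eq_Ioc]

theorem eq_zero_of_fourier {H : ℝ → ℂ} (hH : MemLp H 2 circleMeasure)
    (h : ∀ j : ℤ, ∫ θ, Complex.exp (Complex.I * θ * (-j : ℤ)) * H θ ∂circleMeasure = 0) :
    ∀ᵐ θ ∂circleMeasure, H θ = 0 := by
  have hH' := hH
  rw [circleMeasure_eq_Ioc] at hH'
  have h1 := hasSum_sq_fourierCoeffOn neg_pi_lt_pi hH'
  have h2 : ∀ j, fourierCoeffOn neg_pi_lt_pi H j = 0 := by
    intro j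
    rw [fourierCoeffOn_eq_integral, intervalIntegral.integral_of_le neg_pi_lt_pi.le,
      ← circleMeasure_eq_Ioc]
    have : ∀ θ : ℝ, (fourier (-j) (θ : AddCircle (Real.pi - -Real.pi)) : ℂ) • H θ =
        Complex.exp (Complex.I * θ * (-j : ℤ)) * H θ := by
      intro θ
      rw [fourier_coe_apply, smul_eq_mul]
      congr 2
      have : (Real.pi : ℂ) ≠ 0 := by exact_mod_cast Real.pi_ne_zero
      push_cast
      rw [sub_neg_eq_add, ← two_mul]
      field_simp
    simp only [this]
    rw [h j, smul_zero]
  simp only [h2, norm_zero, ne_eq, OfNat.ofNat_ne_zero, not_false_eq_true, zero_pow] at h1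
  have h3 := h1.unique hasSum_zero
  rw [smul_eq_mul, intervalIntegral.integral_of_le neg_pi_lt_pi.le, ← circleMeasure_eq_Ioc] at h3
  have h4 : ∫ θ, ‖H θ‖ ^ 2 ∂circleMeasure = 0 := by
    refine (mul_eq_zero.mp h3).resolve_left (inv_ne_zero ?_)
    linarith [Real.pi_pos]
  have h5 := (integral_eq_zero_iff_of_nonneg (fun θ => by positivity)
    ((memLp_two_iff_integrable_sq_norm hH.1).mp hH)).mp h4
  filter_upwards [h5] with θ h6
  simpa using h6

theorem IsWhitening.span_eq_top (h : IsWhitening f κ) :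
    (Submodule.span ℂ (Set.range (waveLp h.memLp))).topologicalClosure = ⊤ := by
  rw [Submodule.topologicalClosure_eq_top_iff, Submodule.eq_bot_iff]
  intro g hg
  have horth : ∀ j, inner ℂ (waveLp h.memLp j) g = 0 := fun j =>
    (Submodule.mem_orthogonal _ _).mp hg _ (Submodule.subset_span ⟨j, rfl⟩)
  let H : ℝ → ℂ := fun θ => starRingEnd ℂ (κ θ) * (g θ * f θ)
  have hHm : AEStronglyMeasurable H circleMeasure := by
    refine (Complex.continuous_conj.comp_aestronglyMeasurable
      h.measurable.aestronglyMeasurable).mul ?_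
    refine (Lp.stronglyMeasurable g).aestronglyMeasurable.mul ?_
    exact Complex.continuous_ofReal.comp_aestronglyMeasurable h.aemeasurable.aestronglyMeasurable
  have hH : MemLp H 2 circleMeasure := by
    rw [memLp_two_iff_integrable_sq_norm hHm]
    have h1 := (memLp_two_iff_integrable_sq_norm (Lp.memLp g).1).mp (Lp.memLp g)
    rw [integrable_spectralMeasure_iff h.aemeasurable h.nonneg] at h1
    refine (h1.const_mul (2 * Real.pi)).congr ?_
    filter_upwards [h.norm_sq, h.nonneg] with θ h2 h3
    simp only [H]
    rw [norm_mul, norm_mul, RCLike.norm_conj, Complex.norm_real, Real.norm_of_nonneg h3, mul_pow,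
      mul_pow, smul_eq_mul]
    have := Real.pi_ne_zero
    field_simp
    linear_combination (-(‖g θ‖ ^ 2 * f θ)) * h2
  have h0 := eq_zero_of_fourier hH (fun j => by
    have h1 := horth j
    rw [← Lp.toLp_coeFn g (Lp.memLp g), waveLp, inner_toLp,
      integral_spectralMeasure h.aemeasurable h.nonneg] at h1
    have h2 : ∀ θ : ℝ, Complex.exp (Complex.I * θ * (-j : ℤ)) * H θ = (2 * Real.pi : ℂ) *
        ((f θ / (2 * Real.pi)) • (g θ * starRingEnd ℂ (Complex.exp (Complex.I * θ * j) * κ θ))) := by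
      intro θ
      have : (Real.pi : ℂ) ≠ 0 := by exact_mod_cast Real.pi_ne_zero
      rw [map_mul, conj_exp_I_mul_int, Complex.real_smul]
      simp only [H]
      push_cast
      field_simp
    simp only [h2]
    rw [integral_const_mul, h1, mul_zero])
  refine Lp.ext ?_
  refine EventuallyEq.trans ?_ (Lp.coeFn_zero ℂ 2 (spectralMeasure f)).symm
  refine (spectralMeasure_absolutelyContinuous f).ae_le ?_
  filter_upwards [h0, h.norm_sq] with θ h1 h2
  have h3 : κ θ ≠ 0 := by
    intro h
    simp [h] at h2
  have h4 : f θ ≠ 0 := by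
    intro h
    simp [h] at h2
  simp only [H, mul_eq_zero, map_eq_zero, h3, false_or, Complex.ofReal_eq_zero, h4, or_false] at h1
  exact h1

end Density

end StatIncr
end

noncomputable section
namespace StatIncr

/-! The outer factor of the increments with step one. -/

/-- `γ` and `ψ` are mutually inverse, absolutely summable power series with
`|γ(e^{-iθ})|² = |1 - e^{-iθ}|^{2n} |θ|^{-2n} f(θ)`. -/
structure IsOuterPair (n : ℕ) (f : ℝ → ℝ) (γ ψ : PowerSeries ℂ) : Prop where
  summable : AbsSummable γ
  summable_inv : AbsSummable ψ
  mul_eq : γ * ψ = 1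
  aemeasurable : AEMeasurable f circleMeasure
  nonneg : ∀ᵐ θ ∂circleMeasure, 0 ≤ f θ
  norm_sq : ∀ᵐ θ : ℝ ∂circleMeasure,
    ‖ev γ (Complex.exp (-Complex.I * θ))‖ ^ 2 = ‖kernel n 1 θ‖ ^ 2 * f θ
  le : ∃ C, ∀ᵐ θ ∂circleMeasure, f θ ≤ C

theorem kernel_one_eq (n : ℕ) (θ : ℝ) :
    kernel n 1 θ = ((1 - Complex.exp (-Complex.I * θ)) * (1 / (Complex.I * θ))) ^ n := by
  rw [kernel, mul_pow _ (1 / (Complex.I * (θ : ℂ))), div_pow, one_pow, Int.cast_one, mul_one]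

theorem ae_ne_zero_circleMeasure : ∀ᵐ θ ∂circleMeasure, θ ≠ 0 := by
  rw [circleMeasure]
  refine ae_restrict_of_ae ?_
  rw [ae_iff]
  simp

theorem continuous_ev {c : PowerSeries ℂ} (hc : AbsSummable c) :
    Continuous fun θ : ℝ => ev c (Complex.exp (-Complex.I * θ)) := by
  refine continuous_tsum (fun k => by fun_prop) hc fun k θ => ?_
  rw [norm_mul, norm_pow, norm_exp_neg_I_mul, one_pow, mul_one]

theorem exists_isOuterPair {f : ℝ → ℝ} {φ : ℕ → ℂ} (hφ : IsCanonicalFactorization f φ) (n : ℕ) :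
    ∃ γ ψ : PowerSeries ℂ, IsOuterPair n f γ ψ := by
  obtain ⟨G, G', hG, hG', hGG, hsinc⟩ := exists_outer_sinc
  obtain ⟨d, hd, hdev⟩ := exists_inverse hφ.radius hφ.ne_zero
  have hp : AbsSummable (PowerSeries.mk φ) := by
    have := absSummable_mk_of_radius hφ.radius
    convert this using 2
    funext k
    simp [FormalMultilinearSeries.coeff_ofScalars]
  have hpev : ∀ z, ev (PowerSeries.mk φ) z = genFun φ z := fun z => by simp [ev]
  have hpd : PowerSeries.mk φ * d = 1 := by
    refine ext_of_ev (hp.mul hd) absSummable_one fun z hz => ?_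
    rw [ev_mul hp hd hz, hdev z hz, hpev, ev_one]
    exact mul_inv_cancel₀ (hφ.ne_zero z hz)
  have hf : ∀ᵐ θ : ℝ ∂circleMeasure,
      f θ = ‖ev (PowerSeries.mk φ) (Complex.exp (-Complex.I * θ))‖ ^ 2 := by
    filter_upwards [hφ.eq] with θ h
    rw [h, hpev, genFun]
  refine ⟨G ^ n * PowerSeries.mk φ, G' ^ n * d, (hG.pow n).mul hp, (hG'.pow n).mul hd, ?_, ?_, ?_,
    ?_, absSum (PowerSeries.mk φ) ^ 2, ?_⟩
  · rw [mul_mul_mul_comm, ← mul_pow, hGG, hpd, one_pow, one_mul]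
  · exact (((continuous_ev hp).norm.pow 2).aemeasurable).congr (hf.mono fun θ h => h.symm)
  · filter_upwards [hf] with θ h
    rw [h]
    positivity
  · filter_upwards [hf, ae_ne_zero_circleMeasure,
      ae_restrict_mem (measurableSet_Ico (a := -Real.pi) (b := Real.pi))] with θ h h0 hθ
    have hz : ‖Complex.exp (-Complex.I * θ)‖ ≤ 1 := (norm_exp_neg_I_mul θ).le
    rw [ev_mul (hG.pow n) hp hz, ev_pow hG hz, kernel_one_eq, norm_mul, norm_pow, norm_pow,
      hsinc θ hθ, norm_one_sub_exp_div h0, abs_of_pos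
      (sinc_half_pos (Set.Ico_subset_Icc_self hθ)), mul_pow, h]
  · filter_upwards [hf] with θ h
    rw [h]
    exact pow_le_pow_left₀ (norm_nonneg _) (norm_ev_le hp (norm_exp_neg_I_mul θ).le) 2

theorem measurable_kernel (n : ℕ) (ν : ℤ) : Measurable (kernel n ν) := by
  unfold kernel
  fun_prop

theorem norm_kernel_le (n : ℕ) (ν : ℤ) (θ : ℝ) : ‖kernel n ν θ‖ ≤ |(ν : ℝ)| ^ n := by
  by_cases h0 : θ = 0
  · subst h0
    rcases Nat.eq_zero_or_pos n with rfl | hn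
    · simp [kernel]
    · simp [kernel, hn.ne']
  have h1 : ‖1 - Complex.exp (-Complex.I * θ * ν)‖ ≤ |(ν : ℝ)| * |θ| := by
    have := Real.norm_exp_I_mul_ofReal_sub_one_le (x := -θ * ν)
    rw [norm_sub_rev]
    calc ‖Complex.exp (-Complex.I * θ * ν) - 1‖
        = ‖Complex.exp (Complex.I * ((-θ * ν : ℝ) : ℂ)) - 1‖ := by
          congr 3
          push_cast
          ring
      _ ≤ ‖-θ * (ν : ℝ)‖ := this
      _ = |(ν : ℝ)| * |θ| := by rw [Real.norm_eq_abs, abs_mul, abs_neg, mul_comm]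
  have h2 : 0 < |θ| := abs_pos.mpr h0
  rw [kernel, norm_mul, norm_pow, norm_div, norm_pow, norm_one, norm_mul, Complex.norm_I, one_mul,
    Complex.norm_real, Real.norm_eq_abs, mul_one_div, div_le_iff₀ (by positivity), ← mul_pow]
  exact pow_le_pow_left₀ (norm_nonneg _) h1 n

variable {n : ℕ} {f : ℝ → ℝ} {γ ψ : PowerSeries ℂ}

theorem IsOuterPair.isFiniteMeasure (h : IsOuterPair n f γ ψ) :
    IsFiniteMeasure (spectralMeasure f) := by
  obtain ⟨C, hC⟩ := h.le
  refine isFiniteMeasure_withDensity_ofReal (Integrable.hasFiniteIntegral ?_)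
  refine Integrable.div_const ?_ _
  refine Integrable.of_bound h.aemeasurable.aestronglyMeasurable C ?_
  filter_upwards [hC, h.nonneg] with θ h1 h2
  rwa [Real.norm_of_nonneg h2]

theorem IsOuterPair.memLp_kernel (h : IsOuterPair n f γ ψ) (ν : ℤ) :
    MemLp (kernel n ν) 2 (spectralMeasure f) := by
  have := h.isFiniteMeasure
  exact MemLp.of_bound (measurable_kernel n ν).aestronglyMeasurable (|(ν : ℝ)| ^ n)
    (Eventually.of_forall (norm_kernel_le n ν))

/-- The function `(1 - e^{-iθ})ⁿ (iθ)^{-n} / γ(e^{-iθ})`. -/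
def whitener (n : ℕ) (ψ : PowerSeries ℂ) (θ : ℝ) : ℂ :=
  ev ψ (Complex.exp (-Complex.I * θ)) * kernel n 1 θ

theorem IsOuterPair.ev_mul_ev (h : IsOuterPair n f γ ψ) (θ : ℝ) :
    ev γ (Complex.exp (-Complex.I * θ)) * ev ψ (Complex.exp (-Complex.I * θ)) = 1 := by
  rw [← ev_mul h.summable h.summable_inv (norm_exp_neg_I_mul θ).le, h.mul_eq, ev_one]

theorem IsOuterPair.isWhitening (h : IsOuterPair n f γ ψ) : IsWhitening f (whitener n ψ) where
  aemeasurable := h.aemeasurable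
  nonneg := h.nonneg
  measurable := (continuous_ev h.summable_inv).measurable.mul (measurable_kernel n 1)
  norm_sq := by
    filter_upwards [h.norm_sq] with θ h1
    rw [whitener, norm_mul, mul_pow, mul_assoc, ← h1, ← mul_pow, ← norm_mul, mul_comm,
      h.ev_mul_ev, norm_one, one_pow]

/-- Moving averages of the waves `e^{iθm} u(θ)`. -/
theorem act_waveLp {F : Measure ℝ} {c : PowerSeries ℂ} (hc : AbsSummable c) {u v : ℝ → ℂ}
    (hu : MemLp u 2 F) (hv : MemLp v 2 F)
    (huv : ∀ᵐ θ : ℝ ∂F, v θ = ev c (Complex.exp (-Complex.I * θ)) * u θ) :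
    act c (waveLp hu) = waveLp hv := by
  funext m
  refine (hasSum_toLp_mul hc (w := fun k θ => Complex.exp (Complex.I * θ * ((m - k : ℤ) : ℂ)))
    (fun k θ => (norm_exp_I_mul_int θ _).le) (fun k => memLp_exp_mul hu (m - k)) hu
    (memLp_exp_mul hv m) ?_).tsum_eq
  filter_upwards [huv] with θ h
  rw [h, ← mul_assoc, ev, genFun, ← tsum_mul_left]
  congr 2
  funext k
  rw [← Complex.exp_nat_mul, mul_left_comm, ← Complex.exp_add]
  congr 2
  push_cast
  ring

theorem IsOuterPair.act_kernel (h : IsOuterPair n f γ ψ) :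
    act ψ (waveLp (h.memLp_kernel 1)) = waveLp h.isWhitening.memLp :=
  act_waveLp h.summable_inv _ _ (Eventually.of_forall fun _ => rfl)

theorem IsOuterPair.span_kernel (h : IsOuterPair n f γ ψ) :
    (Submodule.span ℂ (Set.range fun p : ℤ × ℤ =>
      waveLp (h.memLp_kernel p.2) p.1)).topologicalClosure = ⊤ := by
  rw [eq_top_iff, ← h.isWhitening.span_eq_top]
  refine Submodule.topologicalClosure_minimal _ (Submodule.span_le.mpr ?_)
    (Submodule.isClosed_topologicalClosure _)
  rintro _ ⟨m, rfl⟩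
  rw [← h.act_kernel]
  refine act_mem (Submodule.isClosed_topologicalClosure _) h.summable_inv
    (norm_waveLp_le (h.memLp_kernel 1)) fun j _ => ?_
  exact Submodule.le_topologicalClosure _ (Submodule.subset_span ⟨(j, 1), rfl⟩)

theorem increment_eq_diffOp {Ω : Type*} (n : ℕ) (ξ : ℤ → Ω → ℂ) (m ν : ℤ) :
    increment n ξ m ν = diffOp n ν ξ m := by
  funext ω
  simp [increment, diffOp]

section Probability

variable {Ω : Type*} [MeasurableSpace Ω] {P : Measure Ω} {ξ : ℤ → Ω → ℂ}

theorem IsOuterPair.inner_incr (h : IsOuterPair n f γ ψ) (hξ : HasStationaryIncrements P n ξ)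
    (hf : IsSpectralDensity P n ξ f) (p q : ℤ × ℤ) :
    inner ℂ (waveLp (h.memLp_kernel p.2) p.1) (waveLp (h.memLp_kernel q.2) q.1) =
      inner ℂ (hξ.incr p.1 p.2) (hξ.incr q.1 q.2) := by
  obtain ⟨m₂, ν₂⟩ := p
  obtain ⟨m₁, ν₁⟩ := q
  have h1 := hf m₂ (m₁ - m₂) ν₁ ν₂
  rw [add_sub_cancel] at h1
  simp only [HasStationaryIncrements.incr]
  rw [waveLp, waveLp, inner_toLp, inner_toLp, h1, integral_spectralMeasure h.aemeasurable h.nonneg,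
    ← integral_const_mul]
  refine integral_congr_ae (ae_of_all _ fun θ => ?_)
  have h2 : starRingEnd ℂ (kernel n ν₂ θ) =
      (1 - Complex.exp (Complex.I * ν₂ * θ)) ^ n * (1 / (-(Complex.I * θ)) ^ n) := by
    have : -Complex.I * θ * ν₂ = Complex.I * θ * ((-ν₂ : ℤ) : ℂ) := by push_cast; ring
    rw [kernel, this, map_mul, map_pow, map_sub, conj_exp_I_mul_int, map_div₀, map_pow, map_mul]
    simp only [map_one, Complex.conj_I, Complex.conj_ofReal, neg_neg, neg_mul]
    rw [show Complex.I * ν₂ * θ = Complex.I * θ * ν₂ by ring]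
  have h3 : Complex.exp (Complex.I * θ * ((m₁ - m₂ : ℤ) : ℂ)) =
      Complex.exp (Complex.I * θ * m₁) * Complex.exp (Complex.I * θ * ((-m₂ : ℤ) : ℂ)) := by
    rw [← Complex.exp_add]
    congr 1
    push_cast
    ring
  have h4 : (1 : ℂ) / (θ : ℂ) ^ (2 * n) =
      1 / (Complex.I * θ) ^ n * (1 / (-(Complex.I * θ)) ^ n) := by
    rw [div_mul_div_comm, one_mul, ← mul_pow, mul_neg, ← pow_two, mul_pow, Complex.I_sq, neg_one_mul,
      neg_neg, pow_mul]
  have h5 : -Complex.I * ν₁ * θ = -Complex.I * θ * ν₁ := by ring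
  simp only [map_mul]
  rw [conj_exp_I_mul_int, h2, h3, h4, h5, kernel, Complex.real_smul]
  push_cast
  have : (Real.pi : ℂ) ≠ 0 := by exact_mod_cast Real.pi_ne_zero
  field_simp

/-- The spectral representation is an isometry of `L²(F)` which carries `e^{iθm} (1 - e^{-iνθ})ⁿ
(iθ)^{-n}` to `ξ⁽ⁿ⁾(m, ν)`. -/
theorem IsSpectralRepresentation.exists_isometry {hξ : HasStationaryIncrements P n ξ}
    {Z : Set ℝ → Lp ℂ 2 P} (h : IsOuterPair n f γ ψ) (hZ : IsSpectralRepresentation hξ f Z) :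
    ∃ T : Lp ℂ 2 (spectralMeasure f) →ₗᵢ[ℂ] Lp ℂ 2 P,
      (∀ m ν, T (waveLp (h.memLp_kernel ν) m) = hξ.incr m ν) ∧
      ∀ g J, IsStochasticIntegral (spectralMeasure f) Z g J ↔
        ∃ hg : MemLp g 2 (spectralMeasure f), T (hg.toLp g) = J := by
  have := h.isFiniteMeasure
  obtain ⟨T, hT⟩ := hZ.orthogonal.exists_isometry
  refine ⟨T, fun m ν => ?_, hT⟩
  obtain ⟨hg, h1⟩ := (hT _ _).mp (hZ.integral m ν)
  exact h1

theorem IsOuterPair.exists_spectralRepresentation (h : IsOuterPair n f γ ψ)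
    (hξ : HasStationaryIncrements P n ξ) (hf : IsSpectralDensity P n ξ f) :
    ∃ Z : Set ℝ → Lp ℂ 2 P, IsSpectralRepresentation hξ f Z := by
  have := h.isFiniteMeasure
  obtain ⟨T, hT⟩ := exists_isometry_of_gram (h.inner_incr hξ hf) h.span_kernel
  obtain ⟨Z, hZ, hZT⟩ := exists_isOrthogonalMeasure T
  exact ⟨Z, hZ, fun m ν => (hZT _ _).mpr ⟨memLp_exp_mul (h.memLp_kernel ν) m, hT (m, ν)⟩⟩

/-! The innovation sequence. -/

/-- The square integrable functions. -/
def squareIntegrable (P : Measure Ω) : Submodule ℂ (Ω → ℂ) where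
  carrier := {g | MemLp g 2 P}
  add_mem' hx hy := MemLp.add hx hy
  zero_mem' := MemLp.zero
  smul_mem' c _ hx := MemLp.const_smul hx c

/-- The class of a square integrable function in `L²(Ω)`. -/
def toLpLinear (P : Measure Ω) : squareIntegrable P →ₗ[ℂ] Lp ℂ 2 P where
  toFun g := MemLp.toLp g.1 g.2
  map_add' _ _ := rfl
  map_smul' _ _ := rfl

theorem HasStationaryIncrements.incr_natCast (hξ : HasStationaryIncrements P n ξ) (m : ℤ) (ν : ℕ) :
    hξ.incr m ν = (geomPoly n ν).sum fun j z => z • hξ.incr (m - j) 1 := by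
  have h1 : (⟨increment n ξ m ν, hξ.memLp m ν⟩ : squareIntegrable P) =
      ∑ j ∈ (geomPoly n ν).support, (geomPoly n ν).coeff j •
        (⟨increment n ξ (m - j) 1, hξ.memLp (m - j) 1⟩ : squareIntegrable P) := by
    refine Subtype.ext ?_
    rw [Submodule.coe_sum]
    simp only [Submodule.coe_smul]
    rw [increment_eq_diffOp, diffOp_natCast, Polynomial.sum_def]
    simp only [increment_eq_diffOp]
  have h2 := congrArg (toLpLinear P) h1
  rw [map_sum] at h2
  simp only [map_smul] at h2
  rw [Polynomial.sum_def]
  exact h2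

theorem HasStationaryIncrements.incr_eq_act (hξ : HasStationaryIncrements P n ξ) (m : ℤ) (ν : ℕ) :
    hξ.incr m ν = act (geomPoly n ν : PowerSeries ℂ) (fun k => hξ.incr k 1) m := by
  rw [act_coe, hξ.incr_natCast]

theorem HasStationaryIncrements.norm_incr (hξ : HasStationaryIncrements P n ξ) (m ν : ℤ) :
    ‖hξ.incr m ν‖ = ‖hξ.incr 0 ν‖ := by
  have h1 : inner ℂ (hξ.incr m ν) (hξ.incr m ν) = inner ℂ (hξ.incr 0 ν) (hξ.incr 0 ν) := by
    simp only [HasStationaryIncrements.incr]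
    rw [inner_toLp, inner_toLp]
    simpa using hξ.covariance m 0 0 ν ν
  rw [inner_self_eq_norm_sq_to_K, inner_self_eq_norm_sq_to_K] at h1
  have h2 : ‖hξ.incr m ν‖ ^ 2 = ‖hξ.incr 0 ν‖ ^ 2 := by exact_mod_cast h1
  exact (pow_left_inj₀ (norm_nonneg _) (norm_nonneg _) two_ne_zero).mp h2

/-- The innovations `ε(m) = ∑ ψ_k ξ⁽ⁿ⁾(m - k, 1)`. -/
def innov (hξ : HasStationaryIncrements P n ξ) (ψ : PowerSeries ℂ) : ℤ → Lp ℂ 2 P :=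
  act ψ fun k => hξ.incr k 1

/-- The coefficients of the canonical moving average of the increments with step `μ`. -/
def canonicalSeries (n μ : ℕ) (γ : PowerSeries ℂ) : PowerSeries ℂ :=
  (geomPoly n μ : PowerSeries ℂ) * γ

variable {hξ : HasStationaryIncrements P n ξ}

theorem map_waveLp_whitener (h : IsOuterPair n f γ ψ)
    {T : Lp ℂ 2 (spectralMeasure f) →ₗᵢ[ℂ] Lp ℂ 2 P}
    (hT : ∀ m ν, T (waveLp (h.memLp_kernel ν) m) = hξ.incr m ν) (m : ℤ) :
    T (waveLp h.isWhitening.memLp m) = innov hξ ψ m := by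
  rw [← h.act_kernel]
  have := map_act T.toContinuousLinearMap h.summable_inv (norm_waveLp_le (h.memLp_kernel 1)) m
  simp only [LinearIsometry.coe_toContinuousLinearMap, hT] at this
  exact this

theorem IsOuterPair.orthonormal_innov (h : IsOuterPair n f γ ψ) (hf : IsSpectralDensity P n ξ f) :
    Orthonormal ℂ (innov hξ ψ) := by
  obtain ⟨T, hT⟩ := exists_isometry_of_gram (h.inner_incr hξ hf) h.span_kernel
  have h1 := h.isWhitening.orthonormal.comp_linearIsometry T
  have h2 : T ∘ waveLp h.isWhitening.memLp = innov hξ ψ :=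
    funext fun m => map_waveLp_whitener h (fun m ν => hT (m, ν)) m
  rwa [h2] at h1

theorem IsOuterPair.act_innov (h : IsOuterPair n f γ ψ) :
    act γ (innov hξ ψ) = fun k => hξ.incr k 1 := by
  rw [innov, ← act_mul h.summable h.summable_inv (fun m => (hξ.norm_incr m 1).le), h.mul_eq,
    act_one]

theorem norm_innov_le (h : IsOuterPair n f γ ψ) (m : ℤ) :
    ‖innov hξ ψ m‖ ≤ absSum ψ * ‖hξ.incr 0 1‖ :=
  norm_act_le h.summable_inv (fun m => (hξ.norm_incr m 1).le) m

theorem IsOuterPair.absSummable_canonicalSeries (h : IsOuterPair n f γ ψ) (μ : ℕ) :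
    AbsSummable (canonicalSeries n μ γ) := (absSummable_coe _).mul h.summable

theorem IsOuterPair.incr_eq_act_innov (h : IsOuterPair n f γ ψ) (m : ℤ) (ν : ℕ) :
    hξ.incr m ν = act (canonicalSeries n ν γ) (innov hξ ψ) m := by
  rw [canonicalSeries, act_mul (absSummable_coe _) h.summable (norm_innov_le h), h.act_innov,
    hξ.incr_eq_act]

theorem isClosed_pastOf (ε : ℤ → Lp ℂ 2 P) (t : ℤ) : IsClosed (pastOf ε t : Set (Lp ℂ 2 P)) :=
  Submodule.isClosed_topologicalClosure _

theorem mem_pastOf {ε : ℤ → Lp ℂ 2 P} {m t : ℤ} (h : m ≤ t) : ε m ∈ pastOf ε t :=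
  Submodule.le_topologicalClosure _ (Submodule.subset_span ⟨m, h, rfl⟩)

theorem IsOuterPair.past_eq (h : IsOuterPair n f γ ψ) (t : ℤ) :
    hξ.past t = pastOf (innov hξ ψ) t := by
  refine le_antisymm (Submodule.topologicalClosure_minimal _ (Submodule.span_le.mpr ?_)
    (isClosed_pastOf _ _)) (Submodule.topologicalClosure_minimal _ (Submodule.span_le.mpr ?_)
    (Submodule.isClosed_topologicalClosure _))
  · rintro _ ⟨m, ν, hm, hν, rfl⟩
    lift ν to ℕ using hν.le
    rw [SetLike.mem_coe, h.incr_eq_act_innov]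
    exact act_mem (isClosed_pastOf _ _) (h.absSummable_canonicalSeries ν) (norm_innov_le h)
      fun j hj => mem_pastOf (hj.trans hm)
  · rintro _ ⟨m, hm, rfl⟩
    refine act_mem (Submodule.isClosed_topologicalClosure _) h.summable_inv
      (fun m => (hξ.norm_incr m 1).le) fun j hj => ?_
    exact Submodule.le_topologicalClosure _
      (Submodule.subset_span ⟨j, 1, hj.trans hm, one_pos, rfl⟩)

theorem AbsSummable.summable_sq {c : PowerSeries ℂ} (hc : AbsSummable c) :
    Summable fun k => ‖PowerSeries.coeff k c‖ ^ 2 := by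
  refine (hc.mul_left (absSum c)).of_nonneg_of_le (fun _ => by positivity) fun k => ?_
  rw [pow_two]
  exact mul_le_mul_of_nonneg_right (hc.le_tsum k fun _ _ => norm_nonneg _) (norm_nonneg _)

theorem IsOuterPair.isCanonicalMovingAverage [IsProbabilityMeasure P] (h : IsOuterPair n f γ ψ)
    (hf : IsSpectralDensity P n ξ f) (hmean : ∀ m ν : ℤ, ∫ ω, increment n ξ m ν ω ∂P = 0)
    (μ : ℕ) : IsCanonicalMovingAverage hξ μ (innov hξ ψ)
      fun k => PowerSeries.coeff k (canonicalSeries n μ γ) where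
  mean m := by
    have h1 : ∀ x : Lp ℂ 2 P, inner ℂ (indicatorConstLp 2 MeasurableSet.univ
        (measure_ne_top P _) (1 : ℂ)) x = ∫ ω, x ω ∂P := by
      intro x
      rw [L2.inner_indicatorConstLp_one, setIntegral_univ]
    have hK : innov hξ ψ m ∈ (Submodule.span ℂ {indicatorConstLp 2 MeasurableSet.univ
        (measure_ne_top P _) (1 : ℂ)})ᗮ := by
      refine act_mem (Submodule.isClosed_orthogonal _) h.summable_inv
        (fun m => (hξ.norm_incr m 1).le) fun j _ => ?_
      rw [Submodule.mem_orthogonal_singleton_iff_inner_right, h1, ← hmean j 1]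
      exact integral_congr_ae (hξ.memLp j 1).coeFn_toLp
    rw [Submodule.mem_orthogonal_singleton_iff_inner_right, h1] at hK
    exact hK
  orthonormal := h.orthonormal_innov hf
  innovation := h.past_eq
  square_summable := (h.absSummable_canonicalSeries μ).summable_sq
  hasSum m := by
    rw [h.incr_eq_act_innov]
    exact hasSum_act (h.absSummable_canonicalSeries μ) (norm_innov_le h) m

end Probability

end StatIncr
end

noncomputable section
namespace StatIncr

theorem inner_eq_zero_of_mem_closure_span {E : Type*} [NormedAddCommGroup E]
    [InnerProductSpace ℂ E] {s : Set E} {y x : E} (h : ∀ z ∈ s, inner ℂ y z = 0)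
    (hx : x ∈ (Submodule.span ℂ s).topologicalClosure) : inner ℂ y x = 0 := by
  have h1 : (Submodule.span ℂ s).topologicalClosure ≤ (Submodule.span ℂ {y})ᗮ := by
    refine Submodule.topologicalClosure_minimal _ (Submodule.span_le.mpr fun z hz => ?_)
      (Submodule.isClosed_orthogonal _)
    rw [SetLike.mem_coe, Submodule.mem_orthogonal_singleton_iff_inner_right]
    exact h z hz
  exact Submodule.mem_orthogonal_singleton_iff_inner_right.mp (h1 hx)

theorem eq_zero_of_mem_closure_span {E : Type*} [NormedAddCommGroup E] [InnerProductSpace ℂ E]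
    {s : Set E} {x : E} (hx : x ∈ (Submodule.span ℂ s).topologicalClosure)
    (h : ∀ z ∈ s, inner ℂ z x = 0) : x = 0 := by
  refine inner_self_eq_zero (𝕜 := ℂ).mp (inner_eq_zero_of_mem_closure_span (fun z hz => ?_) hx)
  rw [← inner_conj_symm, h z hz, map_zero]

theorem inner_of_hasSum {E ι : Type*} [NormedAddCommGroup E] [InnerProductSpace ℂ E] {v : ι → E}
    (hv : Orthonormal ℂ v) {c : ι → ℂ} {x : E} (hx : HasSum (fun i => c i • v i) x) (i : ι) :
    inner ℂ (v i) x = c i := by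
  classical
  have h1 := hx.mapL (innerSL ℂ (v i))
  have h2 : ∀ j, innerSL ℂ (v i) (c j • v j) = if j = i then c i else 0 := by
    intro j
    rw [innerSL_apply_apply, inner_smul_right, orthonormal_iff_ite.mp hv]
    rcases eq_or_ne j i with rfl | h
    · simp
    · simp [h, h.symm]
  simp only [h2] at h1
  exact h1.unique (hasSum_ite_eq i (c i))

theorem hasSum_norm_sq {E ι : Type*} [NormedAddCommGroup E] [InnerProductSpace ℂ E] {v : ι → E}
    (hv : Orthonormal ℂ v) {c : ι → ℂ} {x : E} (hx : HasSum (fun i => c i • v i) x) :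
    HasSum (fun i => ‖c i‖ ^ 2) (‖x‖ ^ 2) := by
  have h1 := hx.mapL (innerSL ℂ x)
  have h2 : ∀ i, innerSL ℂ x (c i • v i) = ((‖c i‖ ^ 2 : ℝ) : ℂ) := by
    intro i
    rw [innerSL_apply_apply, inner_smul_right, ← inner_conj_symm, inner_of_hasSum hv hx,
      Complex.mul_conj, Complex.normSq_eq_norm_sq]
  simp only [h2, innerSL_apply_apply, inner_self_eq_norm_sq_to_K] at h1
  refine Complex.hasSum_ofReal.mp ?_
  rw [Complex.ofReal_pow]
  exact h1

section Uniqueness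

variable {Ω : Type*} [MeasurableSpace Ω] {P : Measure Ω}

theorem inner_eq_zero_of_mem_pastOf {ε : ℤ → Lp ℂ 2 P} {t : ℤ} {y x : Lp ℂ 2 P}
    (h : ∀ m ≤ t, inner ℂ y (ε m) = 0) (hx : x ∈ pastOf ε t) : inner ℂ y x = 0 :=
  inner_eq_zero_of_mem_closure_span (by rintro _ ⟨m, hm, rfl⟩; exact h m hm) hx

theorem eq_zero_of_mem_pastOf {ε : ℤ → Lp ℂ 2 P} {t : ℤ} {x : Lp ℂ 2 P} (hx : x ∈ pastOf ε t)
    (h : ∀ m ≤ t, inner ℂ (ε m) x = 0) : x = 0 :=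
  eq_zero_of_mem_closure_span hx (by rintro _ ⟨m, hm, rfl⟩; exact h m hm)

theorem mem_pastOf_of_inner_eq_zero {ε : ℤ → Lp ℂ 2 P} (hε : Orthonormal ℂ ε) {t : ℤ}
    {x : Lp ℂ 2 P} (hx : x ∈ (Submodule.span ℂ (Set.range ε)).topologicalClosure)
    (h : ∀ m, t < m → inner ℂ (ε m) x = 0) : x ∈ pastOf ε t := by
  have : CompleteSpace (pastOf ε t) := (isClosed_pastOf ε t).completeSpace_coe
  have hmono : pastOf ε t ≤ (Submodule.span ℂ (Set.range ε)).topologicalClosure := by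
    refine Submodule.topologicalClosure_mono (Submodule.span_mono ?_)
    rintro _ ⟨m, -, rfl⟩
    exact ⟨m, rfl⟩
  set p : Lp ℂ 2 P := (pastOf ε t).starProjection x
  have hp : p ∈ pastOf ε t := (pastOf ε t).starProjection_apply_mem x
  have h1 : x - p = 0 := by
    refine eq_zero_of_mem_closure_span (Submodule.sub_mem _ hx (hmono hp)) ?_
    rintro _ ⟨m, rfl⟩
    rcases le_or_gt m t with hm | hm
    · exact (Submodule.mem_orthogonal _ _).mp
        ((pastOf ε t).sub_starProjection_mem_orthogonal x) _ (mem_pastOf hm)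
    · rw [inner_sub_right, h m hm, inner_eq_zero_of_mem_pastOf (fun j hj => ?_) hp, sub_zero]
      exact hε.2 (by omega)
  rw [sub_eq_zero.mp h1]
  exact hp

/-- Two innovation sequences of the same flow of subspaces differ by unimodular factors. -/
theorem exists_smul_of_pastOf_eq {ε ε₀ : ℤ → Lp ℂ 2 P} (hε : Orthonormal ℂ ε)
    (hε₀ : Orthonormal ℂ ε₀) (h : ∀ t, pastOf ε t = pastOf ε₀ t) (t : ℤ) :
    ∃ c : ℂ, ‖c‖ = 1 ∧ ε t = c • ε₀ t := by
  refine ⟨inner ℂ (ε₀ t) (ε t), ?_⟩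
  have h1 : ε t = inner ℂ (ε₀ t) (ε t) • ε₀ t := by
    refine sub_eq_zero.mp (eq_zero_of_mem_pastOf (ε := ε₀) (t := t) ?_ fun m hm => ?_)
    · exact Submodule.sub_mem _ (h t ▸ mem_pastOf le_rfl)
        (Submodule.smul_mem _ _ (mem_pastOf le_rfl))
    · rw [inner_sub_right, inner_smul_right]
      rcases hm.eq_or_lt with rfl | hlt
      · rw [inner_self_eq_norm_sq_to_K, hε₀.1 m]
        simp
      · have h2 : inner ℂ (ε t) (ε₀ m) = 0 := by
          refine inner_eq_zero_of_mem_pastOf (ε := ε) (t := t - 1) (fun j hj => hε.2 (by omega)) ?_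
          rw [h]
          exact mem_pastOf (by omega)
        rw [← inner_conj_symm, h2, map_zero, hε₀.2 hlt.ne, mul_zero, sub_zero]
  refine ⟨?_, h1⟩
  have h3 := congrArg norm h1
  rw [norm_smul, hε.1, hε₀.1, mul_one] at h3
  exact h3.symm

theorem inner_hasSum {ε : ℤ → Lp ℂ 2 P} (hε : Orthonormal ℂ ε) {c : ℕ → ℂ} {m : ℤ}
    {x : Lp ℂ 2 P} (hx : HasSum (fun k : ℕ => c k • ε (m - k)) x) (k : ℕ) :
    inner ℂ (ε (m - k)) x = c k :=
  inner_of_hasSum (hε.comp (fun k : ℕ => m - k) fun i j h => by simpa using h) hx k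

variable {n μ : ℕ} {f : ℝ → ℝ} {γ ψ : PowerSeries ℂ} {ξ : ℤ → Ω → ℂ}
  {hξ : HasStationaryIncrements P n ξ}

theorem constantCoeff_canonicalSeries_ne_zero (h : γ * ψ = 1) (hμ : 1 ≤ μ) :
    PowerSeries.coeff 0 (canonicalSeries n μ γ) ≠ 0 := by
  have h1 := congrArg (PowerSeries.constantCoeff (R := ℂ)) h
  rw [map_mul, map_one] at h1
  have h2 : (geomPoly n μ).coeff 0 = 1 := by
    rw [Polynomial.coeff_zero_eq_eval_zero, geomPoly, Polynomial.eval_pow,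
      Polynomial.eval_finsetSum, Finset.sum_eq_single 0]
    · simp
    · intro j _ hj
      simp [hj]
    · intro hj
      simp at hj
      omega
  rw [PowerSeries.coeff_zero_eq_constantCoeff_apply, canonicalSeries, map_mul,
    ← PowerSeries.coeff_zero_eq_constantCoeff_apply, Polynomial.coeff_coe, h2, one_mul]
  exact left_ne_zero_of_mul_eq_one h1

/-- The canonical moving average is unique up to a unimodular constant. -/
theorem IsCanonicalMovingAverage.exists_eq_smul (h : IsOuterPair n f γ ψ)
    (hf : IsSpectralDensity P n ξ f) (hμ : 1 ≤ μ) {ε : ℤ → Lp ℂ 2 P} {φμ : ℕ → ℂ}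
    (hε : IsCanonicalMovingAverage hξ μ ε φμ) :
    ∃ c : ℂ, c ≠ 0 ∧ (∀ m, ε m = c • innov hξ ψ m) ∧
      ∀ k, PowerSeries.coeff k (canonicalSeries n μ γ) = c * φμ k := by
  have horth := h.orthonormal_innov (hξ := hξ) hf
  have h1 := exists_smul_of_pastOf_eq hε.orthonormal horth fun t => by
    rw [← hε.innovation, h.past_eq]
  choose c hc1 hc using h1
  have h2 : ∀ (m : ℤ) (k : ℕ),
      PowerSeries.coeff k (canonicalSeries n μ γ) = c (m - k) * φμ k := by
    intro m k
    have h3 : HasSum (fun k : ℕ => PowerSeries.coeff k (canonicalSeries n μ γ) •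
        innov hξ ψ (m - k)) (hξ.incr m μ) := by
      rw [h.incr_eq_act_innov]
      exact hasSum_act (h.absSummable_canonicalSeries μ) (norm_innov_le h) m
    have h4 := hε.hasSum m
    simp only [hc, smul_smul] at h4
    rw [← inner_hasSum horth h3 k, inner_hasSum horth h4 k, mul_comm]
  have h5 : ∀ m, c m = c 0 := by
    intro m
    have h6 := h2 m 0
    rw [h2 0 0] at h6
    have h7 : φμ 0 ≠ 0 := by
      intro h8
      have := h2 0 0
      rw [h8, mul_zero] at this
      exact constantCoeff_canonicalSeries_ne_zero h.mul_eq hμ this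
    simpa using (mul_right_cancel₀ h7 h6).symm
  refine ⟨c 0, ?_, fun m => by rw [hc, h5], fun k => ?_⟩
  · intro h8
    have := hc1 0
    simp [h8] at this
  · have := h2 k k
    rwa [sub_self] at this

end Uniqueness

end StatIncr
end

noncomputable section
namespace StatIncr

section Dual

variable {E : Type*} [NormedAddCommGroup E] [InnerProductSpace ℂ E]

/-- The coordinate sequence `j ↦ ⟪ε(-j), z⟫`. -/
def coords (ε : ℤ → E) (z : E) (j : ℤ) : ℂ := inner ℂ (ε (-j)) z

theorem norm_coords_le {ε : ℤ → E} (hε : Orthonormal ℂ ε) (z : E) (j : ℤ) :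
    ‖coords ε z j‖ ≤ ‖z‖ := by
  have := norm_inner_le_norm (𝕜 := ℂ) (ε (-j)) z
  rwa [hε.1, one_mul] at this

theorem tendsto_coords {ε : ℤ → E} (hε : Orthonormal ℂ ε) (z : E) :
    Tendsto (coords ε z) atBot (𝓝 0) := by
  have h1 := (hε.inner_products_summable z).tendsto_cofinite_zero
  have h2 : Tendsto (fun j : ℤ => inner ℂ (ε j) z) cofinite (𝓝 0) := by
    rw [tendsto_zero_iff_norm_tendsto_zero]
    have h3 := h1.sqrt
    simpa [Real.sqrt_sq] using h3
  rw [Int.cofinite_eq] at h2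
  exact (h2.mono_left le_sup_right).comp tendsto_neg_atBot_atTop

theorem tendsto_act {c : PowerSeries ℂ} (hc : AbsSummable c) {g : ℤ → ℂ} {B : ℝ}
    (hB : ∀ m, ‖g m‖ ≤ B) (hg : Tendsto g atBot (𝓝 0)) : Tendsto (act c g) atBot (𝓝 0) := by
  have h1 := tendsto_tsum_of_dominated_convergence (𝓕 := (atBot : Filter ℤ))
    (f := fun m k => PowerSeries.coeff k c • g (m - k)) (g := fun _ : ℕ => (0 : ℂ))
    (hc.mul_right B) (fun k => ?_) (Eventually.of_forall fun m k => norm_smul_shift_le c hB m k)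
  · rw [tsum_zero] at h1
    exact h1
  · have h2 : Tendsto (fun m : ℤ => g (m - k)) atBot (𝓝 0) :=
      hg.comp (tendsto_atBot_add_const_right _ _ tendsto_id)
    simpa using h2.const_smul (PowerSeries.coeff k c)

/-- The continuous functional `z ↦ ∑ ψ_k ⟪ε(s + k), z⟫`. -/
def dualCoord (ε : ℤ → E) (ψ : PowerSeries ℂ) (s : ℤ) (z : E) : ℂ := act ψ (coords ε z) (-s)

theorem coords_add (ε : ℤ → E) (y z : E) : coords ε (y + z) = fun j => coords ε y j + coords ε z j :=
  funext fun _ => inner_add_right _ _ _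

theorem coords_smul (ε : ℤ → E) (c : ℂ) (z : E) : coords ε (c • z) = fun j => c • coords ε z j :=
  funext fun _ => inner_smul_right _ _ _

/-- `dualCoord` as a linear map. -/
def dualCoordLinear {ε : ℤ → E} (hε : Orthonormal ℂ ε) {ψ : PowerSeries ℂ} (hψ : AbsSummable ψ)
    (s : ℤ) : E →ₗ[ℂ] ℂ where
  toFun := dualCoord ε ψ s
  map_add' y z := by
    have h1 := hasSum_act hψ (norm_coords_le hε y) (-s)
    have h2 := hasSum_act hψ (norm_coords_le hε z) (-s)
    rw [dualCoord, coords_add, act]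
    simp only [smul_add]
    exact (h1.add h2).tsum_eq
  map_smul' c z := by
    rw [dualCoord, coords_smul, act_smul]
    rfl

theorem dualCoordLinear_apply {ε : ℤ → E} (hε : Orthonormal ℂ ε) {ψ : PowerSeries ℂ}
    (hψ : AbsSummable ψ) (s : ℤ) (z : E) : dualCoordLinear hε hψ s z = dualCoord ε ψ s z := rfl

theorem continuous_dualCoord {ε : ℤ → E} (hε : Orthonormal ℂ ε) {ψ : PowerSeries ℂ}
    (hψ : AbsSummable ψ) (s : ℤ) : Continuous (dualCoord ε ψ s) :=
  ((dualCoordLinear hε hψ s).mkContinuous (absSum ψ)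
    fun z => norm_act_le hψ (norm_coords_le hε z) _).continuous

theorem tendsto_dualCoord {ε : ℤ → E} (hε : Orthonormal ℂ ε) {ψ : PowerSeries ℂ}
    (hψ : AbsSummable ψ) (z : E) : Tendsto (fun s => dualCoord ε ψ s z) atTop (𝓝 0) :=
  (tendsto_act hψ (norm_coords_le hε z) (tendsto_coords hε z)).comp tendsto_neg_atTop_atBot

theorem inner_eq_zero_of_dualCoord {ε : ℤ → E} (hε : Orthonormal ℂ ε) {γ ψ : PowerSeries ℂ}
    (hγ : AbsSummable γ) (hψ : AbsSummable ψ) (h : γ * ψ = 1) {z : E}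
    (hz : ∀ s, dualCoord ε ψ s z = 0) (m : ℤ) : inner ℂ (ε m) z = 0 := by
  have h1 : act ψ (coords ε z) = fun _ => (0 : ℂ) := by
    funext j
    have := hz (-j)
    rwa [dualCoord, neg_neg] at this
  have h2 := congrFun (act_mul hγ hψ (norm_coords_le hε z)) (-m)
  rw [h, act_one, h1] at h2
  simpa [coords, act] using h2

theorem dualCoord_act [CompleteSpace E] {ε : ℤ → E} (hε : Orthonormal ℂ ε) {γ ψ : PowerSeries ℂ}
    (hγ : AbsSummable γ) (hψ : AbsSummable ψ) (h : γ * ψ = 1) (s m : ℤ) :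
    dualCoord ε ψ s (act γ ε m) = if m = s then 1 else 0 := by
  let δ : ℤ → ℂ := fun j => if j = -m then 1 else 0
  have hδ : ∀ j, ‖δ j‖ ≤ 1 := fun j => by
    simp only [δ]
    split_ifs <;> simp
  have h1 : coords ε (act γ ε m) = act γ δ := by
    funext j
    have h2 := (hasSum_act hγ (fun k => (hε.1 k).le) m).mapL (innerSL ℂ (ε (-j)))
    simp only [innerSL_apply_apply, inner_smul_right] at h2
    rw [coords, ← h2.tsum_eq, act]
    refine tsum_congr fun k => ?_
    rw [orthonormal_iff_ite.mp hε, smul_eq_mul]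
    congr 1
    simp only [δ]
    congr 1
    exact propext ⟨fun h => by omega, fun h => by omega⟩
  rw [dualCoord, h1, ← act_mul hψ hγ hδ, mul_comm, h, act_one]
  simp [δ, eq_comm]

end Dual

section Remainder

variable {E : Type*} [NormedAddCommGroup E] [InnerProductSpace ℂ E]

/-- The sequence killed by `Dⁿ` which agrees with `t` on `m ≥ s`, when `Dⁿ t = δ_s`. -/
def polyPart (n : ℕ) (t : ℤ → ℂ) (s m : ℤ) : ℂ := t m - impulse n (m - s) + binomSeq n (m - s)

theorem bdiff_pow_polyPart {n : ℕ} (hn : 1 ≤ n) {t : ℤ → ℂ} {s : ℤ}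
    (ht : (bdiff ℂ ^ n) t = Pi.single s 1) : (bdiff ℂ ^ n) (polyPart n t s) = 0 := by
  have h1 : polyPart n t s =
      t - (fun m => impulse n (m + -s)) + (fun m => binomSeq n (m + -s)) := rfl
  rw [h1, map_add, map_sub, ht]
  funext m
  rw [Pi.add_apply, Pi.sub_apply, bdiff_pow_shift, bdiff_pow_shift, bdiff_pow_impulse hn,
    bdiff_pow_binomSeq hn]
  by_cases h : m = s
  · simp [h]
  · simp [h, show m + -s ≠ 0 by omega]

theorem polyPart_of_le {n : ℕ} {t : ℤ → ℂ} {s m : ℤ} (h : s ≤ m) : polyPart n t s m = t m := by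
  rw [polyPart, impulse, if_pos (by omega)]
  ring

theorem polyPart_of_lt {n : ℕ} {t : ℤ → ℂ} {s m : ℤ} (h : m < s) :
    polyPart n t s m = t m + binomSeq n (m - s) := by
  rw [polyPart, impulse, if_neg (by omega), sub_zero]

theorem eq_zero_of_sum_binomSeq {n : ℕ} (hn : 1 ≤ n) {ρ : Fin n → ℂ}
    (h : ∀ m : ℤ, ∑ i : Fin n, ρ i * binomSeq n (m - i - 1) = 0) : ρ = 0 := by
  have key : ∀ j : ℕ, ∀ hj : j < n, ρ ⟨j, hj⟩ = 0 := by
    intro j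
    induction j using Nat.strong_induction_on with
    | _ j ih =>
      intro hj
      have h1 := h (j + 1)
      rw [Finset.sum_eq_single ⟨j, hj⟩] at h1
      · rw [show (j : ℤ) + 1 - ((⟨j, hj⟩ : Fin n) : ℕ) - 1 = 0 by simp, binomSeq_zero hn,
          mul_one] at h1
        exact h1
      · intro i _ hi
        rcases lt_trichotomy (i : ℕ) j with hlt | heq | hgt
        · rw [ih i hlt i.2, zero_mul]
        · exact absurd (Fin.ext heq) hi
        · have := i.2
          rw [binomSeq_eq_zero (by omega) (by omega), mul_zero]
      · simp
  funext i
  exact key i i.2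

theorem eq_zero_of_tendsto_polyPart {n : ℕ} (hn : 1 ≤ n) {t : ℤ → ℤ → ℂ}
    (ht : ∀ m, Tendsto (fun s => t s m) atTop (𝓝 0)) {ρ : Fin n → ℂ}
    (h : Tendsto (fun s => ∑ i : Fin n, ρ i * polyPart n (t s) s (-(i : ℤ) - 1)) atTop (𝓝 0)) :
    ρ = 0 := by
  let U : ℤ → ℂ := fun m => ∑ i : Fin n, ρ i * binomSeq n (m - i - 1)
  have hU : (bdiff ℂ ^ n) U = 0 := by
    have h1 : U = ∑ i : Fin n, ρ i • fun m => binomSeq n (m + (-(i : ℤ) - 1)) := by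
      funext m
      rw [Finset.sum_apply]
      refine Finset.sum_congr rfl fun i _ => ?_
      rw [Pi.smul_apply, smul_eq_mul]
      congr 2
      ring
    rw [h1, map_sum]
    refine Finset.sum_eq_zero fun i _ => ?_
    rw [map_smul]
    funext m
    rw [Pi.smul_apply, bdiff_pow_shift, bdiff_pow_binomSeq hn]
    simp
  have hlim : Tendsto (fun s => U (-s)) atTop (𝓝 0) := by
    have h2 : Tendsto (fun s => ∑ i : Fin n, ρ i * t s (-(i : ℤ) - 1)) atTop (𝓝 0) := by
      have := tendsto_finsetSum Finset.univ fun (i : Fin n) _ => (ht (-(i : ℤ) - 1)).const_mul (ρ i)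
      simpa using this
    have h3 := h.sub h2
    rw [sub_zero] at h3
    refine h3.congr' ?_
    filter_upwards [eventually_ge_atTop (0 : ℤ)] with s hs
    rw [← Finset.sum_sub_distrib]
    refine Finset.sum_congr rfl fun i _ => ?_
    rw [polyPart_of_lt (by omega), mul_add, add_sub_cancel_left]
    congr 2
    ring
  have hlim' : Tendsto U atBot (𝓝 0) := by
    have := hlim.comp tendsto_neg_atBot_atTop
    simpa [Function.comp_def] using this
  have h4 := eq_zero_of_bdiff_pow_of_tendsto n hU hlim'
  exact eq_zero_of_sum_binomSeq hn fun m => congrFun h4 m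

theorem linearCombination_startForm {V : Type*} [AddCommGroup V] [Module ℂ V] (u : ℤ → V) {n : ℕ}
    (ρ : Fin n → ℂ) :
    Finsupp.linearCombination ℂ u (startForm n ρ) = ∑ i : Fin n, ρ i • u (-(i : ℤ) - 1) := by
  simp [startForm]

/-- Linear forms which are supported near infinity and converge in mean square converge to zero,
together with their reductions to the starting values. -/
theorem tendsto_zero_of_support_atTop [CompleteSpace E] {n : ℕ} (hn : 1 ≤ n) {ε : ℤ → E}
    (hε : Orthonormal ℂ ε) {γ ψ : PowerSeries ℂ} (hγ : AbsSummable γ) (hψ : AbsSummable ψ)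
    (hγψ : γ * ψ = 1) {X : ℤ → E} (hX : (bdiff E ^ n) X = act γ ε) {R : ℕ → ℤ →₀ ℂ} {d : ℤ}
    (hR : ∀ (N : ℕ) (m : ℤ), m + d < (N : ℤ) → R N m = 0) {ρ : ℕ → Fin n → ℂ}
    (hρ : ∀ N, R N - startForm n (ρ N) ∈ incrementForms n) {x : E}
    (hx : Tendsto (fun N => Finsupp.linearCombination ℂ X (R N)) atTop (𝓝 x)) :
    Tendsto ρ atTop (𝓝 0) ∧ x = 0 := by
  let t : ℤ → ℤ → ℂ := fun s m => dualCoord ε ψ s (X m)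
  let u : ℤ → ℤ → ℂ := fun s => polyPart n (t s) s
  have ht : ∀ s, (bdiff ℂ ^ n) (t s) = Pi.single s 1 := by
    intro s
    funext m
    have h1 := map_diffOp (dualCoordLinear hε hψ s) n 1 X m
    rw [← bdiff_pow_eq, ← bdiff_pow_eq, hX, dualCoordLinear_apply,
      dualCoord_act hε hγ hψ hγψ] at h1
    rw [Pi.single_apply]
    exact h1
  have hu : ∀ s, (bdiff ℂ ^ n) (u s) = 0 := fun s => bdiff_pow_polyPart hn (ht s)
  let T : (Fin n → ℂ) →ₗ[ℂ] (ℤ → ℂ) :=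
    { toFun := fun r s => ∑ i : Fin n, r i * u s (-(i : ℤ) - 1)
      map_add' := fun p q => by
        funext s
        simp [add_mul, Finset.sum_add_distrib]
      map_smul' := fun c p => by
        funext s
        simp [Finset.mul_sum, mul_assoc] }
  have hT0 : ∀ r, Tendsto (T r) atTop (𝓝 0) → r = 0 := fun r hr =>
    eq_zero_of_tendsto_polyPart hn (fun m => tendsto_dualCoord hε hψ (X m)) hr
  have hemb : IsClosedEmbedding T := by
    refine LinearMap.isClosedEmbedding_of_injective (LinearMap.ker_eq_bot'.mpr fun r hr => ?_)
    refine hT0 r ?_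
    rw [hr]
    exact tendsto_const_nhds
  have hTρ : Tendsto (fun N => T (ρ N)) atTop (𝓝 fun s => dualCoord ε ψ s x) := by
    rw [tendsto_pi_nhds]
    intro s
    have h1 := ((continuous_dualCoord hε hψ s).tendsto x).comp hx
    refine h1.congr' ?_
    filter_upwards [eventually_ge_atTop (s + d).toNat] with N hN
    have h2 : dualCoord ε ψ s (Finsupp.linearCombination ℂ X (R N)) =
        Finsupp.linearCombination ℂ (t s) (R N) := by
      rw [← dualCoordLinear_apply hε hψ, Finsupp.apply_linearCombination]
      rfl
    have h3 : Finsupp.linearCombination ℂ (t s) (R N) = Finsupp.linearCombination ℂ (u s) (R N) := by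
      rw [Finsupp.linearCombination_apply, Finsupp.linearCombination_apply]
      refine Finsupp.sum_congr fun m hm => ?_
      have hm' : (N : ℤ) ≤ m + d := by
        by_contra hlt
        exact Finsupp.mem_support_iff.mp hm (hR N m (by omega))
      simp only [u]
      rw [polyPart_of_le (by omega)]
    have h4 : Finsupp.linearCombination ℂ (u s) (R N) =
        Finsupp.linearCombination ℂ (u s) (startForm n (ρ N)) := by
      rw [← sub_eq_zero, ← map_sub]
      exact linearCombination_eq_zero hn (hu s) (hρ N)
    rw [Function.comp_apply, h2, h3, h4, linearCombination_startForm]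
    rfl
  obtain ⟨r, hr⟩ := hemb.isClosed_range.mem_of_tendsto hTρ
    (Eventually.of_forall fun N => ⟨ρ N, rfl⟩)
  have hρr : Tendsto ρ atTop (𝓝 r) := by
    rw [hemb.tendsto_nhds_iff, hr]
    exact hTρ
  have hr0 : r = 0 := hT0 r (by
    rw [hr]
    exact tendsto_dualCoord hε hψ x)
  subst hr0
  refine ⟨hρr, ?_⟩
  rw [map_zero] at hr
  have hx0 : ∀ m, inner ℂ (ε m) x = 0 := inner_eq_zero_of_dualCoord hε hγ hψ hγψ
    fun s => (congrFun hr s).symm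
  let K : Submodule ℂ E := (Submodule.span ℂ (Set.range ε)).topologicalClosure
  have hK : IsClosed (K : Set E) := Submodule.isClosed_topologicalClosure _
  have hεK : ∀ m, ε m ∈ K := fun m =>
    Submodule.le_topologicalClosure _ (Submodule.subset_span ⟨m, rfl⟩)
  have hxK : x ∈ K := by
    have h5 : Tendsto (fun N => Finsupp.linearCombination ℂ X (R N - startForm n (ρ N))) atTop
        (𝓝 x) := by
      have h6 : Tendsto (fun N => Finsupp.linearCombination ℂ X (startForm n (ρ N))) atTop
          (𝓝 0) := by
        simp only [linearCombination_startForm]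
        have := tendsto_finsetSum Finset.univ fun (i : Fin n) _ =>
          ((tendsto_pi_nhds.mp hρr) i).smul_const (X (-(i : ℤ) - 1))
        simpa using this
      have h7 := hx.sub h6
      rw [sub_zero] at h7
      simpa only [map_sub] using h7
    refine hK.mem_of_tendsto h5 (Eventually.of_forall fun N => ?_)
    have h8 : incrementForms n ≤ K.comap (Finsupp.linearCombination ℂ X) := by
      rw [incrementForms_eq_span hn]
      refine Submodule.span_le.mpr ?_
      rintro _ ⟨j, rfl⟩
      rw [SetLike.mem_coe, Submodule.mem_comap, linearCombination_incrementForm, ← bdiff_pow_eq, hX]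
      exact act_mem hK hγ (fun k => (hε.1 k).le) fun k _ => hεK k
    exact h8 (hρ N)
  refine eq_zero_of_mem_closure_span hxK ?_
  rintro _ ⟨m, rfl⟩
  exact hx0 m

end Remainder

section Coefficients

variable {n μ : ℕ} {a b : ℕ → ℂ}

theorem dSeries_mul (n : ℕ) (hμ : 1 ≤ μ) :
    (1 - PowerSeries.X ^ μ : PowerSeries ℂ) ^ n *
      (PowerSeries.mk fun j => if μ ∣ j then (1 : ℂ) else 0) ^ n = 1 := by
  rw [← mul_pow]
  suffices (1 - PowerSeries.X ^ μ : PowerSeries ℂ) *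
      (PowerSeries.mk fun j => if μ ∣ j then (1 : ℂ) else 0) = 1 by rw [this, one_pow]
  ext j
  rw [sub_mul, one_mul, map_sub, PowerSeries.coeff_X_pow_mul', PowerSeries.coeff_mk,
    PowerSeries.coeff_mk, PowerSeries.coeff_one]
  by_cases h0 : j = 0
  · simp [h0, show ¬ μ ≤ 0 by omega]
  · by_cases h1 : μ ≤ j
    · have h2 : μ ∣ j - μ ↔ μ ∣ j := by
        rw [Nat.dvd_sub_iff_left h1 dvd_rfl]
      simp only [if_pos h1, if_neg h0, h2, sub_self]
    · rw [if_neg h1, if_neg h0, if_neg, sub_zero]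
      exact fun h => h1 (Nat.le_of_dvd (by omega) h)

theorem sum_dMatrix (hμ : 1 ≤ μ) (k m : ℕ) :
    ∑ l ∈ Finset.range (n + 1), ((-1 : ℂ) ^ l * (n.choose l : ℂ)) * dMatrix n μ (k + l * μ) m =
      if m = k then 1 else 0 := by
  by_cases hkm : k ≤ m
  · have h1 := congrArg (PowerSeries.coeff (m - k)) (dSeries_mul n hμ)
    have h2 : (1 - PowerSeries.X ^ μ : PowerSeries ℂ) ^ n =
        ∑ l ∈ Finset.range (n + 1), PowerSeries.C ((-1 : ℂ) ^ l * (n.choose l : ℂ)) *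
          PowerSeries.X ^ (μ * l) := by
      rw [sub_eq_neg_add, add_pow]
      refine Finset.sum_congr rfl fun l _ => ?_
      rw [neg_pow, ← pow_mul]
      simp only [one_pow, mul_one, map_mul, map_pow, map_neg, map_one, map_natCast]
      ring
    rw [h2, Finset.sum_mul, map_sum, PowerSeries.coeff_one] at h1
    rw [show (if m = k then (1 : ℂ) else 0) = if m - k = 0 then 1 else 0 by
      congr 1; exact propext ⟨fun h => by omega, fun h => by omega⟩, ← h1]
    refine Finset.sum_congr rfl fun l _ => ?_
    rw [mul_assoc (PowerSeries.C _), PowerSeries.coeff_C_mul, PowerSeries.coeff_X_pow_mul', dMatrix, dCoeff]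
    congr 1
    have h3 : (k + l * μ ≤ m) ↔ μ * l ≤ m - k := by
      rw [mul_comm μ l]
      omega
    by_cases h4 : k + l * μ ≤ m
    · rw [if_pos h4, if_pos (h3.mp h4)]
      congr 2
      rw [mul_comm μ l]
      omega
    · rw [if_neg h4, if_neg fun h => h4 (h3.mpr h)]
  · rw [if_neg (by omega)]
    refine Finset.sum_eq_zero fun l _ => ?_
    rw [dMatrix, if_neg (by omega), mul_zero]

/-- `a(k) = ∑ (-1)^l C(n,l) b(k + lμ)` when `b = D^μ a`. -/
theorem sum_choose_mul_eq (hμ : 1 ≤ μ) (hb : IsMulVec (dMatrix n μ) a b) (k : ℕ) :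
    ∑ l ∈ Finset.range (n + 1), ((-1 : ℂ) ^ l * (n.choose l : ℂ)) * b (k + l * μ) = a k := by
  have h1 := tendsto_finsetSum (Finset.range (n + 1)) fun l _ =>
    (hb (k + l * μ)).const_mul ((-1 : ℂ) ^ l * (n.choose l : ℂ))
  refine tendsto_nhds_unique h1 (tendsto_const_nhds.congr' ?_)
  filter_upwards [eventually_gt_atTop k] with N hN
  simp only [Finset.mul_sum]
  rw [Finset.sum_comm]
  have h2 : ∀ m ∈ Finset.range N, ∑ l ∈ Finset.range (n + 1),
      ((-1 : ℂ) ^ l * (n.choose l : ℂ)) * (dMatrix n μ (k + l * μ) m * a m) =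
        if m = k then a k else 0 := by
    intro m _
    simp only [← mul_assoc]
    rw [← Finset.sum_mul, sum_dMatrix hμ]
    split_ifs with h
    · rw [h, one_mul]
    · rw [zero_mul]
  rw [Finset.sum_congr rfl h2, Finset.sum_ite_eq', if_pos (Finset.mem_range.mpr hN)]

/-- The extension of a one-sided sequence by zero. -/
def zeroExt (b : ℕ → ℂ) (m : ℤ) : ℂ := if 0 ≤ m then b m.toNat else 0

/-- The form `∑ v_μ(-i) ξ(-i)`. -/
def vForm (n μ : ℕ) (b : ℕ → ℂ) : ℤ →₀ ℂ :=
  ∑ i ∈ Finset.Icc 1 (μ * n), Finsupp.single (-(i : ℤ)) (vCoeff n μ b i)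

/-- The difference between the partial sums of `∑ a(k) ξ(k) + ∑ v_μ(-i) ξ(-i)` and of
`∑ b(k) ξ⁽ⁿ⁾(k, μ)`. -/
def remForm (n μ : ℕ) (a b : ℕ → ℂ) (N : ℕ) : ℤ →₀ ℂ :=
  truncForm a N + vForm n μ b - ∑ k ∈ Finset.range N, b k • incrementForm n k μ

theorem sum_range_single_apply (x : ℕ → ℂ) (N : ℕ) (m : ℤ) :
    (∑ k ∈ Finset.range N, Finsupp.single (k : ℤ) (x k)) m = if m < N then zeroExt x m else 0 := by
  rw [Finsupp.finsetSum_apply]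
  simp only [Finsupp.single_apply]
  rcases lt_or_ge m 0 with hm | hm
  · rw [Finset.sum_eq_zero fun k _ => if_neg (by omega), zeroExt, if_neg (show ¬ 0 ≤ m by omega),
      ite_self]
  · lift m to ℕ using hm
    simp only [Nat.cast_inj, Finset.sum_ite_eq', Finset.mem_range, Nat.cast_lt, zeroExt,
      Nat.cast_nonneg, if_true, Int.toNat_natCast]

theorem vForm_apply (hμ : 1 ≤ μ) (b : ℕ → ℂ) {m : ℤ} (hm : m < 0) :
    vForm n μ b m = ∑ l ∈ Finset.range (n + 1),
      ((-1 : ℂ) ^ l * (n.choose l : ℂ)) * zeroExt b (m + l * μ) := by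
  obtain ⟨i, rfl, hi⟩ : ∃ i : ℕ, m = -(i : ℤ) ∧ 1 ≤ i := ⟨m.natAbs, by omega, by omega⟩
  rw [vForm, Finsupp.finsetSum_apply]
  simp only [Finsupp.single_apply, neg_inj, Nat.cast_inj, Finset.sum_ite_eq', Finset.mem_Icc, hi,
    true_and]
  have hsplit : ∀ l : ℕ, zeroExt b (-(i : ℤ) + l * μ) =
      if i ≤ l * μ then b (l * μ - i) else 0 := by
    intro l
    rw [zeroExt]
    have h1 : (-(i : ℤ) + l * μ) = ((l * μ : ℕ) : ℤ) - i := by push_cast; ring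
    rw [h1]
    by_cases h : i ≤ l * μ
    · rw [if_pos h, if_pos (by omega)]
      congr 1
      omega
    · rw [if_neg h, if_neg (by omega)]
  simp only [hsplit]
  have hsum : ∑ l ∈ Finset.range (n + 1), ((-1 : ℂ) ^ l * (n.choose l : ℂ)) *
      (if i ≤ l * μ then b (l * μ - i) else 0) = vCoeff n μ b i := by
    simp only [mul_ite, mul_zero]
    rw [← Finset.sum_filter, vCoeff]
    refine Finset.sum_congr ?_ fun _ _ => rfl
    ext l
    rw [Finset.mem_filter, Finset.mem_range, Finset.mem_Icc, Nat.ceil_le,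
      div_le_iff₀ (by exact_mod_cast hμ)]
    have : ((i : ℚ) ≤ (l : ℚ) * (μ : ℚ)) ↔ i ≤ l * μ := by exact_mod_cast Iff.rfl
    rw [this]
    omega
  rw [hsum]
  split_ifs with h
  · rfl
  · rw [← hsum]
    refine (Finset.sum_eq_zero fun l hl => ?_).symm
    rw [if_neg, mul_zero]
    have h3 : l ≤ n := Nat.lt_succ_iff.mp (Finset.mem_range.mp hl)
    have h4 : l * μ ≤ n * μ := Nat.mul_le_mul_right _ h3
    rw [mul_comm] at h
    omega

theorem vForm_apply_of_nonneg (b : ℕ → ℂ) {m : ℤ} (hm : 0 ≤ m) : vForm n μ b m = 0 := by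
  rw [vForm, Finsupp.finsetSum_apply]
  refine Finset.sum_eq_zero fun i hi => ?_
  have := (Finset.mem_Icc.mp hi).1
  rw [Finsupp.single_apply, if_neg (by omega)]

theorem remForm_apply (hμ : 1 ≤ μ) (hb : IsMulVec (dMatrix n μ) a b) (N : ℕ) (m : ℤ) :
    remForm n μ a b N m = ∑ l ∈ Finset.range (n + 1), ((-1 : ℂ) ^ l * (n.choose l : ℂ)) *
      ((if m < N then zeroExt b (m + l * μ) else 0) -
        if m + l * μ < N then zeroExt b (m + l * μ) else 0) := by
  have h1 : (∑ k ∈ Finset.range N, b k • incrementForm n k μ) m =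
      ∑ l ∈ Finset.range (n + 1), ((-1 : ℂ) ^ l * (n.choose l : ℂ)) *
        if m + l * μ < N then zeroExt b (m + l * μ) else 0 := by
    simp only [← sum_range_single_apply, incrementForm, Finset.smul_sum, Finsupp.finsetSum_apply,
      Finset.mul_sum]
    rw [Finset.sum_comm]
    refine Finset.sum_congr rfl fun l _ => Finset.sum_congr rfl fun k _ => ?_
    rw [Finsupp.smul_apply, Finsupp.single_apply, Finsupp.single_apply, smul_eq_mul]
    by_cases h : (k : ℤ) = m + l * μ
    · rw [if_pos h, if_pos (by omega), mul_comm]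
    · rw [if_neg h, if_neg (by omega), mul_zero, mul_zero]
  have h2 : truncForm a N m + vForm n μ b m = ∑ l ∈ Finset.range (n + 1),
      ((-1 : ℂ) ^ l * (n.choose l : ℂ)) * if m < N then zeroExt b (m + l * μ) else 0 := by
    rw [truncForm, sum_range_single_apply]
    rcases lt_or_ge m 0 with hm | hm
    · rw [vForm_apply hμ b hm, zeroExt, if_neg (show ¬ 0 ≤ m by omega), ite_self, zero_add]
      refine Finset.sum_congr rfl fun l _ => ?_
      rw [if_pos (by omega)]
    · rw [vForm_apply_of_nonneg b hm, add_zero]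
      lift m to ℕ using hm
      by_cases h : (m : ℤ) < N
      · simp only [h, if_true]
        rw [zeroExt, if_pos (by omega), Int.toNat_natCast, ← sum_choose_mul_eq hμ hb m]
        refine Finset.sum_congr rfl fun l _ => ?_
        rw [zeroExt, if_pos (by positivity)]
        congr 2
      · simp [h]
  rw [remForm, Finsupp.sub_apply, Finsupp.add_apply, h1, h2, ← Finset.sum_sub_distrib]
  exact Finset.sum_congr rfl fun l _ => (mul_sub _ _ _).symm

theorem remForm_apply_eq_zero (hμ : 1 ≤ μ) (hb : IsMulVec (dMatrix n μ) a b) (N : ℕ) (m : ℤ)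
    (hm : m + (n * μ : ℕ) < (N : ℤ)) : remForm n μ a b N m = 0 := by
  rw [remForm_apply hμ hb]
  refine Finset.sum_eq_zero fun l hl => ?_
  have h3 : l ≤ n := Nat.lt_succ_iff.mp (Finset.mem_range.mp hl)
  have h4 : ((l * μ : ℕ) : ℤ) ≤ (n * μ : ℕ) := by exact_mod_cast Nat.mul_le_mul_right _ h3
  have h5 : ((l * μ : ℕ) : ℤ) = l * μ := by push_cast; ring
  rw [if_pos (by omega), if_pos (by omega), sub_self, mul_zero]

theorem eq_zero_of_eventually_zero (hb : IsMulVec (dMatrix n μ) a b) {K : ℕ}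
    (ha : ∀ k, K ≤ k → a k = 0) {k : ℕ} (hk : K ≤ k) : b k = 0 := by
  refine tendsto_nhds_unique (hb k) (tendsto_const_nhds.congr fun N => ?_)
  refine (Finset.sum_eq_zero fun j _ => ?_).symm
  rcases lt_or_ge j k with h | h
  · rw [dMatrix, if_neg (by omega), zero_mul]
  · rw [ha j (by omega), mul_zero]

theorem remForm_eq_zero (hμ : 1 ≤ μ) (hb : IsMulVec (dMatrix n μ) a b) {K N : ℕ}
    (ha : ∀ k, K ≤ k → a k = 0) (hN : K ≤ N) : remForm n μ a b N = 0 := by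
  ext m
  rw [remForm_apply hμ hb, Finsupp.zero_apply]
  refine Finset.sum_eq_zero fun l _ => ?_
  have h1 : (0 : ℤ) ≤ l * μ := by positivity
  have h2 : ∀ j : ℤ, ¬ j < N → zeroExt b j = 0 := by
    intro j hj
    rw [zeroExt, if_pos (by omega)]
    exact eq_zero_of_eventually_zero hb ha (by omega)
  by_cases h3 : m + l * μ < N
  · rw [if_pos h3, if_pos (by omega), sub_self, mul_zero]
  · rw [h2 _ h3, ite_self, ite_self, sub_self, mul_zero]

end Coefficients

end StatIncr
end

noncomputable section
namespace StatIncr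

section Probability

variable {Ω : Type*} [MeasurableSpace Ω] {P : Measure Ω} {ξ : ℤ → Ω → ℂ} {n μ : ℕ}

theorem linComb_eq_linearCombination {Ω : Type*} (ξ : ℤ → Ω → ℂ) (c : ℤ →₀ ℂ) :
    linComb ξ c = Finsupp.linearCombination ℂ ξ c := by
  funext ω
  simp [linComb, Finsupp.linearCombination_apply, Finsupp.sum]

theorem aestronglyMeasurable_linComb (hmeas : ∀ m, AEStronglyMeasurable (ξ m) P) (c : ℤ →₀ ℂ) :
    AEStronglyMeasurable (linComb ξ c) P :=
  Finset.aestronglyMeasurable_fun_sum _ fun m _ => (hmeas m).const_mul (c m)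

/-- If a sequence with square integrable increments has infinitely many square integrable members
with positive indices, then all its members are square integrable. -/
theorem HasStationaryIncrements.memLp_of_frequently (hξ : HasStationaryIncrements P n ξ)
    (h : ∃ᶠ k : ℕ in atTop, MemLp (ξ k) 2 P) (m : ℤ) : MemLp (ξ m) 2 P := by
  let Q := (squareIntegrable P).mkQ
  have h1 : (fun m => Q (ξ m)) = 0 := by
    refine eq_zero_of_bdiff_pow_of_frequently n ?_ ?_
    · funext m
      rw [bdiff_pow_eq, map_diffOp, ← increment_eq_diffOp, Submodule.mkQ_apply, Pi.zero_apply,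
        Submodule.Quotient.mk_eq_zero]
      exact hξ.memLp m 1
    · have h2 : ∃ᶠ k : ℕ in atTop, Q (ξ (k : ℤ)) = 0 := h.mono fun k hk => by
        rw [Submodule.mkQ_apply, Submodule.Quotient.mk_eq_zero]
        exact hk
      exact tendsto_natCast_atTop_atTop.frequently h2
  have h3 := congrFun h1 m
  rw [Pi.zero_apply, Submodule.mkQ_apply, Submodule.Quotient.mk_eq_zero] at h3
  exact h3

theorem IsFunctional.memLp_mul (hmeas : ∀ m, AEStronglyMeasurable (ξ m) P) {a : ℕ → ℂ}
    {Aξ : Ω → ℂ} (hA : IsFunctional P ξ a Aξ) :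
    ∀ᶠ k : ℕ in atTop, MemLp (fun ω => a k * ξ k ω) 2 P := by
  have h1 : ∀ᶠ N : ℕ in atTop,
      MemLp (fun ω => (∑ k ∈ Finset.range N, a k * ξ k ω) - Aξ ω) 2 P := by
    filter_upwards [hA.2.eventually_lt_const ENNReal.zero_lt_top] with N hN
    refine ⟨AEStronglyMeasurable.sub ?_ hA.1, hN⟩
    exact Finset.aestronglyMeasurable_fun_sum _ fun k _ => (hmeas k).const_mul _
  filter_upwards [h1, (tendsto_add_atTop_nat 1).eventually h1] with k h2 h3
  have h4 := h3.sub h2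
  refine h4.ae_eq (Eventually.of_forall fun ω => ?_)
  simp only [Pi.sub_apply, Finset.sum_range_succ]
  ring

theorem eLpNorm_eq_enorm {g : Ω → ℂ} {x : Lp ℂ 2 P} (h : g =ᵐ[P] x) : eLpNorm g 2 P = ‖x‖ₑ := by
  rw [eLpNorm_congr_ae h, Lp.enorm_def]

theorem exists_mem_of_tendsto_eLpNorm {K : Submodule ℂ (Lp ℂ 2 P)}
    (hK : IsClosed (K : Set (Lp ℂ 2 P))) {g : ℕ → Ω → ℂ} {y : Ω → ℂ}
    (hy : AEStronglyMeasurable y P) (hg : ∀ j, ∃ x ∈ K, g j =ᵐ[P] x)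
    (h : Tendsto (fun j => eLpNorm (fun ω => g j ω - y ω) 2 P) atTop (𝓝 0)) :
    ∃ x ∈ K, y =ᵐ[P] x := by
  choose x hxK hx using hg
  have hym : MemLp y 2 P := by
    obtain ⟨j, hj⟩ := (h.eventually_lt_const ENNReal.zero_lt_top).exists
    have h1 : MemLp (g j) 2 P := (Lp.memLp (x j)).ae_eq (hx j).symm
    have h2 : MemLp (fun ω => g j ω - y ω) 2 P := ⟨h1.1.sub hy, hj⟩
    refine (h1.sub h2).ae_eq (Eventually.of_forall fun ω => ?_)
    simp
  refine ⟨hym.toLp y, ?_, hym.coeFn_toLp.symm⟩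
  have h3 : Tendsto x atTop (𝓝 (hym.toLp y)) := by
    rw [Lp.tendsto_Lp_iff_tendsto_eLpNorm']
    refine h.congr fun j => eLpNorm_congr_ae ?_
    filter_upwards [hx j, hym.coeFn_toLp] with ω h4 h5
    rw [Pi.sub_apply, h4, h5]
  exact hK.mem_of_tendsto h3 (Eventually.of_forall hxK)

theorem toLp_linComb (hm : ∀ m, MemLp (ξ m) 2 P) (c : ℤ →₀ ℂ) :
    linComb ξ c =ᵐ[P] Finsupp.linearCombination ℂ (fun m => (hm m).toLp (ξ m)) c := by
  have h1 : Finsupp.linearCombination ℂ (fun m => (hm m).toLp (ξ m)) c =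
      toLpLinear P (Finsupp.linearCombination ℂ
        (fun m => (⟨ξ m, hm m⟩ : squareIntegrable P)) c) := by
    rw [Finsupp.apply_linearCombination]
    rfl
  have h2 : ((Finsupp.linearCombination ℂ (fun m => (⟨ξ m, hm m⟩ : squareIntegrable P)) c :
      squareIntegrable P) : Ω → ℂ) = linComb ξ c := by
    rw [linComb_eq_linearCombination]
    exact Finsupp.apply_linearCombination ℂ (squareIntegrable P).subtype _ c
  rw [h1, ← h2]
  exact (MemLp.coeFn_toLp (Finsupp.linearCombination ℂ
    (fun m => (⟨ξ m, hm m⟩ : squareIntegrable P)) c).2).symm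

theorem diffOp_toLp (hξ : HasStationaryIncrements P n ξ) (hm : ∀ m, MemLp (ξ m) 2 P) (m ν : ℤ) :
    diffOp n ν (fun m => (hm m).toLp (ξ m)) m = hξ.incr m ν := by
  rw [← linearCombination_incrementForm]
  refine Lp.ext ((toLp_linComb hm _).symm.trans ?_)
  rw [linComb_incrementForm]
  exact (hξ.memLp m ν).coeFn_toLp.symm

theorem summable_smul_incr (hξ : HasStationaryIncrements P n ξ) {b : ℕ → ℂ}
    (hb : Summable fun k => ‖b k‖) (ν : ℤ) : Summable fun k : ℕ => b k • hξ.incr k ν := by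
  refine Summable.of_norm_bounded (hb.mul_right ‖hξ.incr 0 ν‖) fun k => ?_
  rw [norm_smul, hξ.norm_incr]

variable {f : ℝ → ℝ} {γ ψ : PowerSeries ℂ} {a b : ℕ → ℂ} {Aξ : Ω → ℂ}

/-- The remainder forms and their reductions to the starting values tend to zero in mean square. -/
theorem exists_reduction (hn : 1 ≤ n) (hμ : 1 ≤ μ) (hmeas : ∀ m, AEStronglyMeasurable (ξ m) P)
    (hξ : HasStationaryIncrements P n ξ) (h : IsOuterPair n f γ ψ)
    (hf : IsSpectralDensity P n ξ f) (hb : IsMulVec (dMatrix n μ) a b)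
    (hb₁ : Summable fun k => ‖b k‖) (hA : IsFunctional P ξ a Aξ) :
    ∃ ρ : ℕ → Fin n → ℂ, (∀ N, remForm n μ a b N - startForm n (ρ N) ∈ incrementForms n) ∧
      Tendsto (fun N => eLpNorm (linComb ξ (remForm n μ a b N)) 2 P) atTop (𝓝 0) ∧
      Tendsto (fun N => eLpNorm (linComb ξ (startForm n (ρ N))) 2 P) atTop (𝓝 0) := by
  choose ρ hρ using fun N => exists_startForm_sub_mem n (remForm n μ a b N)
  by_cases ha : ∃ K, ∀ k, K ≤ k → a k = 0
  · obtain ⟨K, hK⟩ := ha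
    have h0 : linComb ξ 0 = 0 := by rw [linComb_eq_linearCombination, map_zero]
    refine ⟨fun N => if K ≤ N then 0 else ρ N, fun N => ?_, ?_, ?_⟩
    · dsimp only
      by_cases hN : K ≤ N
      · rw [if_pos hN, remForm_eq_zero hμ hb hK hN]
        simp [startForm]
      · rw [if_neg hN]
        exact hρ N
    · refine tendsto_const_nhds.congr' ?_
      filter_upwards [eventually_ge_atTop K] with N hN
      rw [remForm_eq_zero hμ hb hK hN, h0, eLpNorm_zero]
    · refine tendsto_const_nhds.congr' ?_
      filter_upwards [eventually_ge_atTop K] with N hN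
      rw [if_pos hN, show startForm n 0 = 0 by simp [startForm], h0, eLpNorm_zero]
  · have hm : ∀ m, MemLp (ξ m) 2 P := by
      refine hξ.memLp_of_frequently ?_
      have h1 : ∃ᶠ k in atTop, a k ≠ 0 := by
        rw [frequently_atTop]
        push Not at ha
        exact ha
      refine (h1.and_eventually (hA.memLp_mul hmeas)).mono fun k hk => ?_
      refine (hk.2.const_mul (a k)⁻¹).ae_eq (Eventually.of_forall fun ω => ?_)
      exact inv_mul_cancel_left₀ hk.1 _
    set X : ℤ → Lp ℂ 2 P := fun m => (hm m).toLp (ξ m) with hXdef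
    have hX : (bdiff (Lp ℂ 2 P) ^ n) X = act γ (innov hξ ψ) := by
      rw [h.act_innov]
      funext m
      rw [bdiff_pow_eq]
      exact diffOp_toLp hξ hm m 1
    have hpart : ∀ N, MemLp (linComb ξ (truncForm a N)) 2 P := fun N =>
      (Lp.memLp _).ae_eq (toLp_linComb hm _).symm
    have hAm : MemLp Aξ 2 P := by
      obtain ⟨N, hN⟩ := (hA.2.eventually_lt_const ENNReal.zero_lt_top).exists
      have h1 := hpart N
      rw [linComb_truncForm] at h1
      have h2 : MemLp (fun ω => (∑ k ∈ Finset.range N, a k * ξ k ω) - Aξ ω) 2 P :=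
        ⟨h1.1.sub hA.1, hN⟩
      refine (h1.sub h2).ae_eq (Eventually.of_forall fun ω => ?_)
      simp
    have hlimA : Tendsto (fun N => Finsupp.linearCombination ℂ X (truncForm a N)) atTop
        (𝓝 (hAm.toLp Aξ)) := by
      rw [Lp.tendsto_Lp_iff_tendsto_eLpNorm']
      refine hA.2.congr fun N => eLpNorm_congr_ae ?_
      have h1 := toLp_linComb hm (truncForm a N)
      rw [linComb_truncForm] at h1
      filter_upwards [h1, hAm.coeFn_toLp] with ω h2 h3
      rw [Pi.sub_apply, ← h2, h3]
    have hlimR : Tendsto (fun N => Finsupp.linearCombination ℂ X (remForm n μ a b N)) atTop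
        (𝓝 (hAm.toLp Aξ + Finsupp.linearCombination ℂ X (vForm n μ b) -
          ∑' k : ℕ, b k • hξ.incr k μ)) := by
      have h1 := (hlimA.add_const (Finsupp.linearCombination ℂ X (vForm n μ b))).sub
        (summable_smul_incr hξ hb₁ μ).hasSum.tendsto_sum_nat
      refine h1.congr fun N => ?_
      rw [remForm, map_sub, map_add, map_sum]
      congr 1
      refine Finset.sum_congr rfl fun k _ => ?_
      rw [map_smul, linearCombination_incrementForm]
      congr 1
      exact (diffOp_toLp hξ hm k μ).symm
    obtain ⟨h1, h2⟩ := tendsto_zero_of_support_atTop hn (h.orthonormal_innov hf) h.summable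
      h.summable_inv h.mul_eq hX (remForm_apply_eq_zero hμ hb) hρ hlimR
    refine ⟨ρ, hρ, ?_, ?_⟩
    · rw [h2] at hlimR
      have h3 := hlimR.enorm
      rw [enorm_zero] at h3
      exact h3.congr fun N => (eLpNorm_eq_enorm (toLp_linComb hm _)).symm
    · have h4 : Tendsto (fun N => Finsupp.linearCombination ℂ X (startForm n (ρ N))) atTop
          (𝓝 0) := by
        simp only [linearCombination_startForm]
        have := tendsto_finsetSum Finset.univ fun (i : Fin n) _ =>
          ((tendsto_pi_nhds.mp h1) i).smul_const (X (-(i : ℤ) - 1))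
        simpa using this
      have h3 := h4.enorm
      rw [enorm_zero] at h3
      exact h3.congr fun N => (eLpNorm_eq_enorm (toLp_linComb hm _)).symm

theorem linComb_remForm {Ω : Type*} {ξ : ℤ → Ω → ℂ} (N : ℕ) (ω : Ω) : linComb ξ (remForm n μ a b N) ω =
    (∑ k ∈ Finset.range N, a k * ξ k ω) +
      (∑ i ∈ Finset.Icc 1 (μ * n), vCoeff n μ b i * ξ (-(i : ℤ)) ω) -
      ∑ k ∈ Finset.range N, b k * increment n ξ k μ ω := by
  have h1 : linComb ξ (vForm n μ b) = fun ω =>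
      ∑ i ∈ Finset.Icc 1 (μ * n), vCoeff n μ b i * ξ (-(i : ℤ)) ω := linComb_sum_single ξ _ _ _
  have h2 := linComb_truncForm ξ a N
  rw [linComb_eq_linearCombination] at h1 h2 ⊢
  rw [remForm, map_sub, map_add, h1, h2, map_sum]
  simp only [map_smul, ← linComb_eq_linearCombination, linComb_incrementForm, Pi.sub_apply,
    Pi.add_apply, Finset.sum_apply, Pi.smul_apply, smul_eq_mul]

/-- `Aξ = -∑ v_μ(k) ξ(k) + ∑ b(k) ξ⁽ⁿ⁾(k, μ)`. -/
theorem functional_add_ae_eq (hmeas : ∀ m, AEStronglyMeasurable (ξ m) P)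
    (hξ : HasStationaryIncrements P n ξ) (hb₁ : Summable fun k => ‖b k‖)
    (hA : IsFunctional P ξ a Aξ)
    (hR : Tendsto (fun N => eLpNorm (linComb ξ (remForm n μ a b N)) 2 P) atTop (𝓝 0)) :
    (fun ω => Aξ ω + ∑ i ∈ Finset.Icc 1 (μ * n), vCoeff n μ b i * ξ (-(i : ℤ)) ω) =ᵐ[P]
      ((∑' k : ℕ, b k • hξ.incr k μ : Lp ℂ 2 P) : Ω → ℂ) := by
  set D : Lp ℂ 2 P := ∑' k : ℕ, b k • hξ.incr k μ
  set S : ℕ → Ω → ℂ := fun N ω => ∑ k ∈ Finset.range N, a k * ξ k ω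
  set V : Ω → ℂ := fun ω => ∑ i ∈ Finset.Icc 1 (μ * n), vCoeff n μ b i * ξ (-(i : ℤ)) ω
  have hS : ∀ N, AEStronglyMeasurable (S N) P := fun N =>
    Finset.aestronglyMeasurable_fun_sum _ fun k _ => (hmeas k).const_mul _
  have hD : Tendsto (fun N => eLpNorm (fun ω =>
      (∑ k ∈ Finset.range N, b k * increment n ξ k μ ω) - D ω) 2 P) atTop (𝓝 0) := by
    have h1 := (summable_smul_incr hξ hb₁ μ).hasSum.tendsto_sum_nat
    rw [Lp.tendsto_Lp_iff_tendsto_eLpNorm'] at h1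
    refine h1.congr fun N => eLpNorm_congr_ae ?_
    have h2 : ∀ᵐ ω ∂P, ∀ k ∈ Finset.range N,
        (b k • hξ.incr k μ : Lp ℂ 2 P) ω = b k * increment n ξ k μ ω := by
      refine (ae_ball_iff (Finset.range N).countable_toSet).mpr fun k _ => ?_
      filter_upwards [Lp.coeFn_smul (b k) (hξ.incr k μ), (hξ.memLp k μ).coeFn_toLp] with ω h3 h4
      rw [h3, Pi.smul_apply, smul_eq_mul, HasStationaryIncrements.incr, h4]
    filter_upwards [h2, Lp.coeFn_fun_finsetSum (Finset.range N) fun k : ℕ =>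
      b k • hξ.incr k μ] with ω h5 h6
    rw [Pi.sub_apply, h6, Finset.sum_congr rfl h5]
  have hincr : ∀ N, AEStronglyMeasurable (fun ω =>
      ∑ k ∈ Finset.range N, b k * increment n ξ k μ ω) P := fun N =>
    Finset.aestronglyMeasurable_fun_sum _ fun k _ => (hξ.memLp k μ).1.const_mul _
  have hlim : Tendsto (fun N => eLpNorm (fun ω => S N ω - Aξ ω) 2 P +
      eLpNorm (linComb ξ (remForm n μ a b N)) 2 P + eLpNorm (fun ω =>
      (∑ k ∈ Finset.range N, b k * increment n ξ k μ ω) - D ω) 2 P) atTop (𝓝 0) := by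
    have := (hA.2.add hR).add hD
    simpa using this
  have hle : ∀ N, eLpNorm (fun ω => Aξ ω + V ω - D ω) 2 P ≤
      eLpNorm (fun ω => S N ω - Aξ ω) 2 P +
      eLpNorm (linComb ξ (remForm n μ a b N)) 2 P + eLpNorm (fun ω =>
      (∑ k ∈ Finset.range N, b k * increment n ξ k μ ω) - D ω) 2 P := by
    intro N
    have h1 : (fun ω => Aξ ω + V ω - D ω) = ((fun ω => linComb ξ (remForm n μ a b N) ω) -
        (fun ω => S N ω - Aξ ω)) + fun ω =>
        (∑ k ∈ Finset.range N, b k * increment n ξ k μ ω) - D ω := by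
      funext ω
      simp only [Pi.add_apply, Pi.sub_apply, linComb_remForm, S, V]
      ring
    rw [h1]
    refine (eLpNorm_add_le (((aestronglyMeasurable_linComb hmeas _).sub ((hS N).sub hA.1)))
      ((hincr N).sub (Lp.aestronglyMeasurable D)) (by norm_num)).trans ?_
    refine add_le_add ?_ le_rfl
    exact (eLpNorm_sub_le (aestronglyMeasurable_linComb hmeas _) ((hS N).sub hA.1)
      (by norm_num)).trans_eq (add_comm _ _)
  have h0 : eLpNorm (fun ω => Aξ ω + V ω - D ω) 2 P = 0 :=
    le_antisymm (ge_of_tendsto' hlim hle) zero_le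
  have hV : AEStronglyMeasurable V P :=
    Finset.aestronglyMeasurable_fun_sum _ fun k _ => (hmeas _).const_mul _
  have hm : AEStronglyMeasurable (fun ω => Aξ ω + V ω - D ω) P :=
    (hA.1.add hV).sub (Lp.aestronglyMeasurable D)
  rw [eLpNorm_eq_zero_iff hm (by norm_num)] at h0
  filter_upwards [h0] with ω h1
  exact sub_eq_zero.mp h1

end Probability

end StatIncr
end

noncomputable section
namespace StatIncr

/-! The vector `D^μ A φ_μ`. -/

section Hankel

variable {n μ : ℕ} {a b x : ℕ → ℂ}

/-- The product of the matrix with entries `b(j + i)` and the vector `x`. -/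
def hankelMulVec (b x : ℕ → ℂ) (j : ℕ) : ℂ := ∑' i, b (j + i) * x i

theorem summable_hankel (hb : Summable fun k => ‖b k‖) (hx : Summable fun k => ‖x k‖) :
    Summable fun p : ℕ × ℕ => ‖b (p.1 + p.2) * x p.2‖ := by
  rw [← (Equiv.prodComm ℕ ℕ).summable_iff]
  change Summable fun p : ℕ × ℕ => ‖b (p.2 + p.1) * x p.1‖
  rw [summable_prod_of_nonneg fun _ => norm_nonneg _]
  have h1 : ∀ i, Summable fun j => ‖b (j + i)‖ := fun i => (summable_nat_add_iff i).mpr hb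
  constructor
  · intro i
    simpa using (h1 i).mul_right ‖x i‖
  · refine (hx.mul_left (∑' k, ‖b k‖)).of_nonneg_of_le
      (fun i => tsum_nonneg fun _ => norm_nonneg _) fun i => ?_
    simp only [norm_mul]
    rw [tsum_mul_right]
    refine mul_le_mul_of_nonneg_right ?_ (norm_nonneg _)
    exact (h1 i).tsum_le_tsum_of_inj (fun j => j + i) (add_left_injective i)
      (fun _ _ => norm_nonneg _) (fun _ => le_rfl) hb

theorem hasSum_hankelMulVec (hb : Summable fun k => ‖b k‖) (hx : Summable fun k => ‖x k‖) (j : ℕ) :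
    HasSum (fun i => b (j + i) * x i) (hankelMulVec b x j) :=
  ((summable_hankel hb hx).of_norm.prod_factor j).hasSum

theorem summable_norm_hankelMulVec (hb : Summable fun k => ‖b k‖) (hx : Summable fun k => ‖x k‖) :
    Summable fun j => ‖hankelMulVec b x j‖ :=
  (summable_hankel hb hx).prod.of_nonneg_of_le (fun _ => norm_nonneg _) fun j =>
    norm_tsum_le_tsum_norm ((summable_hankel hb hx).prod_factor j)

theorem isMulVec_hankelMulVec (hb : Summable fun k => ‖b k‖) (hx : Summable fun k => ‖x k‖) :
    IsMulVec (fun k j => b (k + j)) x (hankelMulVec b x) := fun k =>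
  (hasSum_hankelMulVec hb hx k).tendsto_sum_nat

theorem isMatMul_hankel (hb : IsMulVec (dMatrix n μ) a b) :
    IsMatMul (dMatrix n μ) (hankel a) fun k j => b (k + j) := by
  intro k j
  refine ((hb (k + j)).comp (tendsto_add_atTop_nat j)).congr fun N => ?_
  rw [Function.comp_apply, add_comm N j, Finset.sum_range_add, Finset.sum_eq_zero, zero_add]
  · refine Finset.sum_congr rfl fun l _ => ?_
    simp only [dMatrix, hankel, add_comm j l, add_le_add_iff_right, Nat.add_sub_add_right]
  · intro l hl
    have := Finset.mem_range.mp hl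
    rw [dMatrix, if_neg (by omega), zero_mul]

end Hankel

/-! Stochastic integrals of absolutely convergent trigonometric series. -/

section Series

variable {F : Measure ℝ} {x : ℕ → ℂ} {u : ℝ → ℂ}

theorem continuous_genFun (hx : Summable fun k => ‖x k‖) :
    Continuous fun θ : ℝ => genFun x (Complex.exp (Complex.I * θ)) := by
  refine continuous_tsum (fun k => by fun_prop) hx fun k θ => ?_
  rw [norm_mul, norm_pow, norm_exp_I_mul, one_pow, mul_one]

theorem norm_genFun_le (hx : Summable fun k => ‖x k‖) {z : ℂ} (hz : ‖z‖ ≤ 1) :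
    ‖genFun x z‖ ≤ ∑' k, ‖x k‖ := by
  have h := norm_ev_le (c := PowerSeries.mk x) (by simpa [AbsSummable] using hx) hz
  simpa [ev, absSum] using h

theorem memLp_genFun_mul (hx : Summable fun k => ‖x k‖) (hu : MemLp u 2 F) :
    MemLp (fun θ : ℝ => genFun x (Complex.exp (Complex.I * θ)) * u θ) 2 F := by
  refine hu.of_le_mul (c := ∑' k, ‖x k‖)
    ((continuous_genFun hx).aestronglyMeasurable.mul hu.1) (Eventually.of_forall fun θ => ?_)
  rw [norm_mul]
  exact mul_le_mul_of_nonneg_right (norm_genFun_le hx (norm_exp_I_mul θ).le) (norm_nonneg _)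

theorem hasSum_waveLp (hx : Summable fun k => ‖x k‖) (hu : MemLp u 2 F) :
    HasSum (fun k : ℕ => x k • waveLp hu k) ((memLp_genFun_mul hx hu).toLp _) := by
  refine hasSum_toLp_mul hx (w := fun k θ => Complex.exp (Complex.I * θ * ((k : ℤ) : ℂ)))
    (fun k θ => (norm_exp_I_mul_int θ _).le) (fun k => memLp_exp_mul hu k) hu
    (memLp_genFun_mul hx hu) (Eventually.of_forall fun θ => ?_)
  rw [genFun]
  congr 2
  funext k
  rw [← Complex.exp_nat_mul]
  congr 2
  push_cast
  ring

theorem norm_sq_eq_integral {α : Type*} [MeasurableSpace α] {Q : Measure α} {g : α → ℂ}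
    {y : Lp ℂ 2 Q} (h : g =ᵐ[Q] y) : ∫ ω, ‖g ω‖ ^ 2 ∂Q = ‖y‖ ^ 2 := by
  have h1 : inner ℂ y y = ∫ ω, ((‖g ω‖ ^ 2 : ℝ) : ℂ) ∂Q := by
    rw [inner_eq_integral_mul_conj]
    refine integral_congr_ae ?_
    filter_upwards [h] with ω h2
    rw [← h2, Complex.mul_conj, Complex.normSq_eq_norm_sq]
  rw [integral_complex_ofReal, inner_self_eq_norm_sq_to_K] at h1
  refine Complex.ofReal_injective ?_
  rw [Complex.ofReal_pow]
  exact h1.symm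

variable {f : ℝ → ℝ} {κ : ℝ → ℂ}

theorem IsWhitening.norm_sq_genFun_mul (h : IsWhitening f κ) (hx : Summable fun k => ‖x k‖) :
    ‖(memLp_genFun_mul hx h.memLp).toLp‖ ^ 2 = 1 / (2 * Real.pi) *
      ∫ θ in (-Real.pi)..Real.pi, ‖genFun x (Complex.exp (Complex.I * θ))‖ ^ 2 := by
  rw [← norm_sq_eq_integral (memLp_genFun_mul hx h.memLp).coeFn_toLp.symm,
    integral_spectralMeasure h.aemeasurable h.nonneg,
    intervalIntegral.integral_of_le neg_pi_lt_pi.le, ← circleMeasure_eq_Ioc, ← integral_const_mul]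
  refine integral_congr_ae ?_
  filter_upwards [h.norm_sq] with θ h1
  rw [smul_eq_mul, norm_mul, mul_pow]
  linear_combination (1 / (2 * Real.pi) * ‖genFun x (Complex.exp (Complex.I * θ))‖ ^ 2) * h1

end Series

section Kernel

variable {n μ : ℕ} {f : ℝ → ℝ} {γ ψ : PowerSeries ℂ}

theorem kernel_natCast (n μ : ℕ) (θ : ℝ) : kernel n μ θ =
    (geomPoly n μ).eval (Complex.exp (-Complex.I * θ)) * kernel n 1 θ := by
  have h1 : Complex.exp (-Complex.I * θ * ((μ : ℤ) : ℂ)) = Complex.exp (-Complex.I * θ) ^ μ := by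
    rw [← Complex.exp_nat_mul]
    congr 1
    push_cast
    ring
  have h2 : (1 : ℂ) - Complex.exp (-Complex.I * θ) ^ μ =
      (∑ j ∈ Finset.range μ, Complex.exp (-Complex.I * θ) ^ j) *
        (1 - Complex.exp (-Complex.I * θ)) := (geom_sum_mul_neg _ _).symm
  rw [kernel, kernel, h1, h2, geomPoly, Polynomial.eval_pow, Polynomial.eval_finsetSum, mul_pow]
  simp only [Polynomial.eval_pow, Polynomial.eval_X, Int.cast_one, mul_one]
  ring

theorem ae_eval_geomPoly_ne_zero (n : ℕ) (hμ : 1 ≤ μ) :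
    ∀ᵐ θ : ℝ, (geomPoly n μ).eval (Complex.exp (-Complex.I * θ)) ≠ 0 := by
  have hcount : (Set.range fun k : ℤ => -(k * (2 * Real.pi) / μ)).Countable :=
    Set.countable_range _
  filter_upwards [compl_mem_ae_iff.mpr (hcount.measure_zero volume)] with θ hθ h
  refine hθ ?_
  rw [geomPoly, Polynomial.eval_pow, Polynomial.eval_finsetSum] at h
  have h1 := eq_zero_of_pow_eq_zero h
  simp only [Polynomial.eval_pow, Polynomial.eval_X] at h1
  have h2 := geom_sum_mul_neg (Complex.exp (-Complex.I * θ)) μ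
  rw [h1, zero_mul, ← Complex.exp_nat_mul] at h2
  obtain ⟨k, hk⟩ := Complex.exp_eq_one_iff.mp (sub_eq_zero.mp h2.symm).symm
  refine ⟨k, ?_⟩
  have hμ' : (μ : ℝ) ≠ 0 := by exact_mod_cast (by omega : μ ≠ 0)
  have h3 := congrArg Complex.im hk
  simp at h3
  field_simp
  linarith

theorem kernel_mul_inv (h : IsOuterPair n f γ ψ) {φμ : ℕ → ℂ} {c : ℂ} 
    (hφ : ∀ k, PowerSeries.coeff k (canonicalSeries n μ γ) = c * φμ k) {θ : ℝ}
    (hθ : (geomPoly n μ).eval (Complex.exp (-Complex.I * θ)) ≠ 0) :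
    (genFun φμ (Complex.exp (-Complex.I * θ)))⁻¹ * kernel n μ θ = c * whitener n ψ θ := by
  set z := Complex.exp (-Complex.I * θ) with hz
  have h1 : ev (canonicalSeries n μ γ) z = c * genFun φμ z := by
    simp only [ev, genFun, hφ, mul_assoc]
    rw [tsum_mul_left]
  rw [canonicalSeries, ev_mul (absSummable_coe _) h.summable (norm_exp_neg_I_mul θ).le, ev_coe] at h1
  have h2 := h.ev_mul_ev θ
  rw [← hz] at h2
  have h3 : genFun φμ z ≠ 0 := by
    intro h4
    rw [h4, mul_zero] at h1
    exact (mul_ne_zero hθ (left_ne_zero_of_mul_eq_one h2)) h1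
  rw [kernel_natCast, whitener, ← hz, inv_mul_eq_iff_eq_mul₀ h3]
  linear_combination (-(geomPoly n μ).eval z * kernel n 1 θ) * h2 + (ev ψ z * kernel n 1 θ) * h1

end Kernel

/-! The projection of `∑ b(k) ξ⁽ⁿ⁾(k, μ)` on the past. -/

section Projection

variable {Ω : Type*} [MeasurableSpace Ω] {P : Measure Ω} {ξ : ℤ → Ω → ℂ} {n μ : ℕ} {f : ℝ → ℝ}
  {γ ψ : PowerSeries ℂ} {hξ : HasStationaryIncrements P n ξ} {ε : ℤ → Lp ℂ 2 P} {b φμ : ℕ → ℂ}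

/-- The error `∑ r(j) ε(j)`, where `r = D^μ A φ_μ`. -/
def innovSum (ε : ℤ → Lp ℂ 2 P) (r : ℕ → ℂ) : Lp ℂ 2 P := ∑' j : ℕ, r j • ε j

theorem hasSum_innovSum (hε : Orthonormal ℂ ε) {r : ℕ → ℂ} (hr : Summable fun j => ‖r j‖) :
    HasSum (fun j : ℕ => r j • ε j) (innovSum ε r) := by
  refine Summable.hasSum (Summable.of_norm (hr.congr fun j => ?_))
  rw [norm_smul, hε.1, mul_one]

theorem orthonormal_natCast (hε : Orthonormal ℂ ε) : Orthonormal ℂ fun j : ℕ => ε j :=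
  hε.comp _ Nat.cast_injective

theorem inner_innovSum_of_neg (hε : Orthonormal ℂ ε) {r : ℕ → ℂ} (hr : Summable fun j => ‖r j‖)
    {m : ℤ} (hm : m ≤ -1) : inner ℂ (innovSum ε r) (ε m) = 0 := by
  have h1 := (hasSum_innovSum hε hr).mapL (innerSL ℂ (ε m))
  have h2 : ∀ j : ℕ, innerSL ℂ (ε m) (r j • ε j) = 0 := by
    intro j
    rw [innerSL_apply_apply, inner_smul_right, hε.2 (by omega), mul_zero]
  simp only [h2] at h1
  rw [← inner_conj_symm, ← innerSL_apply_apply ℂ, h1.unique hasSum_zero, map_zero]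

namespace IsCanonicalMovingAverage

theorem incr_mem (hε : IsCanonicalMovingAverage hξ μ ε φμ) (hμ : 1 ≤ μ) (k : ℤ) :
    hξ.incr k μ ∈ pastOf ε k := by
  rw [← hε.innovation]
  exact Submodule.le_topologicalClosure _ (Submodule.subset_span ⟨k, μ, le_rfl, by omega, rfl⟩)

theorem inner_tsum (hε : IsCanonicalMovingAverage hξ μ ε φμ) (hμ : 1 ≤ μ)
    (hb : Summable fun k => ‖b k‖) (hφ : Summable fun k => ‖φμ k‖) (j : ℕ) :
    inner ℂ (ε j) (∑' k : ℕ, b k • hξ.incr k μ) = hankelMulVec b φμ j := by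
  have h1 := (summable_smul_incr hξ hb μ).hasSum.mapL (innerSL ℂ (ε j))
  rw [innerSL_apply_apply, ← (add_right_injective j).hasSum_iff] at h1
  · refine h1.unique ((hasSum_hankelMulVec hb hφ j).congr_fun fun i => ?_)
    have h2 := inner_hasSum hε.orthonormal (hε.hasSum ((j + i : ℕ) : ℤ)) i
    rw [show (((j + i : ℕ) : ℤ) - i) = j by push_cast; ring] at h2
    rw [Function.comp_apply, innerSL_apply_apply, inner_smul_right, h2]
  · intro k hk
    rw [innerSL_apply_apply, inner_smul_right, inner_eq_zero_of_mem_pastOf (fun m hm => ?_)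
      (hε.incr_mem hμ k), mul_zero]
    refine hε.orthonormal.2 ?_
    have : ¬ j ≤ k := fun h => hk ⟨k - j, by simp; omega⟩
    omega

theorem tsum_sub_innovSum_mem_past (hε : IsCanonicalMovingAverage hξ μ ε φμ) (hμ : 1 ≤ μ)
    (hb : Summable fun k => ‖b k‖) (hφ : Summable fun k => ‖φμ k‖) :
    (∑' k : ℕ, b k • hξ.incr k μ) - innovSum ε (hankelMulVec b φμ) ∈ hξ.past (-1) := by
  have hr := summable_norm_hankelMulVec hb hφ
  have hsum := hasSum_innovSum hε.orthonormal hr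
  rw [hε.innovation]
  refine mem_pastOf_of_inner_eq_zero hε.orthonormal (Submodule.sub_mem _ ?_ ?_) fun m hm => ?_
  · refine hasSum_mem_of_isClosed (Submodule.isClosed_topologicalClosure _)
      (summable_smul_incr hξ hb μ).hasSum fun k => Submodule.smul_mem _ _ ?_
    refine Submodule.topologicalClosure_mono (Submodule.span_mono ?_) (hε.incr_mem hμ k)
    rintro _ ⟨m, -, rfl⟩
    exact ⟨m, rfl⟩
  · refine hasSum_mem_of_isClosed (Submodule.isClosed_topologicalClosure _) hsum fun k =>
      Submodule.smul_mem _ _ (Submodule.le_topologicalClosure _ (Submodule.subset_span ⟨k, rfl⟩))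
  · lift m to ℕ using (by omega)
    rw [inner_sub_right, hε.inner_tsum hμ hb hφ,
      inner_of_hasSum (orthonormal_natCast hε.orthonormal) hsum, sub_self]

theorem summable_norm (h : IsOuterPair n f γ ψ) (hf : IsSpectralDensity P n ξ f) (hμ : 1 ≤ μ)
    (hε : IsCanonicalMovingAverage hξ μ ε φμ) : Summable fun k => ‖φμ k‖ := by
  obtain ⟨c, hc, -, h1⟩ := hε.exists_eq_smul h hf hμ
  refine ((h.absSummable_canonicalSeries μ).mul_left ‖c‖⁻¹).congr fun k => ?_
  rw [h1, norm_mul, inv_mul_cancel_left₀ (norm_ne_zero_iff.mpr hc)]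

theorem isStochasticIntegral (h : IsOuterPair n f γ ψ) (hf : IsSpectralDensity P n ξ f)
    (hμ : 1 ≤ μ) (hε : IsCanonicalMovingAverage hξ μ ε φμ) (hb : Summable fun k => ‖b k‖)
    {r : ℕ → ℂ} (hr : Summable fun j => ‖r j‖) {Z : Set ℝ → Lp ℂ 2 P}
    (hZ : IsSpectralRepresentation hξ f Z) :
    IsStochasticIntegral (spectralMeasure f) Z
      (fun θ => spectralCharacteristic b r φμ θ * kernel n μ θ)
      ((∑' k : ℕ, b k • hξ.incr k μ) - innovSum ε r) := by
  obtain ⟨c, -, hcε, hcφ⟩ := hε.exists_eq_smul h hf hμ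
  obtain ⟨T, hT, hTJ⟩ := hZ.exists_isometry h
  have hD := memLp_genFun_mul hb (h.memLp_kernel μ)
  have hR := memLp_genFun_mul hr h.isWhitening.memLp
  have h1 := (hasSum_waveLp hb (h.memLp_kernel μ)).mapL T.toContinuousLinearMap
  have h2 := ((hasSum_waveLp hr h.isWhitening.memLp).mapL T.toContinuousLinearMap).const_smul c
  simp only [map_smul, LinearIsometry.coe_toContinuousLinearMap, hT, map_waveLp_whitener h hT]
    at h1 h2
  simp only [smul_comm c, ← hcε] at h2
  have h3 : (fun θ => spectralCharacteristic b r φμ θ * kernel n μ θ) =ᵐ[spectralMeasure f]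
      (fun θ : ℝ => genFun b (Complex.exp (Complex.I * θ)) * kernel n μ θ) -
        c • fun θ : ℝ => genFun r (Complex.exp (Complex.I * θ)) * whitener n ψ θ := by
    refine (spectralMeasure_absolutelyContinuous f).ae_le ?_
    filter_upwards [ae_restrict_of_ae (ae_eval_geomPoly_ne_zero n hμ)] with θ hθ
    have h4 := kernel_mul_inv h hcφ hθ
    rw [Pi.sub_apply, Pi.smul_apply, smul_eq_mul, spectralCharacteristic]
    linear_combination (-genFun r (Complex.exp (Complex.I * θ))) * h4
  have hcR := hR.const_smul c
  rw [hTJ]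
  refine ⟨(hD.sub hcR).ae_eq h3.symm, ?_⟩
  rw [MemLp.toLp_congr _ (hD.sub hcR) h3, MemLp.toLp_sub hD hcR, MemLp.toLp_const_smul,
    map_sub, map_smul, h1.tsum_eq, (hasSum_innovSum hε.orthonormal hr).unique h2]

theorem norm_sq_innovSum (h : IsOuterPair n f γ ψ) (hε : IsCanonicalMovingAverage hξ μ ε φμ) {r : ℕ → ℂ}
    (hr : Summable fun j => ‖r j‖) : ‖innovSum ε r‖ ^ 2 = 1 / (2 * Real.pi) *
      ∫ θ in (-Real.pi)..Real.pi, ‖genFun r (Complex.exp (Complex.I * θ))‖ ^ 2 := by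
  rw [← h.isWhitening.norm_sq_genFun_mul hr]
  have h1 := hasSum_norm_sq (orthonormal_natCast hε.orthonormal)
    (hasSum_innovSum hε.orthonormal hr)
  have h2 := hasSum_norm_sq (orthonormal_natCast h.isWhitening.orthonormal)
    (hasSum_waveLp hr h.isWhitening.memLp)
  exact h1.unique h2

end IsCanonicalMovingAverage

end Projection

end StatIncr
end

noncomputable section
namespace StatIncr

/-! Optimal estimates. -/

section Optimality

variable {Ω : Type*} [MeasurableSpace Ω] {P : Measure Ω}

/-- An estimate whose error is orthogonal to its differences from the members of a class is the
unique optimal member. -/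
theorem isOptimalIn_iff {C : (Ω → ℂ) → Prop} {X Yh : Ω → ℂ} {e : Lp ℂ 2 P} (hC : C Yh)
    (hcongr : ∀ Y, Y =ᵐ[P] Yh → C Y) (he : (fun ω => X ω - Yh ω) =ᵐ[P] e)
    (horth : ∀ Y, C Y → ∃ x : Lp ℂ 2 P, inner ℂ e x = 0 ∧ (fun ω => Yh ω - Y ω) =ᵐ[P] x)
    (Y : Ω → ℂ) : IsOptimalIn P C X Y ↔ Y =ᵐ[P] Yh := by
  have hsum : ∀ {Y : Ω → ℂ} {x : Lp ℂ 2 P}, (fun ω => Yh ω - Y ω) =ᵐ[P] x →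
      eLpNorm (fun ω => X ω - Y ω) 2 P = ‖e + x‖ₑ := by
    intro Y x hx
    refine eLpNorm_eq_enorm ?_
    filter_upwards [he, hx, Lp.coeFn_add e x] with ω h1 h2 h3
    rw [h3, Pi.add_apply, ← h1, ← h2, sub_add_sub_cancel]
  have hpyth : ∀ {x : Lp ℂ 2 P}, inner ℂ e x = 0 → ‖e + x‖ * ‖e + x‖ = ‖e‖ * ‖e‖ + ‖x‖ * ‖x‖ :=
    fun {x} hx => norm_add_sq_eq_norm_sq_add_norm_sq_of_inner_eq_zero e x hx
  constructor
  · rintro ⟨hY, hmin⟩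
    obtain ⟨x, hx, hYx⟩ := horth Y hY
    have h1 := hmin Yh hC
    rw [hsum hYx, eLpNorm_eq_enorm he, enorm_le_iff_norm_le] at h1
    have h2 : x = 0 := by
      rw [← norm_eq_zero]
      nlinarith [hpyth hx, norm_nonneg x, norm_nonneg e, norm_nonneg (e + x)]
    filter_upwards [hYx, Lp.coeFn_zero ℂ 2 P] with ω h3 h4
    rw [h2, h4, Pi.zero_apply, sub_eq_zero] at h3
    exact h3.symm
  · intro hY
    refine ⟨hcongr Y hY, fun Y' hY' => ?_⟩
    obtain ⟨x, hx, hYx⟩ := horth Y' hY'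
    have h1 : (fun ω => X ω - Y ω) =ᵐ[P] e := by
      filter_upwards [he, hY] with ω h2 h3
      rw [h3, h2]
    rw [hsum hYx, eLpNorm_eq_enorm h1, enorm_le_iff_norm_le]
    nlinarith [hpyth hx, norm_nonneg x, norm_nonneg e, norm_nonneg (e + x)]

/-- The functions whose classes belong to a subspace of `L²(Ω)`. -/
def classesIn (K : Submodule ℂ (Lp ℂ 2 P)) : Submodule ℂ (Ω → ℂ) where
  carrier := {g | ∃ x ∈ K, g =ᵐ[P] x}
  add_mem' := by
    rintro g g' ⟨x, hx, h⟩ ⟨x', hx', h'⟩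
    exact ⟨x + x', K.add_mem hx hx', (h.add h').trans (Lp.coeFn_add x x').symm⟩
  zero_mem' := ⟨0, K.zero_mem, (Lp.coeFn_zero ℂ 2 P).symm⟩
  smul_mem' := by
    rintro c g ⟨x, hx, h⟩
    exact ⟨c • x, K.smul_mem c hx, (h.const_smul c).trans (Lp.coeFn_smul c x).symm⟩

theorem classesIn_mono {K K' : Submodule ℂ (Lp ℂ 2 P)} (h : K ≤ K') :
    classesIn K ≤ classesIn K' := fun _ ⟨x, hx, hg⟩ => ⟨x, h hx, hg⟩

variable {ξ : ℤ → Ω → ℂ} {n μ : ℕ}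

theorem HasStationaryIncrements.linComb_mem_past (hξ : HasStationaryIncrements P n ξ) (hn : 1 ≤ n)
    {c : ℤ →₀ ℂ} (hc : c ∈ incrementForms n) {t : ℤ} (ht : ∀ m ∈ c.support, m ≤ t) :
    linComb ξ c ∈ classesIn (hξ.past t) := by
  rw [linComb_eq_linearCombination]
  have h1 : Submodule.span ℂ {c | ∃ j ≤ t, c = incrementForm n j 1} ≤
      (classesIn (hξ.past t)).comap (Finsupp.linearCombination ℂ ξ) := by
    refine Submodule.span_le.mpr ?_
    rintro _ ⟨j, hj, rfl⟩
    rw [SetLike.mem_coe, Submodule.mem_comap, ← linComb_eq_linearCombination,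
      linComb_incrementForm]
    exact ⟨hξ.incr j 1, Submodule.le_topologicalClosure _
      (Submodule.subset_span ⟨j, 1, hj, one_pos, rfl⟩), (hξ.memLp j 1).coeFn_toLp.symm⟩
  exact h1 (mem_span_of_support_le hn hc ht)

theorem support_incrementForm_le {m ν t : ℤ} (hν : 0 < ν) (hm : m ≤ t) :
    incrementForm n m ν ∈ Finsupp.supported ℂ ℂ (Set.Iic t) := by
  refine Submodule.sum_mem _ fun l _ => Finsupp.single_mem_supported ℂ _ ?_
  have : 0 ≤ (l : ℤ) * ν := by positivity
  rw [Set.mem_Iic]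
  omega

theorem HasStationaryIncrements.exists_form_of_mem_span (hξ : HasStationaryIncrements P n ξ) {t : ℤ}
    {y : Lp ℂ 2 P}
    (hy : y ∈ Submodule.span ℂ {x | ∃ m ν : ℤ, m ≤ t ∧ 0 < ν ∧ x = hξ.incr m ν}) :
    ∃ c ∈ incrementForms n ⊓ Finsupp.supported ℂ ℂ (Set.Iic t), linComb ξ c =ᵐ[P] y := by
  simp only [linComb_eq_linearCombination]
  induction hy using Submodule.span_induction with
  | mem x hx =>
    obtain ⟨m, ν, hm, hν, rfl⟩ := hx
    refine ⟨incrementForm n m ν, ⟨Submodule.subset_span ⟨m, ν, rfl⟩,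
      support_incrementForm_le hν hm⟩, ?_⟩
    rw [← linComb_eq_linearCombination, linComb_incrementForm]
    exact (hξ.memLp m ν).coeFn_toLp.symm
  | zero => exact ⟨0, Submodule.zero_mem _, by rw [map_zero]; exact (Lp.coeFn_zero ℂ 2 P).symm⟩
  | add x x' _ _ h h' =>
    obtain ⟨c, hc, h1⟩ := h
    obtain ⟨c', hc', h1'⟩ := h'
    refine ⟨c + c', Submodule.add_mem _ hc hc', ?_⟩
    rw [map_add]
    exact (h1.add h1').trans (Lp.coeFn_add x x').symm
  | smul z x _ h =>
    obtain ⟨c, hc, h1⟩ := h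
    refine ⟨z • c, Submodule.smul_mem _ z hc, ?_⟩
    rw [map_smul]
    exact (h1.const_smul z).trans (Lp.coeFn_smul z x).symm

theorem HasStationaryIncrements.exists_forms_tendsto (hξ : HasStationaryIncrements P n ξ) {t : ℤ}
    {J : Lp ℂ 2 P} (hJ : J ∈ hξ.past t) :
    ∃ c : ℕ → ℤ →₀ ℂ, (∀ j, c j ∈ incrementForms n ⊓ Finsupp.supported ℂ ℂ (Set.Iic t)) ∧
      Tendsto (fun j => eLpNorm (fun ω => linComb ξ (c j) ω - J ω) 2 P) atTop (𝓝 0) := by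
  obtain ⟨y, hy, hlim⟩ := mem_closure_iff_seq_limit.mp hJ
  choose c hc hcy using fun j => hξ.exists_form_of_mem_span (hy j)
  refine ⟨c, hc, ?_⟩
  rw [Lp.tendsto_Lp_iff_tendsto_eLpNorm'] at hlim
  refine hlim.congr fun j => eLpNorm_congr_ae ?_
  filter_upwards [hcy j] with ω h1
  rw [Pi.sub_apply, h1]

variable {a b : ℕ → ℂ} {Aξ : Ω → ℂ}

/-- The estimate is a limit of linear forms in the observations, and the errors of the forms are
formed from increments. -/
theorem exists_estimate_forms (hmeas : ∀ m, AEStronglyMeasurable (ξ m) P)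
    (hξ : HasStationaryIncrements P n ξ) {ρ : ℕ → Fin n → ℂ}
    (hρ : ∀ N, remForm n μ a b N - startForm n (ρ N) ∈ incrementForms n)
    (hρ0 : Tendsto (fun N => eLpNorm (linComb ξ (startForm n (ρ N))) 2 P) atTop (𝓝 0))
    {J : Lp ℂ 2 P} (hJ : J ∈ hξ.past (-1)) :
    ∃ c : ℕ → ℤ →₀ ℂ, (∀ N, ∀ m ∈ (c N).support, m ≤ -1) ∧
      (∀ N, truncForm a N - c N ∈ incrementForms n) ∧
      Tendsto (fun N => eLpNorm (fun ω => linComb ξ (c N) ω - estimate n μ ξ b J ω) 2 P)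
        atTop (𝓝 0) := by
  obtain ⟨j, hj, hlim⟩ := hξ.exists_forms_tendsto hJ
  refine ⟨fun N => -vForm n μ b + startForm n (ρ N) + j N, fun N m hm => ?_, fun N => ?_, ?_⟩
  · have h1 : -vForm n μ b + startForm n (ρ N) + j N ∈ Finsupp.supported ℂ ℂ (Set.Iic (-1)) := by
      refine Submodule.add_mem _ (Submodule.add_mem _ (Submodule.neg_mem _ ?_) ?_) (hj N).2
      · intro m hm
        by_contra h
        rw [Set.mem_Iic] at h
        exact Finsupp.mem_support_iff.mp hm (vForm_apply_of_nonneg b (by omega))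
      · exact fun m hm => (startForm_support hm).2
    exact h1 hm
  · have h1 : truncForm a N - (-vForm n μ b + startForm n (ρ N) + j N) =
        (remForm n μ a b N - startForm n (ρ N)) +
          (∑ k ∈ Finset.range N, b k • incrementForm n k μ) - j N := by
      rw [remForm]
      abel
    rw [h1]
    refine Submodule.sub_mem _ (Submodule.add_mem _ (hρ N) (Submodule.sum_mem _ fun k _ =>
      Submodule.smul_mem _ _ (Submodule.subset_span ⟨k, μ, rfl⟩))) (hj N).1
  · have h2 := hρ0.add hlim
    rw [add_zero] at h2
    refine tendsto_of_tendsto_of_tendsto_of_le_of_le tendsto_const_nhds h2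
      (fun _ => zero_le) fun N => ?_
    have h3 : (fun ω => linComb ξ (-vForm n μ b + startForm n (ρ N) + j N) ω -
        estimate n μ ξ b J ω) = linComb ξ (startForm n (ρ N)) +
          fun ω => linComb ξ (j N) ω - J ω := by
      have h4 : linComb ξ (vForm n μ b) = fun ω =>
        ∑ i ∈ Finset.Icc 1 (μ * n), vCoeff n μ b i * ξ (-(i : ℤ)) ω := linComb_sum_single ξ _ _ _
      funext ω
      have h5 := congrFun h4 ω
      simp only [linComb_eq_linearCombination] at h5 ⊢
      simp only [map_add, map_neg, Pi.add_apply, Pi.neg_apply, estimate, ← h5]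
      ring
    rw [h3]
    exact eLpNorm_add_le (aestronglyMeasurable_linComb hmeas _)
      ((aestronglyMeasurable_linComb hmeas _).sub (Lp.aestronglyMeasurable J)) (by norm_num)

theorem tendsto_eLpNorm_sub {g g' : ℕ → Ω → ℂ} {y y' : Ω → ℂ}
    (hg : ∀ j, AEStronglyMeasurable (g j) P) (hg' : ∀ j, AEStronglyMeasurable (g' j) P)
    (hy : AEStronglyMeasurable y P) (hy' : AEStronglyMeasurable y' P)
    (h : Tendsto (fun j => eLpNorm (fun ω => g j ω - y ω) 2 P) atTop (𝓝 0))
    (h' : Tendsto (fun j => eLpNorm (fun ω => g' j ω - y' ω) 2 P) atTop (𝓝 0)) :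
    Tendsto (fun j => eLpNorm (fun ω => (g j ω - g' j ω) - (y ω - y' ω)) 2 P) atTop (𝓝 0) := by
  have h2 := h.add h'
  rw [add_zero] at h2
  refine tendsto_of_tendsto_of_tendsto_of_le_of_le tendsto_const_nhds h2 (fun _ => zero_le)
    fun j => ?_
  have h3 : (fun ω => (g j ω - g' j ω) - (y ω - y' ω)) =
      (fun ω => g j ω - y ω) - fun ω => g' j ω - y' ω := by
    funext ω
    simp only [Pi.sub_apply]
    ring
  rw [h3]
  exact eLpNorm_sub_le ((hg j).sub hy) ((hg' j).sub hy') (by norm_num)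

theorem linComb_sub {Ω : Type*} (ξ : ℤ → Ω → ℂ) (c c' : ℤ →₀ ℂ) :
    linComb ξ (c - c') = fun ω => linComb ξ c ω - linComb ξ c' ω := by
  simp only [linComb_eq_linearCombination, map_sub]
  rfl

theorem support_sub_le {c c' : ℤ →₀ ℂ} {t : ℤ} (hc : ∀ m ∈ c.support, m ≤ t)
    (hc' : ∀ m ∈ c'.support, m ≤ t) : ∀ m ∈ (c - c').support, m ≤ t := by
  have h : c - c' ∈ Finsupp.supported ℂ ℂ (Set.Iic t) := Submodule.sub_mem _ hc hc'
  exact h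

variable {c : ℕ → ℤ →₀ ℂ} {Yh Y : Ω → ℂ}

theorem IsIncrementEstimate.sub_mem (hn : 1 ≤ n) (hmeas : ∀ m, AEStronglyMeasurable (ξ m) P)
    (hξ : HasStationaryIncrements P n ξ) (hYh : AEStronglyMeasurable Yh P)
    (hsupp : ∀ N, ∀ m ∈ (c N).support, m ≤ -1)
    (hform : ∀ N, truncForm a N - c N ∈ incrementForms n)
    (hlim : Tendsto (fun N => eLpNorm (fun ω => linComb ξ (c N) ω - Yh ω) 2 P) atTop (𝓝 0))
    (hY : IsIncrementEstimate P n ξ a Y) :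
    (fun ω => Yh ω - Y ω) ∈ classesIn (hξ.past (-1)) := by
  obtain ⟨hYm, N, c', hN, hsupp', hform', hlim'⟩ := hY
  refine exists_mem_of_tendsto_eLpNorm (Submodule.isClosed_topologicalClosure _) (hYh.sub hYm)
    (g := fun j => linComb ξ (c (N j) - c' j)) (fun j => ?_) ?_
  · refine hξ.linComb_mem_past hn ?_ (support_sub_le (hsupp _) (hsupp' j))
    rw [← sub_sub_sub_cancel_left _ _ (truncForm a (N j))]
    exact Submodule.sub_mem _ (hform' j) (hform (N j))
  · simp only [linComb_sub]
    exact tendsto_eLpNorm_sub (fun j => aestronglyMeasurable_linComb hmeas _)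
      (fun j => aestronglyMeasurable_linComb hmeas _) hYh hYm (hlim.comp hN) hlim'

theorem OrthogonalStart.linComb_mem (h : OrthogonalStart P n ξ) (hξ : HasStationaryIncrements P n ξ)
    (hn : 1 ≤ n) {t : ℤ} {e : Lp ℂ 2 P} (he : ∀ x ∈ hξ.past t, inner ℂ e x = 0)
    (he' : e ∈ (Submodule.span ℂ (Set.range fun p : ℤ × ℤ =>
      hξ.incr p.1 p.2)).topologicalClosure) (ht : -1 ≤ t)
    {d : ℤ →₀ ℂ} (hd : ∀ m ∈ d.support, m ≤ t) : linComb ξ d ∈ classesIn (Submodule.span ℂ {e})ᗮ := by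
  obtain ⟨ρ, hρ⟩ := exists_startForm_sub_mem n d
  have h1 : linComb ξ (d - startForm n ρ) ∈ classesIn (Submodule.span ℂ {e})ᗮ := by
    refine classesIn_mono (fun x hx => ?_) (hξ.linComb_mem_past hn hρ
      (support_sub_le hd fun m hm => (startForm_support hm).2.trans ht))
    exact Submodule.mem_orthogonal_singleton_iff_inner_right.mpr (he x hx)
  have h2 : linComb ξ (startForm n ρ) ∈ classesIn (Submodule.span ℂ {e})ᗮ := by
    rw [linComb_eq_linearCombination, linearCombination_startForm]
    refine Submodule.sum_mem _ fun i _ => Submodule.smul_mem _ _ ?_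
    obtain ⟨hm, horth⟩ := h (-(i : ℤ) - 1) (by omega) (by omega)
    refine ⟨hm.toLp, ?_, hm.coeFn_toLp.symm⟩
    rw [Submodule.mem_orthogonal_singleton_iff_inner_left]
    refine inner_eq_zero_of_mem_closure_span ?_ he'
    rintro _ ⟨⟨m, ν⟩, rfl⟩
    change inner ℂ _ (hξ.incr m ν) = 0
    rw [← inner_conj_symm, HasStationaryIncrements.incr, inner_toLp, horth, map_zero]
  have h3 := Submodule.add_mem _ h1 h2
  rw [linComb_eq_linearCombination, linComb_eq_linearCombination, ← map_add, sub_add_cancel,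
    ← linComb_eq_linearCombination] at h3
  exact h3

theorem IsLinearEstimate.sub_mem (hmeas : ∀ m, AEStronglyMeasurable (ξ m) P)
    {K : Submodule ℂ (Lp ℂ 2 P)} (hK : IsClosed (K : Set (Lp ℂ 2 P)))
    (hKξ : ∀ d : ℤ →₀ ℂ, (∀ m ∈ d.support, m ≤ -1) → linComb ξ d ∈ classesIn K)
    (hYh : AEStronglyMeasurable Yh P) (hsupp : ∀ N, ∀ m ∈ (c N).support, m ≤ -1)
    (hlim : Tendsto (fun N => eLpNorm (fun ω => linComb ξ (c N) ω - Yh ω) 2 P) atTop (𝓝 0))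
    (hY : IsLinearEstimate P ξ Y) : (fun ω => Yh ω - Y ω) ∈ classesIn K := by
  obtain ⟨hYm, c', hsupp', hlim'⟩ := hY
  refine exists_mem_of_tendsto_eLpNorm hK (hYh.sub hYm)
    (g := fun j => linComb ξ (c j - c' j)) (fun j => ?_) ?_
  · exact hKξ _ (support_sub_le (hsupp _) (hsupp' j))
  · simp only [linComb_sub]
    exact tendsto_eLpNorm_sub (fun j => aestronglyMeasurable_linComb hmeas _)
      (fun j => aestronglyMeasurable_linComb hmeas _) hYh hYm hlim hlim'

theorem innovSum_mem_closure (hξ : HasStationaryIncrements P n ξ) {ε : ℤ → Lp ℂ 2 P}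
    {φμ : ℕ → ℂ} (hε : IsCanonicalMovingAverage hξ μ ε φμ) {r : ℕ → ℂ}
    (hr : Summable fun j => ‖r j‖) : innovSum ε r ∈ (Submodule.span ℂ (Set.range fun p : ℤ × ℤ =>
      hξ.incr p.1 p.2)).topologicalClosure := by
  refine hasSum_mem_of_isClosed (Submodule.isClosed_topologicalClosure _)
    (hasSum_innovSum hε.orthonormal hr) fun k => Submodule.smul_mem _ _ ?_
  have h1 : ε k ∈ hξ.past k := hε.innovation k ▸ mem_pastOf le_rfl
  refine Submodule.topologicalClosure_mono (Submodule.span_mono ?_) h1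
  rintro _ ⟨m, ν, -, -, rfl⟩
  exact ⟨(m, ν), rfl⟩

theorem aestronglyMeasurable_estimate (hmeas : ∀ m, AEStronglyMeasurable (ξ m) P) (b : ℕ → ℂ)
    (J : Lp ℂ 2 P) : AEStronglyMeasurable (estimate n μ ξ b J) P :=
  AEStronglyMeasurable.add (AEStronglyMeasurable.neg
    (Finset.aestronglyMeasurable_fun_sum _ fun _ _ => (hmeas _).const_mul _))
    (Lp.aestronglyMeasurable J)

end Optimality

end StatIncr

end

open StatIncr in
theorem theorem3p2 {Ω : Type*} [MeasurableSpace Ω] (P : Measure Ω) [IsProbabilityMeasure P]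
    (n μ : ℕ) (hn : 1 ≤ n) (hμ : 1 ≤ μ)
    (ξ : ℤ → Ω → ℂ) (hmeas : ∀ m, AEStronglyMeasurable (ξ m) P)
    (hξ : HasStationaryIncrements P n ξ)
    (hmean : ∀ m ν : ℤ, ∫ ω, increment n ξ m ν ω ∂P = 0)
    (f : ℝ → ℝ) (hf : IsSpectralDensity P n ξ f)
    (φ : ℕ → ℂ) (hφ : IsCanonicalFactorization f φ)
    (a b : ℕ → ℂ) (hb : IsMulVec (dMatrix n μ) a b)
    (hb₁ : Summable fun k => ‖b k‖)
    (hb₂ : Summable fun k : ℕ => ((k : ℝ) + 1) * ‖b k‖ ^ 2)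
    (Aξ : Ω → ℂ) (hA : IsFunctional P ξ a Aξ) :
    (∃ Z : Set ℝ → Lp ℂ 2 P, IsSpectralRepresentation hξ f Z) ∧
    (∃ (ε : ℤ → Lp ℂ 2 P) (φμ : ℕ → ℂ), IsCanonicalMovingAverage hξ μ ε φμ) ∧
    ∀ Z : Set ℝ → Lp ℂ 2 P, IsSpectralRepresentation hξ f Z →
    ∀ (ε : ℤ → Lp ℂ 2 P) (φμ : ℕ → ℂ), IsCanonicalMovingAverage hξ μ ε φμ →
    ∃ (DA : ℕ → ℕ → ℂ) (r : ℕ → ℂ) (J : Lp ℂ 2 P),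
      IsMatMul (dMatrix n μ) (hankel a) DA ∧ IsMulVec DA φμ r ∧
      (Summable fun k => ‖φμ k‖) ∧ (Summable fun k => ‖r k‖) ∧
      IsStochasticIntegral (spectralMeasure f) Z
        (fun θ => spectralCharacteristic b r φμ θ * kernel n μ θ) J ∧
      (∀ Y : Ω → ℂ, IsOptimalIn P (IsIncrementEstimate P n ξ a) Aξ Y ↔
        Y =ᵐ[P] estimate n μ ξ b J) ∧
      (OrthogonalStart P n ξ → ∀ Y : Ω → ℂ, IsOptimalIn P (IsLinearEstimate P ξ) Aξ Y ↔
        Y =ᵐ[P] estimate n μ ξ b J) ∧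
      MemLp (fun ω => Aξ ω - estimate n μ ξ b J ω) 2 P ∧
      ∫ ω, ‖Aξ ω - estimate n μ ξ b J ω‖ ^ 2 ∂P =
        1 / (2 * Real.pi) *
          ∫ θ in (-Real.pi)..Real.pi, ‖genFun r (Complex.exp (Complex.I * θ))‖ ^ 2 ∧
      HasSum (fun j => ‖r j‖ ^ 2) (∫ ω, ‖Aξ ω - estimate n μ ξ b J ω‖ ^ 2 ∂P)
  := by
  obtain ⟨γ, ψ, h⟩ := exists_isOuterPair hφ n
  refine ⟨h.exists_spectralRepresentation hξ hf, ⟨_, _, h.isCanonicalMovingAverage hf hmean μ⟩,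
    fun Z hZ ε φμ hε => ?_⟩
  have hφμ := hε.summable_norm h hf hμ
  have hr := summable_norm_hankelMulVec hb₁ hφμ
  set r := hankelMulVec b φμ
  set e := innovSum ε r
  set J : Lp ℂ 2 P := (∑' k : ℕ, b k • hξ.incr k μ) - e with hJdef
  have hJ : J ∈ hξ.past (-1) := hε.tsum_sub_innovSum_mem_past hμ hb₁ hφμ
  obtain ⟨ρ, hρ, hR, hρ0⟩ := exists_reduction hn hμ hmeas hξ h hf hb hb₁ hA
  obtain ⟨c, hsupp, hform, hlim⟩ := exists_estimate_forms (μ := μ) (b := b) hmeas hξ hρ hρ0 hJ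
  have hest := aestronglyMeasurable_estimate (n := n) (μ := μ) hmeas b J
  have herr : (fun ω => Aξ ω - estimate n μ ξ b J ω) =ᵐ[P] e := by
    filter_upwards [functional_add_ae_eq hmeas hξ hb₁ hA hR,
      Lp.coeFn_sub (∑' k : ℕ, b k • hξ.incr k μ : Lp ℂ 2 P) e] with ω h1 h2
    rw [estimate, hJdef, h2, Pi.sub_apply, ← h1]
    ring
  have horth : ∀ x ∈ hξ.past (-1), inner ℂ e x = 0 := by
    intro x hx
    rw [hε.innovation] at hx
    exact inner_eq_zero_of_mem_pastOf (fun m hm => inner_innovSum_of_neg hε.orthonormal hr hm) hx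
  have hint := norm_sq_eq_integral herr
  refine ⟨_, r, J, isMatMul_hankel hb, isMulVec_hankelMulVec hb₁ hφμ, hφμ, hr,
    hε.isStochasticIntegral h hf hμ hb₁ hr hZ, fun Y => ?_, fun hstart Y => ?_,
    (Lp.memLp e).ae_eq herr.symm, ?_, ?_⟩
  · refine isOptimalIn_iff ⟨hest, id, c, tendsto_id, hsupp, hform, hlim⟩ (fun Y hY => ?_) herr
      (fun Y hY => ?_) Y
    · refine ⟨hest.congr hY.symm, id, c, tendsto_id, hsupp, hform, hlim.congr fun N =>
        eLpNorm_congr_ae ?_⟩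
      filter_upwards [hY] with ω h1
      rw [h1]
    · obtain ⟨x, hx, hxY⟩ := hY.sub_mem hn hmeas hξ hest hsupp hform hlim
      exact ⟨x, horth x hx, hxY⟩
  · refine isOptimalIn_iff ⟨hest, c, hsupp, hlim⟩ (fun Y hY => ?_) herr (fun Y hY => ?_) Y
    · refine ⟨hest.congr hY.symm, c, hsupp, hlim.congr fun N => eLpNorm_congr_ae ?_⟩
      filter_upwards [hY] with ω h1
      rw [h1]
    · obtain ⟨x, hx, hxY⟩ := hY.sub_mem hmeas (Submodule.isClosed_orthogonal _)
        (fun d hd => hstart.linComb_mem hξ hn horth (innovSum_mem_closure hξ hε hr) le_rfl hd)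
        hest hsupp hlim
      exact ⟨x, Submodule.mem_orthogonal_singleton_iff_inner_right.mp hx, hxY⟩
  · rw [hint, hε.norm_sq_innovSum h hr]
  · rw [hint]
    exact hasSum_norm_sq (orthonormal_natCast hε.orthonormal) (hasSum_innovSum hε.orthonormal hr)
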